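/- Let $d,m\ge 0$ be integers, $S$ a finite set, $\Omega=S^{\mathbb Z^{d+1}}$ with the product $\sigma$-algebra, $(\tau_x\sigma)(y)=\sigma(y+x)$, and $\Lambda_n=\{-n,\dots,n\}^{d+1}$, $n\ge 0$. *Transformations.* Let $\pi_n:\Omega\to\Omega$, $n\ge 0$, be such that inside $\Lambda_n$ the configuration $\pi_n\sigma$ depends only on $\sigma|_{\Lambda_n}$, $\pi_n\sigma=\sigma$ outside $\Lambda_n$, $\pi_n\circ\pi_n=\mathrm{id}$, $\pi_n\sigma=\pi_k\sigma$ on $\Lambda_n$ for $n\le k$, and, for some additive automorphism $\theta$ of $\mathbb Z^{d+1}$, $(\pi_n\tau_x\sigma)(y)=(\pi_k\sigma)(y+\theta x)$ whenever $y\in\Lambda_n$ and $y+\theta x\in\Lambda_k$. (Examples: spin flip, with $\theta=\mathrm{id}$; time reversal, with $\theta$ the reflection of the time axis.) For finite $A\subset\mathbb Z^{d+1}$ let $n(A)$ be the least $n$ with $A\subset\Lambda_n$. Put $(\pi U)_A=U_A\circ\pi_{n(A)}$ for a potential $U$, and let $\pi\mu$ be the measure with $\pi\mu(f)=\mu(f\circ\pi_n)$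 for all $f$ depending only on the spins in $\Lambda_n$. *Potentials.* Let $U^0,\dots,U^m$ be potentials: $U^\alpha_A:\Omega\to\mathbb R$ depends only on the spins in the finite set $A$, $U^\alpha_\emptyset=0$, $U^\alpha_{A+x}=U^\alpha_A\circ\tau_x$, and $\sum_{A\ni 0}\|U^\alpha_A\|<\infty$, where $\|\cdot\|$ is the supremum norm. Assume $U^0_A\circ\pi_n=U^0_A$ whenever $A\subset\Lambda_n$. Let $E^1,\dots,E^m\in\mathbb R$, $U=U^0+\sum_{\alpha=1}^mE^\alpha U^\alpha$, $\beta>0$, and let the currents be $$J^\alpha_x=\lim_{n}\sum_{x\in A\subset\Lambda_n}\frac1{2|A|}\bigl(U^\alpha_A\circ\pi_{n(A)}-U^\alpha_A\bigr).$$ *Densities.* With $\mu_n[\sigma]$ the $\mu$-probability of the configuration $\sigma$ in $\Lambda_n$, let $$s(\mu|\rho)=\lim_n\frac1{|\Lambda_n|}\sum_{\sigma\in S^{\Lambda_n}}\mu_n[\sigma]\ln\frac{\mu_n[\sigma]}{\rho_n[\sigma]},\qquad P(V)=\lim_n\frac1{|\Lambda_n|}\ln\sum_{\sigma\in S^{\Lambda_n}}\exp\Bigl[-\beta\sum_{A\subset\Lambda_n}V_A(\sigma)\Bigr],$$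 where $s(\mu|\rho)$ requires that $\rho_n[\sigma]=0$ implies $\mu_n[\sigma]=0$. **Proposition.** Let $\mu$ be a translation-invariant Gibbs probability measure for $U$ at inverse temperature $\beta$, with $\mu\neq\pi\mu$, and suppose that $\pi U$ is not physically equivalent to $U$, i.e. that the relative energies $\sum_A(U_A(\sigma)-U_A(\eta))$ and $\sum_A((\pi U)_A(\sigma)-(\pi U)_A(\eta))$ do not coincide for all pairs $\sigma,\eta$ that differ at finitely many sites. Then the limits defining $J^\alpha_x$ (uniformly on $\Omega$), $s(\pi\mu|\mu)$, $s(\mu|\pi\mu)$ and $P(U+t(\pi U-U))$, $t\in\mathbb R$, exist, and $$s(\pi\mu|\mu)=s(\mu|\pi\mu)=2\beta\sum_{\alpha=1}^mE^\alpha\mu(J^\alpha_0)>0 .$$ If $t\mapsto P(U+t(\pi U-U))$ is differentiable at $t=0$, then $$\sum_{\alpha=1}^mE^\alpha\mu(J_0^\alpha)=-\frac1{2\beta}\,\frac{\partial}{\partial t}P(U+t(\pi U-U))\Big|_{t=0}.$$ This differentiability, and hence the last formula, holds if $$\beta\sum_{A\ni0}(|A|-1)\Bigl(\|U^0_A\|+\sum_{\alpha=1}^m|E^\alpha|\,\|U_A^\alpha\|\Bigr)<1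 .$$ -/

import Mathlib

open MeasureTheory Filter Topology

noncomputable section

/-- The lattice `ℤ^(d+1)`. -/
abbrev Site (d : ℕ) : Type := Fin (d + 1) → ℤ

/-- Space-time configurations `σ : ℤ^(d+1) → S`, with the product sigma-algebra. -/
abbrev Config (d : ℕ) (S : Type*) : Type _ := Site d → S

/-- Translations: `(τ_x σ)(y) = σ(y + x)`. -/
def shift {d : ℕ} {S : Type*} (x : Site d) (σ : Config d S) : Config d S := fun y => σ (y + x)

/-- The cube `Λ_n = {-n, …, n}^(d+1)` centred at the origin. -/
def cube (d n : ℕ) : Finset (Site d) := Finset.Icc (fun _ => -(n : ℤ)) (fun _ => (n : ℤ))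

/-- `n(A)`: the index of the smallest centred cube that contains `A`. -/
def cubeIndex {d : ℕ} (A : Finset (Site d)) : ℕ := sInf {n | A ⊆ cube d n}

open Classical in
/-- The configuration `σ_Λ ξ_{Λᶜ}`, equal to `σ` on `Λ` and to `ξ` off `Λ`. -/
def glue {d : ℕ} {S : Type*} (Λ : Finset (Site d)) (σ : Λ → S) (ξ : Config d S) : Config d S :=
  fun x => if h : x ∈ Λ then σ ⟨x, h⟩ else ξ x

/-- A family of local involutions `π_n` of the configurations in the cubes `Λ_n`, consistent for
growing cubes and compatible with translations. -/
structure InvolutionFamily (d : ℕ) (S : Type*) where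
  /-- The transformation `π_n`, as a map on all configurations. -/
  map : ℕ → Config d S → Config d S
  /-- Inside `Λ_n`, `π_n σ` is a function of `σ` restricted to `Λ_n`. -/
  map_local : ∀ n (σ η : Config d S), (∀ x ∈ cube d n, σ x = η x) →
    ∀ x ∈ cube d n, map n σ x = map n η x
  /-- Outside `Λ_n` nothing is changed. -/
  map_outside : ∀ n (σ : Config d S), ∀ x ∉ cube d n, map n σ x = σ x
  /-- `π_n ∘ π_n = 1`. -/
  map_map : ∀ n (σ : Config d S), map n (map n σ) = σ
  /-- `π_n` and `π_k` agree on the smaller of the two cubes. -/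
  map_consistent : ∀ n k, n ≤ k → ∀ (σ : Config d S), ∀ x ∈ cube d n, map n σ x = map k σ x
  /-- Translation covariance. With `θ = id` it says that the translated transformation
  `τ_x⁻¹ π_n τ_x` on `Λ_n + x` agrees with `π_k` on `(Λ_n + x) ∩ Λ_k`, as for the spin flip; a
  reflection `θ` of the lattice is allowed in order to include the reversal of the time axis. -/
  map_shift : ∃ θ : Site d ≃+ Site d, ∀ n k (x y : Site d) (σ : Config d S),
    y ∈ cube d n → y + θ x ∈ cube d k → map n (shift x σ) y = map k σ (y + θ x)

/-- A family of functions of the configuration, one for each finite set of sites. -/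
abbrev Interaction (d : ℕ) (S : Type*) : Type _ := Finset (Site d) → Config d S → ℝ

/-- The uniform norm `‖f‖ = sup_σ |f σ|`. -/
def unifNorm {d : ℕ} {S : Type*} (f : Config d S → ℝ) : ℝ := ⨆ σ, |f σ|

/-- Translation-invariant, uniformly absolutely summable interaction potentials. -/
structure IsPotential {d : ℕ} {S : Type*} (U : Interaction d S) : Prop where
  /-- `U_∅ = 0`. -/
  empty : ∀ σ, U ∅ σ = 0
  /-- `U_A` depends only on the spins in `A`. -/
  dep : ∀ A σ η, (∀ x ∈ A, σ x = η x) → U A σ = U A η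
  /-- `U_{A+x}(η) = U_A(τ_x η)`. -/
  invariant : ∀ (A : Finset (Site d)) (x : Site d) (η : Config d S),
    U (A.map (addRightEmbedding x)) η = U A (shift x η)
  /-- `∑_{A ∋ 0} ‖U_A‖ < ∞`. -/
  summable : Summable fun A : {A : Finset (Site d) // (0 : Site d) ∈ A} => unifNorm (U A.1)

/-- The relative energy `H(σ) - H(η) = ∑_A (U_A(σ) - U_A(η))`
(used for configurations that differ at finitely many sites only). -/
def relEnergy {d : ℕ} {S : Type*} (U : Interaction d S) (σ η : Config d S) : ℝ :=
  ∑' A, (U A σ - U A η)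

/-- Physical equivalence: the same relative energy for all pairs of configurations that differ at
finitely many sites. -/
def PhysicallyEquivalent {d : ℕ} {S : Type*} (U V : Interaction d S) : Prop :=
  ∀ σ η : Config d S, {x | σ x ≠ η x}.Finite → relEnergy U σ η = relEnergy V σ η

/-- The potential `U = U⁰ + ∑_α E^α U^α`. -/
def totalPotential {d m : ℕ} {S : Type*} (U₀ : Interaction d S) (U : Fin m → Interaction d S)
    (E : Fin m → ℝ) : Interaction d S :=
  fun A σ => U₀ A σ + ∑ α, E α * U α A σ

section Measures

variable {d : ℕ} {S : Type*} [MeasurableSpace S]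

/-- The event that the configuration is `σ` on `Λ`. -/
def cylinderEvent (Λ : Finset (Site d)) (σ : Λ → S) : Set (Config d S) :=
  {ω | ∀ x : Λ, ω x = σ x}

/-- Translation invariance of a measure. -/
def IsShiftInvariant (μ : Measure (Config d S)) : Prop := ∀ x : Site d, μ.map (shift x) = μ

/-- Gibbs measures at inverse temperature `β`: for all finite `Λ` and all `σ, η` on `Λ`,
`μ[X = σ on Λ | X = ξ off Λ] = exp(-β (H(σξ) - H(ηξ))) μ[X = η on Λ | X = ξ off Λ]`
for `μ`-almost every `ξ`. -/
def IsGibbs (β : ℝ) (U : Interaction d S) (μ : Measure (Config d S)) : Prop :=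
  ∀ (Λ : Finset (Site d)) (σ η : Λ → S), ∀ᵐ ξ ∂μ,
    (μ[(cylinderEvent Λ σ).indicator (fun _ => (1 : ℝ)) |
        cylinderEvents (X := fun _ : Site d => S) ((Λ : Set (Site d))ᶜ)]) ξ =
      Real.exp (-β * relEnergy U (glue Λ σ ξ) (glue Λ η ξ)) *
        (μ[(cylinderEvent Λ η).indicator (fun _ => (1 : ℝ)) |
          cylinderEvents (X := fun _ : Site d => S) ((Λ : Set (Site d))ᶜ)]) ξ

/-- The probability `μ_n[σ]` of the configuration `σ` in the cube `Λ_n`. -/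
def cubeProb (μ : Measure (Config d S)) (n : ℕ) (σ : cube d n → S) : ℝ :=
  μ.real (cylinderEvent (cube d n) σ)

/-- `s(μ|ρ) = s`: the relative entropy density
`lim_n |Λ_n|⁻¹ ∑_σ μ_n[σ] log (μ_n[σ] / ρ_n[σ])` is defined and equal to `s`. -/
def HasRelEntropyDensity [Fintype S] (μ ρ : Measure (Config d S)) (s : ℝ) : Prop :=
  (∀ n (σ : cube d n → S), cubeProb ρ n σ = 0 → cubeProb μ n σ = 0) ∧
  Tendsto (fun n : ℕ => (1 / ((cube d n).card : ℝ)) *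
    ∑ σ : cube d n → S, cubeProb μ n σ * Real.log (cubeProb μ n σ / cubeProb ρ n σ)) atTop (𝓝 s)

end Measures

section FreeEnergy

variable {d : ℕ} {S : Type*} [Fintype S] [Nonempty S]

/-- `|Λ_n|⁻¹ log ∑_{σ on Λ_n} exp(-β ∑_{A ⊆ Λ_n} V_A(σ))`. For the `V` of interest, `V_A` with
`A ⊆ Λ_n` depends on the spins in `Λ_n` only, so that the spins off `Λ_n` are immaterial. -/
def cubeFreeEnergy (β : ℝ) (V : Interaction d S) (n : ℕ) : ℝ :=
  (1 / ((cube d n).card : ℝ)) * Real.log (∑ σ : cube d n → S,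
    Real.exp (-β * ∑ A ∈ (cube d n).powerset,
      V A (glue (cube d n) σ fun _ => Classical.arbitrary S)))

/-- The free energy density `P(V)`. -/
def freeEnergy (β : ℝ) (V : Interaction d S) : ℝ := limUnder atTop (cubeFreeEnergy β V)

end FreeEnergy

namespace InvolutionFamily

variable {d : ℕ} {S : Type*} (T : InvolutionFamily d S)

/-- The transformed interaction `(πU)_A = π_{n(A)} U_A`. -/
def potential (U : Interaction d S) : Interaction d S := fun A σ => U A (T.map (cubeIndex A) σ)

/-- The transformation of infinite configurations that agrees with `π_n` inside each `Λ_n`. -/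
def globalMap (σ : Config d S) : Config d S := fun x => T.map (cubeIndex {x}) σ x

/-- The transformed measure: `πμ(f) = μ(f ∘ π_n)` for all `f` that depend only on the spins
in `Λ_n`. -/
def measure [MeasurableSpace S] (μ : Measure (Config d S)) : Measure (Config d S) :=
  μ.map T.globalMap

open Classical in
/-- `∑_{x ∈ A ⊆ Λ_n} (2|A|)⁻¹ (π_{n(A)} U_A - U_A)`. -/
def cubeCurrent (U : Interaction d S) (x : Site d) (n : ℕ) (σ : Config d S) : ℝ :=
  ∑ A ∈ (cube d n).powerset with x ∈ A,
    (1 / (2 * (A.card : ℝ))) * (U A (T.map (cubeIndex A) σ) - U A σ)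

/-- The current `J_x` associated to `U`: the limit of the preceding sums as `n → ∞`. -/
def current (U : Interaction d S) (x : Site d) (σ : Config d S) : ℝ :=
  limUnder atTop fun n => T.cubeCurrent U x n σ

/-- `t ↦ P(U + t (πU - U))`. -/
def freeEnergyPath [Fintype S] [Nonempty S] (β : ℝ) (U : Interaction d S) (t : ℝ) : ℝ :=
  freeEnergy β fun A σ => U A σ + t * (T.potential U A σ - U A σ)

end InvolutionFamily

/-- The small-potential condition
`β ∑_{A ∋ 0} (|A| - 1) (‖U⁰_A‖ + ∑_α |E^α| ‖U^α_A‖) < 1`. -/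
def IsSmall {d m : ℕ} {S : Type*} (β : ℝ) (U₀ : Interaction d S) (U : Fin m → Interaction d S)
    (E : Fin m → ℝ) : Prop :=
  (Summable fun A : {A : Finset (Site d) // (0 : Site d) ∈ A} =>
    ((A.1.card : ℝ) - 1) * (unifNorm (U₀ A.1) + ∑ α, |E α| * unifNorm (U α A.1))) ∧
  β * ∑' A : {A : Finset (Site d) // (0 : Site d) ∈ A},
    ((A.1.card : ℝ) - 1) * (unifNorm (U₀ A.1) + ∑ α, |E α| * unifNorm (U α A.1)) < 1

end

/-! Write πμ for `T.measure μ`, H_n for `cubeEnergy` and e_V for `siteEnergy V`, in which each site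
of A receives the share V_A/|A|. Covariance forces every involution family to act as (πσ)(θx) =
φ(σ(x)), with θ preserving all centred cubes, once S has two elements
(`InvolutionFamily.exists_isImplementedBy`); μ ≠ πμ excludes smaller S. Hence πμ is translation
invariant and Gibbs for πU, re-indexed by θ so that it is again a potential (`reflected`). The
integrated Gibbs property `GibbsSwap` makes this transport a change of variables.

Entropy: the Gibbs property gives ln(μ_n[σ]/μ_n[πσ]) = β(H_n(πσ) - H_n(σ)) up to boundary terms
(`GibbsSwap.abs_log_div_le`), and these are o(|Λ_n|) (`IsWeight.tendsto_boundarySum`). As (πμ)_n[σ]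
= μ_n[πσ], the relative entropy per site tends to β μ(e_{πU} - e_U). This is 2β ∑ E^α μ(J^α_0),
since U⁰ cancels (`sum_mul_current`). The substitution σ ↦ πσ exchanges the two relative entropies
exactly in every cube.

Positivity (`GibbsSwap.relEntropy_ge`): if U and πU assign different relative energies to some σ, η,
then g = 1_σ - c 1_η in a large enough cube has, for suitable c, nonpositive mean under πμ whatever
happens outside the cube, but positive mean under μ. Insert a small multiple l of the sum of g over
disjoint translates into the Donsker–Varadhan bound. The gain is of order l per translate and the
cost of order l², so the relative entropy grows like the number of translates, that is, like the
volume. No independence is needed, only a bound uniform in the exterior.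

Derivative: Jensen's inequality makes -β μ(e_V - e_U) a lower bound for P(V) - P(U)
(`GibbsSwap.freeEnergy_tangent`). Along V = U + t(πU - U) this is a supporting line at t = 0, so
differentiability identifies its slope with the derivative. For small potentials Dobrushin's
uniqueness condition holds in every cube, uniformly in n. It yields a second-order expansion of the
log partition function with error proportional to |Λ_n|
(`DobrushinCondition.abs_log_sum_exp_sub_le`), which survives the thermodynamic limit and gives
differentiability. -/

section Lattice

/-! ### Cubes, their volumes and tilings of large cubes by small ones -/

variable {d : ℕ}

theorem mem_cube {n : ℕ} {x : Site d} : x ∈ cube d n ↔ ∀ i, |x i| ≤ (n : ℤ) := by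
  simp only [cube, Finset.mem_Icc, Pi.le_def, abs_le, forall_and]

theorem zero_mem_cube (n : ℕ) : (0 : Site d) ∈ cube d n := by simp [mem_cube]

theorem cube_mono {n k : ℕ} (h : n ≤ k) : cube d n ⊆ cube d k := fun x hx =>
  mem_cube.2 fun i => (mem_cube.1 hx i).trans (by exact_mod_cast h)

theorem add_mem_cube {n k : ℕ} {x y : Site d} (hx : x ∈ cube d n) (hy : y ∈ cube d k) :
    x + y ∈ cube d (n + k) := by
  rw [mem_cube] at *
  intro i
  push_cast
  exact (abs_add_le _ _).trans (add_le_add (hx i) (hy i))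

theorem exists_mem_cube (x : Site d) : ∃ n, x ∈ cube d n := by
  refine ⟨∑ i, (x i).natAbs, mem_cube.2 fun i => ?_⟩
  rw [Int.abs_eq_natAbs]
  exact_mod_cast Finset.single_le_sum (f := fun i => (x i).natAbs) (fun _ _ => Nat.zero_le _)
    (Finset.mem_univ i)

theorem exists_subset_cube (A : Finset (Site d)) : ∃ n, A ⊆ cube d n := by
  choose f hf using exists_mem_cube (d := d)
  exact ⟨A.sup f, fun x hx => cube_mono (Finset.le_sup hx) (hf x)⟩

theorem subset_cube_cubeIndex (A : Finset (Site d)) : A ⊆ cube d (cubeIndex A) :=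
  Nat.sInf_mem (s := {n | A ⊆ cube d n}) (exists_subset_cube A)

theorem cubeIndex_le {A : Finset (Site d)} {n : ℕ} (h : A ⊆ cube d n) : cubeIndex A ≤ n :=
  Nat.sInf_le h

theorem card_cube (d n : ℕ) : (cube d n).card = (2 * n + 1) ^ (d + 1) := by
  unfold cube
  rw [Pi.card_Icc]
  simp
  omega

theorem card_cube_pos (d n : ℕ) : 0 < ((cube d n).card : ℝ) := by
  rw [card_cube]
  positivity

theorem tendsto_powerset_cube : Tendsto (fun n => (cube d n).powerset) atTop atTop := by
  refine tendsto_atTop_finset_of_monotone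
    (fun n k h => Finset.powerset_mono.2 (cube_mono h)) fun A => ?_
  obtain ⟨n, hn⟩ := exists_subset_cube A
  exact ⟨n, Finset.mem_powerset.2 hn⟩

/-- Volumes of cubes are powers of side lengths, so a bounded error in the side does not affect the
leading order of the volume. -/
theorem tendsto_ratio_pow {f : ℕ → ℕ} {c : ℝ}
    (hf : ∀ᶠ n in atTop, |(f n : ℝ) - (2 * n + 1)| ≤ c) (e : ℕ) :
    Tendsto (fun n : ℕ => ((f n ^ e : ℕ) : ℝ) / ((2 * n + 1) ^ e : ℕ)) atTop (𝓝 1) := by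
  have h : Tendsto (fun n : ℕ => (f n : ℝ) / (2 * n + 1)) atTop (𝓝 1) := by
    have h1 : Tendsto (fun n : ℕ => ((2 * n + 1 : ℕ) : ℝ)) atTop atTop :=
      tendsto_natCast_atTop_atTop.comp
        (tendsto_atTop_mono (fun n => by simp only [id]; omega) tendsto_id)
    have h2 : Tendsto (fun n : ℕ => c / ((2 * n + 1 : ℕ) : ℝ)) atTop (𝓝 0) :=
      tendsto_const_nhds.div_atTop h1
    rw [tendsto_iff_norm_sub_tendsto_zero]
    refine squeeze_zero' (Eventually.of_forall fun _ => norm_nonneg _) ?_ h2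
    filter_upwards [hf] with n hn
    have hp : (0 : ℝ) < 2 * n + 1 := by positivity
    rw [Real.norm_eq_abs, div_sub_one hp.ne', abs_div, abs_of_pos hp]
    push_cast
    gcongr
  simpa [div_pow] using h.pow e

theorem tendsto_card_cube_sub (k : ℕ) :
    Tendsto (fun n => ((cube d (n - k)).card : ℝ) / (cube d n).card) atTop (𝓝 1) := by
  simp only [card_cube]
  refine tendsto_ratio_pow (f := fun n => 2 * (n - k) + 1) (c := 2 * k) ?_ _
  filter_upwards [eventually_ge_atTop k] with n hn
  push_cast [Nat.cast_sub hn]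
  rw [show (2 * ((n : ℝ) - k) + 1 - (2 * n + 1)) = -(2 * k) by ring, abs_neg, abs_of_nonneg]
  positivity

/-- Centres of pairwise disjoint shiftSets of `Λ_k` inside `Λ_n`. -/
noncomputable def tiles (d k n : ℕ) : Finset (Site d) :=
  -- The quotient is the largest q with (2k+1)q + k ≤ n. For k > n the truncated subtraction would
  -- leave the centre 0, whose cube does not fit, hence the case distinction.
  if k ≤ n then (cube d ((n - k) / (2 * k + 1))).image fun z => (2 * k + 1 : ℤ) • z else ∅

theorem card_tiles {k n : ℕ} (h : k ≤ n) :
    (tiles d k n).card = (2 * ((n - k) / (2 * k + 1)) + 1) ^ (d + 1) := by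
  rw [tiles, if_pos h, Finset.card_image_of_injective, card_cube]
  exact smul_right_injective _ (by omega)

theorem add_mem_of_mem_tiles {k n : ℕ} {x y : Site d} (hx : x ∈ tiles d k n)
    (hy : y ∈ cube d k) : y + x ∈ cube d n := by
  unfold tiles at hx
  split_ifs at hx with h
  · obtain ⟨z, hz, rfl⟩ := Finset.mem_image.1 hx
    rw [mem_cube] at *
    intro i
    have h1 := hy i
    have h2 := hz i
    have h3 : (2 * k + 1) * ((n - k) / (2 * k + 1)) ≤ n - k := Nat.mul_div_le _ _
    have h4 : |((2 * k + 1 : ℤ) • z) i| ≤ n - k := by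
      rw [Pi.smul_apply, smul_eq_mul, abs_mul, abs_of_nonneg (by positivity)]
      calc (2 * k + 1 : ℤ) * |z i| ≤ (2 * k + 1) * (((n - k) / (2 * k + 1) : ℕ) : ℤ) := by gcongr
        _ ≤ ((n - k : ℕ) : ℤ) := by exact_mod_cast h3
        _ = n - k := by push_cast [Nat.cast_sub h]; ring
    rw [Pi.add_apply]
    have := abs_add_le (y i) (((2 * k + 1 : ℤ) • z) i)
    linarith
  · simp at hx

theorem eq_of_mem_tiles {k n : ℕ} {x x' y y' : Site d} (hx : x ∈ tiles d k n)
    (hx' : x' ∈ tiles d k n) (hy : y ∈ cube d k) (hy' : y' ∈ cube d k)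
    (h : y + x = y' + x') : x = x' := by
  unfold tiles at hx hx'
  split_ifs at hx hx' with hk
  · obtain ⟨z, -, rfl⟩ := Finset.mem_image.1 hx
    obtain ⟨z', -, rfl⟩ := Finset.mem_image.1 hx'
    congr 1
    ext i
    have h1 := abs_le.1 (mem_cube.1 hy i)
    have h2 := abs_le.1 (mem_cube.1 hy' i)
    have h3 := congrFun h i
    simp only [Pi.add_apply, Pi.smul_apply, smul_eq_mul] at h3
    have h4 : (2 * (k : ℤ) + 1) * (z i - z' i) = y' i - y i := by linear_combination h3
    have h5 : |(2 * (k : ℤ) + 1)| * |z i - z' i| ≤ 2 * k := by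
      rw [← abs_mul, h4, abs_le]
      constructor <;> linarith
    rw [abs_of_nonneg (by positivity)] at h5
    by_contra hne
    have h6 : 1 ≤ |z i - z' i| := Int.one_le_abs (sub_ne_zero.2 hne)
    nlinarith
  · simp at hx

theorem tendsto_card_tiles (k : ℕ) :
    Tendsto (fun n => ((tiles d k n).card * (cube d k).card : ℝ) / (cube d n).card)
      atTop (𝓝 1) := by
  -- The tiled region is a cube whose side falls short of 2n+1 by at most 4k+2; the constant 6k+2 is
  -- a generous bound.
  have h := tendsto_ratio_pow
    (f := fun n => (2 * ((n - k) / (2 * k + 1)) + 1) * (2 * k + 1)) (c := 6 * k + 2) ?_ (d + 1)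
  · refine h.congr' ?_
    filter_upwards [eventually_ge_atTop k] with n hn
    rw [card_tiles hn, card_cube, card_cube, mul_pow]
    push_cast
    rfl
  · filter_upwards [eventually_ge_atTop k] with n hn
    have h1 : (2 * k + 1) * ((n - k) / (2 * k + 1)) ≤ n - k := Nat.mul_div_le _ _
    have h2 : n - k < (2 * k + 1) * ((n - k) / (2 * k + 1)) + (2 * k + 1) :=
      Nat.lt_mul_div_succ _ (by omega)
    set q := (n - k) / (2 * k + 1)
    have h1' : (2 * k + 1 : ℝ) * q ≤ n - k := by
      have : (((2 * k + 1) * q : ℕ) : ℝ) ≤ (n - k : ℕ) := by exact_mod_cast h1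
      push_cast [Nat.cast_sub hn] at this
      linarith
    have h2' : (n - k : ℝ) ≤ (2 * k + 1) * q + (2 * k + 1) := by
      have : ((n - k : ℕ) : ℝ) ≤ ((2 * k + 1) * q + (2 * k + 1) : ℕ) := by exact_mod_cast h2.le
      push_cast [Nat.cast_sub hn] at this
      linarith
    rw [abs_le]
    push_cast
    have : (0 : ℝ) ≤ k := by positivity
    constructor <;> nlinarith

/-! ### Summable weights on finite sets; boundary terms are negligible per site -/

/-- Nonnegative, translation-invariant weights of the finite sets, summable over the sets that
contain the origin. -/
structure IsWeight (N : Finset (Site d) → ℝ) : Prop where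
  nonneg : ∀ A, 0 ≤ N A
  invariant : ∀ (A : Finset (Site d)) (x : Site d), N (A.map (addRightEmbedding x)) = N A
  summable : Summable ({A : Finset (Site d) | 0 ∈ A}.indicator N)

/-- The sum of a function over the finite sets that contain `x`. -/
noncomputable def starSum (f : Finset (Site d) → ℝ) (x : Site d) : ℝ :=
  ∑' A, {A : Finset (Site d) | x ∈ A}.indicator f A

/-- The sum of a function over the finite sets that contain `x` and leave `Λ_n`. -/
noncomputable def tailSum (f : Finset (Site d) → ℝ) (n : ℕ) (x : Site d) : ℝ :=
  ∑' A, {A : Finset (Site d) | x ∈ A ∧ ¬ A ⊆ cube d n}.indicator f A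

/-- The contribution of the sets that meet `Λ_n` and its complement. -/
noncomputable def boundarySum (f : Finset (Site d) → ℝ) (n : ℕ) : ℝ :=
  ∑ x ∈ cube d n, tailSum f n x

/-- Translation of finite sets. -/
def shiftSet (x : Site d) : Finset (Site d) ≃ Finset (Site d) :=
  (Equiv.addRight x).finsetCongr

theorem shiftSet_apply (x : Site d) (A : Finset (Site d)) :
    shiftSet x A = A.map (addRightEmbedding x) := rfl

theorem mem_shiftSet {x y : Site d} {A : Finset (Site d)} : y ∈ shiftSet x A ↔ y - x ∈ A := by
  rw [shiftSet_apply, Finset.mem_map]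
  constructor
  · rintro ⟨z, hz, rfl⟩
    simpa using hz
  · exact fun h => ⟨_, h, by simp⟩

theorem card_shiftSet (x : Site d) (A : Finset (Site d)) : (shiftSet x A).card = A.card :=
  Finset.card_map _

theorem indicator_comp_shiftSet {f : Finset (Site d) → ℝ} {x : Site d}
    (hf : ∀ A, f (shiftSet x A) = f A) (s : Set (Finset (Site d))) :
    s.indicator f ∘ shiftSet x = (shiftSet x ⁻¹' s).indicator f := by
  ext A
  by_cases h : shiftSet x A ∈ s <;> simp [Set.indicator, h, hf]

theorem preimage_shiftSet_star (x : Site d) :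
    shiftSet x ⁻¹' {A : Finset (Site d) | x ∈ A} = {A | 0 ∈ A} := by
  ext A
  simp [mem_shiftSet]

theorem summable_star {f : Finset (Site d) → ℝ} (hf : ∀ x A, f (shiftSet x A) = f A)
    (hs : Summable ({A : Finset (Site d) | 0 ∈ A}.indicator f)) (x : Site d) :
    Summable ({A : Finset (Site d) | x ∈ A}.indicator f) := by
  rw [← (shiftSet x).summable_iff, indicator_comp_shiftSet (hf x), preimage_shiftSet_star]
  exact hs

theorem starSum_eq {f : Finset (Site d) → ℝ} (hf : ∀ x A, f (shiftSet x A) = f A)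
    (x : Site d) : starSum f x = starSum f 0 := by
  unfold starSum
  rw [← (shiftSet x).tsum_eq]
  change ∑' A, ({A : Finset (Site d) | x ∈ A}.indicator f ∘ shiftSet x) A = _
  rw [indicator_comp_shiftSet (hf x), preimage_shiftSet_star]

theorem IsWeight.comp_shiftSet {N : Finset (Site d) → ℝ} (h : IsWeight N) (x : Site d)
    (A : Finset (Site d)) : N (shiftSet x A) = N A := h.invariant A x

theorem IsWeight.indicator_nonneg {N : Finset (Site d) → ℝ} (h : IsWeight N)
    (s : Set (Finset (Site d))) (A : Finset (Site d)) : 0 ≤ s.indicator N A :=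
  Set.indicator_nonneg (fun A _ => h.nonneg A) A

theorem IsWeight.summable_star {N : Finset (Site d) → ℝ} (h : IsWeight N) (x : Site d) :
    Summable ({A : Finset (Site d) | x ∈ A}.indicator N) :=
  _root_.summable_star h.comp_shiftSet h.summable x

theorem IsWeight.summable_of_subset {N : Finset (Site d) → ℝ} (h : IsWeight N) {x : Site d}
    {s : Set (Finset (Site d))} (hs : ∀ A ∈ s, x ∈ A) : Summable (s.indicator N) :=
  (h.summable_star x).of_nonneg_of_le (h.indicator_nonneg s)
    fun A => Set.indicator_le_indicator_of_subset (fun A hA => hs A hA) h.nonneg A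

theorem IsWeight.tsum_le_tsum {N : Finset (Site d) → ℝ} (h : IsWeight N) {x : Site d}
    {s t : Set (Finset (Site d))} (hst : s ⊆ t) (ht : ∀ A ∈ t, x ∈ A) :
    ∑' A, s.indicator N A ≤ ∑' A, t.indicator N A :=
  Summable.tsum_le_tsum (Set.indicator_le_indicator_of_subset hst h.nonneg)
    (h.summable_of_subset fun A hA => ht A (hst hA)) (h.summable_of_subset ht)

theorem IsWeight.tailSum_nonneg {N : Finset (Site d) → ℝ} (h : IsWeight N) (n : ℕ) (x : Site d) :
    0 ≤ tailSum N n x := tsum_nonneg (h.indicator_nonneg _)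

theorem IsWeight.boundarySum_nonneg {N : Finset (Site d) → ℝ} (h : IsWeight N) (n : ℕ) :
    0 ≤ boundarySum N n := Finset.sum_nonneg fun _ _ => h.tailSum_nonneg _ _

theorem IsWeight.starSum_eq {N : Finset (Site d) → ℝ} (h : IsWeight N) (x : Site d) :
    starSum N x = starSum N 0 := _root_.starSum_eq h.comp_shiftSet x

theorem IsWeight.tailSum_le_starSum {N : Finset (Site d) → ℝ} (h : IsWeight N) (n : ℕ)
    (x : Site d) : tailSum N n x ≤ starSum N 0 := by
  rw [← h.starSum_eq x]
  exact h.tsum_le_tsum (fun A hA => hA.1) fun A hA => hA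

/-- After translation by -x, a set through x that leaves Λ_n becomes a set through 0 that leaves
Λ_k, because x + Λ_k lies inside Λ_n. -/
theorem IsWeight.tailSum_le {N : Finset (Site d) → ℝ} (h : IsWeight N) {n k : ℕ} {x : Site d}
    (hx : ∀ y ∈ cube d k, y + x ∈ cube d n) : tailSum N n x ≤ tailSum N k 0 := by
  unfold tailSum
  rw [← (shiftSet x).tsum_eq]
  change ∑' A, ({A : Finset (Site d) | x ∈ A ∧ ¬ A ⊆ cube d n}.indicator N ∘ shiftSet x) A ≤ _
  rw [indicator_comp_shiftSet (h.comp_shiftSet x)]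
  refine h.tsum_le_tsum (x := 0) (fun A hA => ?_) fun A hA => hA.1
  obtain ⟨h1, h2⟩ := hA
  refine ⟨by simpa [mem_shiftSet] using h1, fun h3 => h2 fun y hy => ?_⟩
  simpa using hx _ (h3 (mem_shiftSet.1 hy))

theorem tendsto_tailSum_zero {f : Finset (Site d) → ℝ}
    (hf : Summable ({A : Finset (Site d) | 0 ∈ A}.indicator f)) :
    Tendsto (fun n => tailSum f n 0) atTop (𝓝 0) := by
  have h1 : Tendsto (fun n => starSum f 0 -
      ∑ A ∈ (cube d n).powerset, {A : Finset (Site d) | 0 ∈ A}.indicator f A) atTop (𝓝 0) := by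
    rw [← sub_self (starSum f 0)]
    exact tendsto_const_nhds.sub (hf.hasSum.comp tendsto_powerset_cube)
  refine h1.congr fun n => ?_
  rw [starSum, ← hf.sum_add_tsum_compl (s := (cube d n).powerset), add_sub_cancel_left, tailSum,
    tsum_subtype (((cube d n).powerset : Set (Finset (Site d)))ᶜ)
      ({A : Finset (Site d) | 0 ∈ A}.indicator f)]
  congr 1
  ext A
  rw [Set.indicator_indicator]
  congr 1
  ext B
  simp [and_comm]

theorem IsWeight.tendsto_tailSum {N : Finset (Site d) → ℝ} (h : IsWeight N) (x : Site d) :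
    Tendsto (fun n => tailSum N n x) atTop (𝓝 0) := by
  obtain ⟨b, hb⟩ := exists_mem_cube x
  refine squeeze_zero' (Eventually.of_forall fun n => h.tailSum_nonneg n x) ?_
    ((tendsto_tailSum_zero h.summable).comp (tendsto_sub_atTop_nat b))
  filter_upwards [eventually_ge_atTop b] with n hn
  refine h.tailSum_le fun y hy => ?_
  have := add_mem_cube hy hb
  rwa [Nat.sub_add_cancel hn] at this

/-- Sites of the core Λ_{n-k} have room k around them and hence a small tail; the remaining shell is
bounded crudely by its size. Fixing k first and then letting n → ∞ makes both terms small. -/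
theorem IsWeight.boundarySum_le {N : Finset (Site d) → ℝ} (h : IsWeight N) {n k : ℕ}
    (hk : k ≤ n) : boundarySum N n / (cube d n).card ≤ tailSum N k 0 +
      starSum N 0 * (1 - ((cube d (n - k)).card : ℝ) / (cube d n).card) := by
  have hp := card_cube_pos d n
  rw [div_le_iff₀ hp]
  have hsub := cube_mono (d := d) (Nat.sub_le n k)
  unfold boundarySum
  rw [← Finset.sum_sdiff hsub]
  have h1 : ∑ x ∈ cube d n \ cube d (n - k), tailSum N n x ≤
      (((cube d n).card : ℝ) - (cube d (n - k)).card) * starSum N 0 := by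
    rw [← Nat.cast_sub (Finset.card_le_card hsub), ← Finset.card_sdiff_of_subset hsub,
      ← nsmul_eq_mul]
    exact Finset.sum_le_card_nsmul _ _ _ fun x _ => h.tailSum_le_starSum n x
  have h2 : ∑ x ∈ cube d (n - k), tailSum N n x ≤ (cube d n).card * tailSum N k 0 := by
    calc _ ≤ ((cube d (n - k)).card : ℝ) * tailSum N k 0 := by
          rw [← nsmul_eq_mul]
          refine Finset.sum_le_card_nsmul _ _ _ fun x hx => h.tailSum_le fun y hy => ?_
          have := add_mem_cube hy hx
          rwa [Nat.add_sub_cancel' hk] at this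
      _ ≤ _ := mul_le_mul_of_nonneg_right (by exact_mod_cast Finset.card_le_card hsub)
          (h.tailSum_nonneg _ _)
  have h3 : (tailSum N k 0 + starSum N 0 * (1 - ((cube d (n - k)).card : ℝ) / (cube d n).card)) *
      (cube d n).card = (((cube d n).card : ℝ) - (cube d (n - k)).card) * starSum N 0 +
        (cube d n).card * tailSum N k 0 := by
    field_simp
    ring
  rw [h3]
  exact add_le_add h1 h2

theorem IsWeight.tendsto_boundarySum {N : Finset (Site d) → ℝ} (h : IsWeight N) :
    Tendsto (fun n => boundarySum N n / (cube d n).card) atTop (𝓝 0) := by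
  rw [Metric.tendsto_atTop]
  intro ε hε
  obtain ⟨k, hk⟩ := ((tendsto_tailSum_zero h.summable).eventually
    (gt_mem_nhds (half_pos hε))).exists
  have h1 : Tendsto (fun n => tailSum N k 0 +
      starSum N 0 * (1 - ((cube d (n - k)).card : ℝ) / (cube d n).card)) atTop
      (𝓝 (tailSum N k 0 + starSum N 0 * (1 - 1))) :=
    tendsto_const_nhds.add (tendsto_const_nhds.mul (tendsto_const_nhds.sub
      (tendsto_card_cube_sub k)))
  have h2 : tailSum N k 0 + starSum N 0 * (1 - 1) < ε := by linarith
  obtain ⟨n₀, hn₀⟩ := eventually_atTop.1 (h1.eventually (gt_mem_nhds h2))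
  refine ⟨max n₀ k, fun n hn => ?_⟩
  rw [Real.dist_eq, sub_zero, abs_of_nonneg (div_nonneg (h.boundarySum_nonneg n)
    (card_cube_pos d n).le)]
  exact (h.boundarySum_le (le_of_max_le_right hn)).trans_lt (hn₀ n (le_of_max_le_left hn))

end Lattice

/-! ### Functions of finitely many spins, cylinder events and translations -/

section LocalFunctions

variable {d : ℕ} {S : Type*}

theorem glue_restrict (Λ : Finset (Site d)) (σ ξ : Config d S) :
    glue Λ (fun x => σ x) ξ = Λ.piecewise σ ξ := by
  ext x
  simp [glue, Finset.piecewise]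

theorem glue_apply_mem {Λ : Finset (Site d)} {x : Site d} (hx : x ∈ Λ) (σ : Λ → S)
    (ξ : Config d S) : glue Λ σ ξ x = σ ⟨x, hx⟩ := by
  simp [glue, hx]

theorem glue_apply_notMem {Λ : Finset (Site d)} {x : Site d} (hx : x ∉ Λ) (σ : Λ → S)
    (ξ : Config d S) : glue Λ σ ξ x = ξ x := by
  simp [glue, hx]

theorem dependsOn_glue {Λ : Finset (Site d)} {f : Config d S → ℝ} (hf : DependsOn f Λ)
    (ξ σ : Config d S) : f (glue Λ (fun x => σ x) ξ) = f σ :=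
  hf fun _ hx => glue_apply_mem hx _ _

theorem finite_range_of_dependsOn [Finite S] {Λ : Finset (Site d)} {f : Config d S → ℝ}
    (hf : DependsOn f Λ) : (Set.range f).Finite := by
  rcases isEmpty_or_nonempty (Config d S) with h | ⟨⟨ξ⟩⟩
  · rw [Set.range_eq_empty]
    exact Set.finite_empty
  · refine (Set.finite_range fun σ : Λ → S => f (glue Λ σ ξ)).subset ?_
    rintro _ ⟨σ, rfl⟩
    exact ⟨fun x => σ x, dependsOn_glue hf ξ σ⟩

theorem abs_le_unifNorm_of_dependsOn [Finite S] {Λ : Finset (Site d)} {f : Config d S → ℝ}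
    (hf : DependsOn f Λ) (σ : Config d S) : |f σ| ≤ unifNorm f := by
  refine le_ciSup (f := fun σ => |f σ|) (Set.Finite.bddAbove ?_) σ
  exact finite_range_of_dependsOn (f := fun σ => |f σ|) fun σ η h => congrArg _ (hf h)

theorem unifNorm_nonneg (f : Config d S → ℝ) : 0 ≤ unifNorm f :=
  Real.iSup_nonneg fun _ => abs_nonneg _

theorem unifNorm_le {f : Config d S → ℝ} {c : ℝ} (hc : 0 ≤ c) (h : ∀ σ, |f σ| ≤ c) :
    unifNorm f ≤ c := Real.iSup_le h hc

theorem unifNorm_comp {f : Config d S → ℝ} {g : Config d S → Config d S}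
    (hg : Function.Surjective g) : unifNorm (fun σ => f (g σ)) = unifNorm f :=
  hg.iSup_comp (fun σ => |f σ|)

theorem measurable_of_dependsOn [Finite S] [MeasurableSpace S] [DiscreteMeasurableSpace S]
    {Λ : Finset (Site d)} {f : Config d S → ℝ} (hf : DependsOn f Λ) : Measurable f := by
  rcases isEmpty_or_nonempty (Config d S) with h | ⟨⟨ξ⟩⟩
  · exact measurable_of_empty f
  · have h : f = (fun σ : Λ → S => f (glue Λ σ ξ)) ∘ fun σ x => σ x := by
      ext σ
      exact (dependsOn_glue hf ξ σ).symm
    rw [h]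
    exact (Measurable.of_discrete).comp (measurable_pi_lambda _ fun _ => measurable_pi_apply _)

theorem integrable_of_dependsOn [Finite S] [MeasurableSpace S] [DiscreteMeasurableSpace S]
    {Λ : Finset (Site d)} {f : Config d S → ℝ} (hf : DependsOn f Λ)
    (ρ : Measure (Config d S)) [IsFiniteMeasure ρ] : Integrable f ρ :=
  Integrable.of_bound (measurable_of_dependsOn hf).aestronglyMeasurable (unifNorm f)
    (Eventually.of_forall fun σ => abs_le_unifNorm_of_dependsOn hf σ)

theorem measurableSet_cylinderEvent [MeasurableSpace S] [DiscreteMeasurableSpace S]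
    (Λ : Finset (Site d)) (σ : Λ → S) : MeasurableSet (cylinderEvent Λ σ) := by
  have : cylinderEvent Λ σ = ⋂ x : Λ, (fun ω : Config d S => ω x) ⁻¹' {σ x} := by
    ext ω
    simp [cylinderEvent]
  rw [this]
  exact MeasurableSet.iInter fun x => measurable_pi_apply _ (MeasurableSet.of_discrete)

open Classical in
theorem sum_indicator_cylinderEvent [Fintype S] (Λ : Finset (Site d)) (ω : Config d S)
    (F : (Λ → S) → ℝ) :
    ∑ σ : Λ → S, (cylinderEvent Λ σ).indicator (fun _ => F σ) ω = F fun x => ω x := by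
  rw [Finset.sum_eq_single (fun x : Λ => ω x)]
  · exact Set.indicator_of_mem (s := cylinderEvent Λ _) (fun _ => rfl) _
  · intro σ _ hσ
    exact Set.indicator_of_notMem (s := cylinderEvent Λ σ)
      (fun h => hσ (funext fun x => (h x).symm)) _
  · simp

theorem integral_of_dependsOn [Fintype S] [MeasurableSpace S] [DiscreteMeasurableSpace S]
    {Λ : Finset (Site d)} {f : Config d S → ℝ} (hf : DependsOn f Λ)
    (ρ : Measure (Config d S)) [IsFiniteMeasure ρ] (ξ : Config d S) :
    ∫ ω, f ω ∂ρ = ∑ σ : Λ → S, ρ.real (cylinderEvent Λ σ) * f (glue Λ σ ξ) := by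
  have h : ∀ ω, f ω = ∑ σ : Λ → S, (cylinderEvent Λ σ).indicator (fun _ => f (glue Λ σ ξ)) ω := by
    intro ω
    rw [sum_indicator_cylinderEvent Λ ω fun σ => f (glue Λ σ ξ), dependsOn_glue hf]
  rw [integral_congr_ae (Eventually.of_forall h), integral_finsetSum]
  · refine Finset.sum_congr rfl fun σ _ => ?_
    rw [integral_indicator_const _ (measurableSet_cylinderEvent Λ σ), smul_eq_mul]
  · exact fun σ _ => (integrable_const _).indicator (measurableSet_cylinderEvent Λ σ)

theorem measurable_shift [MeasurableSpace S] (x : Site d) :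
    Measurable (shift x : Config d S → Config d S) :=
  measurable_pi_lambda _ fun _ => measurable_pi_apply _

theorem shift_shift (x y : Site d) (σ : Config d S) :
    shift x (shift y σ) = shift (x + y) σ := by
  ext z
  simp [shift, add_assoc]

theorem shift_zero (σ : Config d S) : shift 0 σ = σ := by
  ext z
  simp [shift]

theorem surjective_shift (x : Site d) : Function.Surjective (shift x : Config d S → Config d S) :=
  fun σ => ⟨shift (-x) σ, by rw [shift_shift, add_neg_cancel, shift_zero]⟩

theorem DependsOn.comp_shift {s : Set (Site d)} {f : Config d S → ℝ} (hf : DependsOn f s)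
    (x : Site d) : DependsOn (fun σ => f (shift x σ)) {z | z - x ∈ s} :=
  fun σ η h => hf fun y hy => h (y + x) (by simpa using hy)

theorem DependsOn.finset_sum' {ι : Type*} {s : Set (Site d)} {X : Finset ι}
    {f : ι → Config d S → ℝ} (h : ∀ i ∈ X, DependsOn (f i) s) :
    DependsOn (fun σ => ∑ i ∈ X, f i σ) s :=
  fun _ _ hση => Finset.sum_congr rfl fun i hi => h i hi hση

theorem DependsOn.finset_prod' {ι : Type*} {s : Set (Site d)} {X : Finset ι}
    {f : ι → Config d S → ℝ} (h : ∀ i ∈ X, DependsOn (f i) s) :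
    DependsOn (fun σ => ∏ i ∈ X, f i σ) s :=
  fun _ _ hση => Finset.prod_congr rfl fun i hi => h i hi hση

/-- Disjointness of the tiles. It allows products over tiles to be integrated by splitting off one
factor at a time. -/
theorem dependsOn_prod_tiles {k n : ℕ} {f : Config d S → ℝ} (hf : DependsOn f (cube d k))
    {X : Finset (Site d)} (hX : X ⊆ tiles d k n) {x : Site d} (hx : x ∈ tiles d k n)
    (hxX : x ∉ X) :
    DependsOn (fun σ => ∏ y ∈ X, f (shift y σ))
      ((cube d n).filter fun z => z - x ∉ cube d k : Finset (Site d)) := by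
  refine DependsOn.finset_prod' fun y hy => ((DependsOn.comp_shift hf y).mono fun z hz => ?_)
  rw [Finset.coe_filter]
  refine ⟨by simpa using add_mem_of_mem_tiles (hX hy) hz, fun hzx => hxX ?_⟩
  rwa [eq_of_mem_tiles hx (hX hy) hzx hz (by simp)]

end LocalFunctions

/-! ### Energies in cubes and the energy per site -/

section Potentials

variable {d : ℕ} {S : Type*}

theorem IsPotential.dependsOn {V : Interaction d S} (hV : IsPotential V)
    (A : Finset (Site d)) : DependsOn (V A) A := fun σ η h => hV.dep A σ η h

theorem IsPotential.abs_le [Finite S] {V : Interaction d S} (hV : IsPotential V)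
    (A : Finset (Site d)) (σ : Config d S) : |V A σ| ≤ unifNorm (V A) :=
  abs_le_unifNorm_of_dependsOn (hV.dependsOn A) σ

theorem IsPotential.isWeight {V : Interaction d S} (hV : IsPotential V) :
    IsWeight fun A => unifNorm (V A) where
  nonneg A := unifNorm_nonneg _
  invariant A x := by
    have : V (A.map (addRightEmbedding x)) = fun σ => V A (shift x σ) :=
      funext fun σ => hV.invariant A x σ
    rw [this]
    exact unifNorm_comp (surjective_shift x)
  summable := summable_subtype_iff_indicator.1 hV.summable

theorem IsPotential.lin_comb [Finite S] {V W : Interaction d S} (hV : IsPotential V)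
    (hW : IsPotential W) (a b : ℝ) : IsPotential fun A σ => a * V A σ + b * W A σ where
  empty σ := by simp [hV.empty, hW.empty]
  dep A σ η h := by rw [hV.dep A σ η h, hW.dep A σ η h]
  invariant A x η := by rw [hV.invariant, hW.invariant]
  summable := by
    refine Summable.of_nonneg_of_le (fun A => unifNorm_nonneg _) (fun A => ?_)
      ((hV.summable.mul_left |a|).add (hW.summable.mul_left |b|))
    have h1 := unifNorm_nonneg (V A.1)
    have h2 := unifNorm_nonneg (W A.1)
    refine unifNorm_le (by positivity) fun σ => ?_
    refine (abs_add_le _ _).trans ?_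
    rw [abs_mul, abs_mul]
    gcongr
    exacts [hV.abs_le _ _, hW.abs_le _ _]

/-- The energy `∑_{A ⊆ Λ_n} V_A` in the cube `Λ_n` with free boundary conditions. -/
noncomputable def cubeEnergy (V : Interaction d S) (n : ℕ) (σ : Config d S) : ℝ :=
  ∑ A ∈ (cube d n).powerset, V A σ

/-- The energy per site `∑_{A ∋ 0} V_A / |A|`. -/
noncomputable def siteEnergy (V : Interaction d S) (σ : Config d S) : ℝ :=
  starSum (fun A => V A σ / A.card) 0

theorem IsPotential.dependsOn_cubeEnergy {V : Interaction d S} (hV : IsPotential V) (n : ℕ) :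
    DependsOn (cubeEnergy V n) (cube d n) :=
  DependsOn.finset_sum' fun A hA => (hV.dependsOn A).mono (Finset.mem_powerset.1 hA)

theorem abs_div_card_le (a : ℝ) (A : Finset (Site d)) : |a / A.card| ≤ |a| := by
  rw [abs_div, Nat.abs_cast]
  rcases A.card.eq_zero_or_pos with h | h
  · simp [h]
  · exact div_le_self (abs_nonneg _) (by exact_mod_cast h)

theorem IsPotential.norm_indicator_div_card_le [Finite S] {V : Interaction d S}
    (hV : IsPotential V) (s : Set (Finset (Site d))) (σ : Config d S) (A : Finset (Site d)) :
    ‖s.indicator (fun A => V A σ / (A.card : ℝ)) A‖ ≤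
      s.indicator (fun A => unifNorm (V A)) A := by
  rw [norm_indicator_eq_indicator_norm]
  exact Set.indicator_le_indicator ((abs_div_card_le _ A).trans (hV.abs_le A σ))

theorem IsPotential.summable_div_card [Finite S] {V : Interaction d S} (hV : IsPotential V)
    {x : Site d} {s : Set (Finset (Site d))} (hs : ∀ A ∈ s, x ∈ A) (σ : Config d S) :
    Summable (s.indicator fun A => V A σ / A.card) :=
  Summable.of_norm_bounded (hV.isWeight.summable_of_subset hs)
    (hV.norm_indicator_div_card_le s σ)

theorem IsPotential.abs_tsum_div_card_le [Finite S] {V : Interaction d S} (hV : IsPotential V)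
    {x : Site d} {s : Set (Finset (Site d))} (hs : ∀ A ∈ s, x ∈ A) (σ : Config d S) :
    |∑' A, s.indicator (fun A => V A σ / (A.card : ℝ)) A| ≤
      ∑' A, s.indicator (fun A => unifNorm (V A)) A :=
  tsum_of_norm_bounded (f := s.indicator fun A => V A σ / (A.card : ℝ))
    (hV.isWeight.summable_of_subset hs).hasSum (hV.norm_indicator_div_card_le s σ)

theorem IsPotential.abs_siteEnergy_le [Finite S] {V : Interaction d S} (hV : IsPotential V)
    (σ : Config d S) : |siteEnergy V σ| ≤ starSum (fun A => unifNorm (V A)) 0 :=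
  hV.abs_tsum_div_card_le (fun _ h => h) σ

theorem IsPotential.siteEnergy_shift {V : Interaction d S} (hV : IsPotential V) (x : Site d)
    (σ : Config d S) : siteEnergy V (shift x σ) = starSum (fun A => V A σ / A.card) x := by
  unfold siteEnergy starSum
  rw [← (shiftSet x).tsum_eq ({A : Finset (Site d) | x ∈ A}.indicator _)]
  refine tsum_congr fun A => ?_
  have h : (0 : Site d) ∈ A ↔ x ∈ shiftSet x A := by simp [mem_shiftSet]
  have h2 : V (shiftSet x A) σ = V A (shift x σ) := hV.invariant A x σ
  simp only [Set.indicator_apply, Set.mem_ofPred_eq, ← h, card_shiftSet, h2]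

theorem IsPotential.starSum_eq_sum_add [Finite S] {V : Interaction d S} (hV : IsPotential V)
    (n : ℕ) (x : Site d) (σ : Config d S) :
    starSum (fun A => V A σ / A.card) x =
      ∑ A ∈ (cube d n).powerset, (if x ∈ A then V A σ / A.card else 0) +
        tailSum (fun A => V A σ / A.card) n x := by
  have hs := hV.summable_div_card (x := x) (s := {A | x ∈ A}) (fun _ h => h) σ
  rw [starSum, ← hs.sum_add_tsum_compl (s := (cube d n).powerset), tailSum]
  congr 1
  · exact Finset.sum_congr rfl fun A _ => by simp only [Set.indicator_apply, Set.mem_ofPred_eq]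
  rw [tsum_subtype (((cube d n).powerset : Set (Finset (Site d)))ᶜ)
      ({A : Finset (Site d) | x ∈ A}.indicator fun A => V A σ / A.card)]
  congr 1
  ext A
  rw [Set.indicator_indicator]
  congr 1
  ext B
  simp [and_comm]

/-- The energy of A is shared equally among its sites. The empty set has no site to carry its share,
which is where V_∅ = 0 enters. -/
theorem IsPotential.cubeEnergy_eq {V : Interaction d S} (hV : IsPotential V) (n : ℕ)
    (σ : Config d S) : cubeEnergy V n σ =
      ∑ x ∈ cube d n, ∑ A ∈ (cube d n).powerset, if x ∈ A then V A σ / A.card else 0 := by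
  rw [Finset.sum_comm]
  refine Finset.sum_congr rfl fun A hA => ?_
  rw [Finset.sum_ite_mem, Finset.inter_eq_right.2 (Finset.mem_powerset.1 hA), Finset.sum_const,
    nsmul_eq_mul]
  rcases A.eq_empty_or_nonempty with rfl | h
  · simp [hV.empty]
  · have : (A.card : ℝ) ≠ 0 := by exact_mod_cast h.card_pos.ne'
    field_simp

/-- The site energies in Λ_n also count the shares of sets that stick out of Λ_n, and nothing else.
-/
theorem IsPotential.abs_cubeEnergy_sub_le [Finite S] {V : Interaction d S} (hV : IsPotential V)
    (n : ℕ) (σ : Config d S) :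
    |cubeEnergy V n σ - ∑ x ∈ cube d n, siteEnergy V (shift x σ)| ≤
      boundarySum (fun A => unifNorm (V A)) n := by
  simp_rw [hV.siteEnergy_shift, hV.starSum_eq_sum_add n, Finset.sum_add_distrib]
  rw [← hV.cubeEnergy_eq, sub_add_cancel_left, abs_neg]
  refine (Finset.abs_sum_le_sum_abs _ _).trans (Finset.sum_le_sum fun x _ => ?_)
  exact hV.abs_tsum_div_card_le (fun _ h => h.1) σ

theorem IsPotential.tendsto_siteEnergy [Finite S] {V : Interaction d S} (hV : IsPotential V)
    (σ : Config d S) : Tendsto (fun n => ∑ A ∈ (cube d n).powerset,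
      if (0 : Site d) ∈ A then V A σ / A.card else 0) atTop (𝓝 (siteEnergy V σ)) := by
  have h := (hV.summable_div_card (x := 0) (s := {A | 0 ∈ A}) (fun _ h => h) σ).hasSum.comp
    tendsto_powerset_cube
  exact h.congr fun n => Finset.sum_congr rfl fun A _ => by
    simp only [Set.indicator_apply, Set.mem_ofPred_eq]

theorem IsPotential.measurable_siteEnergy [Finite S] [MeasurableSpace S]
    [DiscreteMeasurableSpace S] {V : Interaction d S} (hV : IsPotential V) :
    Measurable (siteEnergy V) := by
  refine measurable_of_tendsto_metrizable (fun n => ?_)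
    (tendsto_pi_nhds.2 fun σ => hV.tendsto_siteEnergy σ)
  refine Finset.measurable_sum _ fun A _ => ?_
  split_ifs
  · exact (measurable_of_dependsOn (hV.dependsOn A)).div_const _
  · exact measurable_const

theorem IsPotential.integrable_siteEnergy [Finite S] [MeasurableSpace S]
    [DiscreteMeasurableSpace S] {V : Interaction d S} (hV : IsPotential V)
    (μ : Measure (Config d S)) [IsFiniteMeasure μ] : Integrable (siteEnergy V) μ :=
  Integrable.of_bound hV.measurable_siteEnergy.aestronglyMeasurable _
    (Eventually.of_forall hV.abs_siteEnergy_le)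

theorem integral_shift [MeasurableSpace S] {μ : Measure (Config d S)} (hμ : IsShiftInvariant μ)
    {f : Config d S → ℝ} (hf : Measurable f) (x : Site d) :
    ∫ σ, f (shift x σ) ∂μ = ∫ σ, f σ ∂μ := by
  conv_rhs => rw [← hμ x]
  rw [integral_map (measurable_shift x).aemeasurable hf.aestronglyMeasurable]

theorem integrable_shift [MeasurableSpace S] {μ : Measure (Config d S)}
    (hμ : IsShiftInvariant μ) {f : Config d S → ℝ} (hf : Integrable f μ) (x : Site d) :
    Integrable (fun σ => f (shift x σ)) μ := by
  rw [← hμ x] at hf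
  exact hf.comp_measurable (measurable_shift x)

/-- The mean energy per site in large cubes is the mean of the site energy. -/
theorem IsPotential.tendsto_integral_cubeEnergy [Finite S] [MeasurableSpace S]
    [DiscreteMeasurableSpace S] {V : Interaction d S} (hV : IsPotential V)
    {μ : Measure (Config d S)} [IsProbabilityMeasure μ] (hμ : IsShiftInvariant μ) :
    Tendsto (fun n => (∫ σ, cubeEnergy V n σ ∂μ) / (cube d n).card) atTop
      (𝓝 (∫ σ, siteEnergy V σ ∂μ)) := by
  rw [tendsto_iff_norm_sub_tendsto_zero]
  refine squeeze_zero (fun _ => norm_nonneg _) (fun n => ?_) hV.isWeight.tendsto_boundarySum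
  have hp := card_cube_pos d n
  have h1 : ∫ σ, ∑ x ∈ cube d n, siteEnergy V (shift x σ) ∂μ =
      (cube d n).card * ∫ σ, siteEnergy V σ ∂μ := by
    rw [integral_finsetSum _ fun x _ => integrable_shift hμ (hV.integrable_siteEnergy μ) x]
    simp_rw [integral_shift hμ hV.measurable_siteEnergy]
    rw [Finset.sum_const, nsmul_eq_mul]
  have h2 : (∫ σ, cubeEnergy V n σ ∂μ) / (cube d n).card - ∫ σ, siteEnergy V σ ∂μ =
      (∫ σ, (cubeEnergy V n σ - ∑ x ∈ cube d n, siteEnergy V (shift x σ)) ∂μ) /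
        (cube d n).card := by
    rw [integral_sub (integrable_of_dependsOn (hV.dependsOn_cubeEnergy n) μ)
      (integrable_finsetSum _ fun x _ => integrable_shift hμ (hV.integrable_siteEnergy μ) x), h1]
    field_simp
  rw [h2, norm_div, Real.norm_of_nonneg hp.le]
  gcongr
  refine (norm_integral_le_of_norm_le_const (C := boundarySum (fun A => unifNorm (V A)) n)
    (Eventually.of_forall fun σ => hV.abs_cubeEnergy_sub_le n σ)).trans ?_
  simp

end Potentials

/-! ### Existence of the free energy density -/

section FreeEnergyLimit

variable {d : ℕ} {S : Type*}

theorem DependsOn.comp_fun {s : Set (Site d)} {f : Config d S → ℝ} (hf : DependsOn f s)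
    (g : ℝ → ℝ) : DependsOn (fun σ => g (f σ)) s := fun _ _ h => congrArg g (hf h)

/-- Both energies are compared with sums of site energies. The three errors come from the boundary
of Λ_n, the boundaries of the tiles, and the sites of Λ_n outside all tiles. -/
theorem IsPotential.abs_cubeEnergy_sub_tiles_le [Finite S] {V : Interaction d S}
    (hV : IsPotential V) (k n : ℕ) (σ : Config d S) :
    |cubeEnergy V n σ - ∑ x ∈ tiles d k n, cubeEnergy V k (shift x σ)| ≤
      boundarySum (fun A => unifNorm (V A)) n +
        (tiles d k n).card * boundarySum (fun A => unifNorm (V A)) k +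
        ((cube d n).card - (tiles d k n).card * (cube d k).card) *
          starSum (fun A => unifNorm (V A)) 0 := by
  have h1 := hV.abs_cubeEnergy_sub_le n σ
  have h2 : |∑ x ∈ tiles d k n, (cubeEnergy V k (shift x σ) -
      ∑ y ∈ cube d k, siteEnergy V (shift (y + x) σ))| ≤
      (tiles d k n).card * boundarySum (fun A => unifNorm (V A)) k := by
    refine (Finset.abs_sum_le_sum_abs _ _).trans ?_
    rw [← nsmul_eq_mul]
    refine Finset.sum_le_card_nsmul _ _ _ fun x _ => ?_
    simpa only [shift_shift] using hV.abs_cubeEnergy_sub_le k (shift x σ)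
  set B := (tiles d k n ×ˢ cube d k).image fun p => p.2 + p.1 with hB
  have hinj : Set.InjOn (fun p : Site d × Site d => p.2 + p.1)
      (tiles d k n ×ˢ cube d k : Finset _) := by
    rintro ⟨x, y⟩ hp ⟨x', y'⟩ hp' h
    obtain ⟨hx, hy⟩ := Finset.mem_product.1 (Finset.mem_coe.1 hp)
    obtain ⟨hx', hy'⟩ := Finset.mem_product.1 (Finset.mem_coe.1 hp')
    have hxx : x = x' := eq_of_mem_tiles hx hx' hy hy' h
    subst hxx
    simpa using h
  have hcard : B.card = (tiles d k n).card * (cube d k).card := by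
    rw [hB, Finset.card_image_of_injOn hinj, Finset.card_product]
  have hsub : B ⊆ cube d n := by
    intro z hz
    obtain ⟨⟨x, y⟩, hp, rfl⟩ := Finset.mem_image.1 hz
    obtain ⟨hx, hy⟩ := Finset.mem_product.1 hp
    exact add_mem_of_mem_tiles hx hy
  have hsum : ∑ z ∈ B, siteEnergy V (shift z σ) =
      ∑ x ∈ tiles d k n, ∑ y ∈ cube d k, siteEnergy V (shift (y + x) σ) := by
    rw [hB, Finset.sum_image hinj, Finset.sum_product]
  have h3 : |∑ z ∈ cube d n \ B, siteEnergy V (shift z σ)| ≤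
      ((cube d n).card - (tiles d k n).card * (cube d k).card) *
        starSum (fun A => unifNorm (V A)) 0 := by
    refine (Finset.abs_sum_le_sum_abs _ _).trans ?_
    rw [← Nat.cast_mul, ← hcard, ← Nat.cast_sub (Finset.card_le_card hsub),
      ← Finset.card_sdiff_of_subset hsub, ← nsmul_eq_mul]
    exact Finset.sum_le_card_nsmul _ _ _ fun x _ => hV.abs_siteEnergy_le _
  have h4 := Finset.sum_sdiff (f := fun z => siteEnergy V (shift z σ)) hsub
  rw [Finset.sum_sub_distrib, ← hsum] at h2
  rw [_root_.abs_le] at h1 h2 h3 ⊢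
  constructor <;> linarith [h1.1, h1.2, h2.1, h2.2, h3.1, h3.2]

/-- A Cauchy criterion suited to tilings: a block size k is compared only with n large depending on
k, and two large indices are compared through a common k. -/
theorem exists_tendsto_of_eventually_le {c b : ℕ → ℝ} (hb : Tendsto b atTop (𝓝 0))
    (h : ∀ k, ∀ ε > 0, ∀ᶠ n in atTop, |c n - c k| ≤ b k + ε) :
    ∃ l, Tendsto c atTop (𝓝 l) := by
  refine cauchySeq_tendsto_of_complete (Metric.cauchySeq_iff'.2 fun ε hε => ?_)
  obtain ⟨k, hk⟩ := (hb.eventually (gt_mem_nhds (show (0 : ℝ) < ε / 8 by linarith))).exists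
  obtain ⟨n, hn⟩ := eventually_atTop.1 (h k (ε / 8) (by linarith))
  refine ⟨n, fun m hm => ?_⟩
  rw [Real.dist_eq]
  have h1 := abs_le.1 (hn m hm)
  have h2 := abs_le.1 (hn n le_rfl)
  rw [abs_lt]
  constructor <;> linarith

theorem integral_exp_pos_of_dependsOn [Finite S] [MeasurableSpace S] [DiscreteMeasurableSpace S]
    {Λ : Finset (Site d)} {f : Config d S → ℝ} (hf : DependsOn f Λ) (μ : Measure (Config d S))
    [IsProbabilityMeasure μ] : 0 < ∫ σ, Real.exp (f σ) ∂μ :=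
  integral_exp_pos (integrable_of_dependsOn (hf.comp_fun Real.exp) μ)

theorem log_integral_exp_le [Finite S] [MeasurableSpace S] [DiscreteMeasurableSpace S]
    {Λ : Finset (Site d)} {f g : Config d S → ℝ} (hf : DependsOn f Λ) (hg : DependsOn g Λ) {c : ℝ}
    (h : ∀ σ, f σ ≤ g σ + c) (μ : Measure (Config d S)) [IsProbabilityMeasure μ] :
    Real.log (∫ σ, Real.exp (f σ) ∂μ) ≤ Real.log (∫ σ, Real.exp (g σ) ∂μ) + c := by
  rw [← Real.log_exp c, ← Real.log_mul (integral_exp_pos_of_dependsOn hg μ).ne'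
    (Real.exp_ne_zero _)]
  refine Real.log_le_log (integral_exp_pos_of_dependsOn hf μ) ?_
  rw [← integral_mul_const]
  refine integral_mono (integrable_of_dependsOn (hf.comp_fun Real.exp) μ)
    ((integrable_of_dependsOn (hg.comp_fun Real.exp) μ).mul_const _) fun σ => ?_
  simp only [← Real.exp_add]
  exact Real.exp_le_exp.2 (h σ)

theorem abs_log_integral_exp_sub_le [Finite S] [MeasurableSpace S] [DiscreteMeasurableSpace S]
    {Λ : Finset (Site d)} {f g : Config d S → ℝ} (hf : DependsOn f Λ) (hg : DependsOn g Λ) {c : ℝ}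
    (h : ∀ σ, |f σ - g σ| ≤ c) (μ : Measure (Config d S)) [IsProbabilityMeasure μ] :
    |Real.log (∫ σ, Real.exp (f σ) ∂μ) - Real.log (∫ σ, Real.exp (g σ) ∂μ)| ≤ c := by
  have h1 := log_integral_exp_le hf hg (c := c) (fun σ => by linarith [(abs_le.1 (h σ)).2]) μ
  have h2 := log_integral_exp_le hg hf (c := c) (fun σ => by linarith [(abs_le.1 (h σ)).1]) μ
  rw [abs_le]
  constructor <;> linarith

variable [Fintype S] [Nonempty S] [MeasurableSpace S]

/-- The uniform product measure on the configurations. -/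
noncomputable def uniformConfig (d : ℕ) (S : Type*) [Fintype S] [Nonempty S] [MeasurableSpace S] :
    Measure (Config d S) :=
  Measure.infinitePi fun _ => (PMF.uniformOfFintype S).toMeasure

instance : IsProbabilityMeasure (uniformConfig d S) := by
  unfold uniformConfig
  infer_instance

theorem isShiftInvariant_uniformConfig : IsShiftInvariant (uniformConfig d S) := by
  intro x
  refine Measure.eq_infinitePi _ fun s t ht => ?_
  rw [Measure.map_apply (measurable_shift x)
    (MeasurableSet.pi s.countable_toSet fun i _ => ht i)]
  have : shift x ⁻¹' (s : Set (Site d)).pi t =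
      (shiftSet x s : Set (Site d)).pi fun y => t (y - x) := by
    ext σ
    simp only [Set.mem_preimage, Set.mem_pi, SetLike.mem_coe, shift, mem_shiftSet]
    exact ⟨fun h y hy => by simpa using h _ hy, fun h y hy => by simpa using h (y + x) (by simpa)⟩
  rw [this, uniformConfig, Measure.infinitePi_pi _ fun i _ => ht _, shiftSet_apply,
    Finset.prod_map]
  simp

theorem uniformConfig_cylinderEvent [DiscreteMeasurableSpace S] (Λ : Finset (Site d))
    (σ : Λ → S) :
    (uniformConfig d S).real (cylinderEvent Λ σ) = ((Fintype.card S : ℝ) ^ Λ.card)⁻¹ := by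
  classical
  obtain ⟨ξ⟩ : Nonempty (Config d S) := inferInstance
  have h : cylinderEvent Λ σ = (Λ : Set (Site d)).pi fun x => {glue Λ σ ξ x} := by
    ext ω
    simp only [cylinderEvent, Set.mem_pi, SetLike.mem_coe, Set.mem_singleton_iff]
    exact ⟨fun h x hx => by rw [glue_apply_mem hx, ← h],
      fun h x => by rw [h x x.2, glue_apply_mem x.2]⟩
  rw [h, measureReal_def, uniformConfig,
    Measure.infinitePi_pi _ fun i _ => MeasurableSet.of_discrete]
  simp

theorem integral_uniformConfig [DiscreteMeasurableSpace S] {Λ : Finset (Site d)}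
    {f : Config d S → ℝ} (hf : DependsOn f Λ) (ξ : Config d S) :
    ∑ σ : Λ → S, f (glue Λ σ ξ) =
      (Fintype.card S : ℝ) ^ Λ.card * ∫ σ, f σ ∂(uniformConfig d S) := by
  rw [integral_of_dependsOn hf _ ξ, Finset.mul_sum]
  refine Finset.sum_congr rfl fun σ _ => ?_
  rw [uniformConfig_cylinderEvent]
  have : (Fintype.card S : ℝ) ≠ 0 := by exact_mod_cast Fintype.card_ne_zero
  field_simp

theorem integral_mul_uniformConfig [DiscreteMeasurableSpace S] {Λ Δ : Finset (Site d)}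
    (hΛΔ : Disjoint Λ Δ) {f g : Config d S → ℝ} (hf : DependsOn f Λ) (hg : DependsOn g Δ) :
    ∫ σ, f σ * g σ ∂(uniformConfig d S) =
      (∫ σ, f σ ∂(uniformConfig d S)) * ∫ σ, g σ ∂(uniformConfig d S) := by
  obtain ⟨ξ⟩ : Nonempty (Config d S) := inferInstance
  have h1 := ProbabilityTheory.iIndepFun_infinitePi
    (P := fun _ : Site d => (PMF.uniformOfFintype S).toMeasure) (X := fun _ s => s)
    fun _ => measurable_id
  have h2 := (h1.indepFun_finset Λ Δ hΛΔ fun i => measurable_pi_apply i).comp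
    (φ := fun σ : Λ → S => f (glue Λ σ ξ)) (ψ := fun σ : Δ → S => g (glue Δ σ ξ))
    Measurable.of_discrete Measurable.of_discrete
  have hf' : (fun σ : Λ → S => f (glue Λ σ ξ)) ∘ (fun σ (i : Λ) => σ i) = f :=
    funext fun σ => dependsOn_glue hf ξ σ
  have hg' : (fun σ : Δ → S => g (glue Δ σ ξ)) ∘ (fun σ (i : Δ) => σ i) = g :=
    funext fun σ => dependsOn_glue hg ξ σ
  rw [hf', hg'] at h2
  exact ProbabilityTheory.IndepFun.integral_fun_mul_eq_mul_integral h2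
    (measurable_of_dependsOn hf).aestronglyMeasurable
    (measurable_of_dependsOn hg).aestronglyMeasurable

/-- Spins in disjoint tiles are independent under the product measure, and by translation invariance
all tiles contribute the same factor. -/
theorem integral_prod_tiles_uniformConfig [DiscreteMeasurableSpace S] {k n : ℕ}
    {f : Config d S → ℝ} (hf : DependsOn f (cube d k)) {X : Finset (Site d)}
    (hX : X ⊆ tiles d k n) :
    ∫ σ, ∏ x ∈ X, f (shift x σ) ∂(uniformConfig d S) =
      (∫ σ, f σ ∂(uniformConfig d S)) ^ X.card := by
  induction X using Finset.induction_on with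
  | empty => simp
  | insert x X hx ih =>
    have hX' := (Finset.subset_insert _ _).trans hX
    simp_rw [Finset.prod_insert hx]
    have hs : DependsOn (fun σ => f (shift x σ)) (shiftSet x (cube d k) : Finset (Site d)) :=
      (DependsOn.comp_shift hf x).mono fun z hz => by simpa [mem_shiftSet] using hz
    rw [integral_mul_uniformConfig ?_ hs
      (dependsOn_prod_tiles hf hX' (hX (Finset.mem_insert_self _ _)) hx), ih hX',
      integral_shift isShiftInvariant_uniformConfig (measurable_of_dependsOn hf),
      Finset.card_insert_of_notMem hx, pow_succ']
    rw [Finset.disjoint_left]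
    intro z hz hz'
    exact (Finset.mem_filter.1 hz').2 (mem_shiftSet.1 hz)

/-- The partition function of a cube, normalized by the number of configurations. -/
noncomputable def meanPartition (β : ℝ) (V : Interaction d S) (n : ℕ) : ℝ :=
  ∫ σ, Real.exp (-β * cubeEnergy V n σ) ∂(uniformConfig d S)

theorem IsPotential.cubeFreeEnergy_eq [DiscreteMeasurableSpace S] {V : Interaction d S}
    (hV : IsPotential V) (β : ℝ) (n : ℕ) :
    cubeFreeEnergy β V n =
      Real.log (Fintype.card S) + Real.log (meanPartition β V n) / (cube d n).card := by
  have hd := (hV.dependsOn_cubeEnergy n).comp_fun fun t => -β * t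
  have hS : (Fintype.card S : ℝ) ≠ 0 := by exact_mod_cast Fintype.card_ne_zero
  have hp := card_cube_pos d n
  have h := integral_uniformConfig (hd.comp_fun Real.exp) fun _ => Classical.arbitrary S
  have h' : cubeFreeEnergy β V n = (1 / ((cube d n).card : ℝ)) * Real.log
      (∑ σ : cube d n → S, Real.exp (-β * cubeEnergy V n
        (glue (cube d n) σ fun _ => Classical.arbitrary S))) := rfl
  rw [h', h, Real.log_mul (pow_ne_zero _ hS) (integral_exp_pos_of_dependsOn hd _).ne',
    Real.log_pow, meanPartition]
  field_simp

/-- The thermodynamic limit of the free energy density exists. -/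
theorem IsPotential.exists_tendsto_cubeFreeEnergy [DiscreteMeasurableSpace S]
    {V : Interaction d S} (hV : IsPotential V) {β : ℝ} (hβ : 0 ≤ β) :
    ∃ P, Tendsto (cubeFreeEnergy β V) atTop (𝓝 P) := by
  set N : Finset (Site d) → ℝ := fun A => unifNorm (V A)
  set K := starSum N 0
  suffices h : ∃ P, Tendsto (fun n => Real.log (meanPartition β V n) / (cube d n).card)
      atTop (𝓝 P) by
    obtain ⟨P, hP⟩ := h
    exact ⟨_, (tendsto_const_nhds.add hP).congr fun n => (hV.cubeFreeEnergy_eq β n).symm⟩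
  have hb : Tendsto (fun k => β * (boundarySum N k / (cube d k).card)) atTop (𝓝 0) := by
    simpa using hV.isWeight.tendsto_boundarySum.const_mul β
  refine exists_tendsto_of_eventually_le hb fun k ε hε => ?_
  set c : ℕ → ℝ := fun n => Real.log (meanPartition β V n) / (cube d n).card with hc
  set r : ℕ → ℝ := fun n => ((tiles d k n).card * (cube d k).card : ℝ) / (cube d n).card with hr
  have hrt : Tendsto r atTop (𝓝 1) := tendsto_card_tiles k
  -- Here `r n` is the fraction of Λ_n covered by tiles. Replacing the cube energy by the tile
  -- energies turns the partition function into a power of that of Λ_k.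
  have key : ∀ n, |c n - r n * c k| ≤ β * (boundarySum N n / (cube d n).card) +
      β * (r n * (boundarySum N k / (cube d k).card)) + β * ((1 - r n) * K) := by
    intro n
    have hp := card_cube_pos d n
    have hpk := card_cube_pos d k
    have hdk := (hV.dependsOn_cubeEnergy k).comp_fun fun t => -β * t
    have hd := (hV.dependsOn_cubeEnergy n).comp_fun fun t => -β * t
    have hdt : DependsOn (fun σ => -β * ∑ x ∈ tiles d k n, cubeEnergy V k (shift x σ))
        (cube d n) := by
      refine DependsOn.comp_fun (DependsOn.finset_sum' fun x hx => ?_) fun t => -β * t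
      refine (DependsOn.comp_shift (hV.dependsOn_cubeEnergy k) x).mono fun z hz => ?_
      simpa using add_mem_of_mem_tiles hx hz
    have h1 := abs_log_integral_exp_sub_le hd hdt (c := β * (boundarySum N n +
        (tiles d k n).card * boundarySum N k +
        ((cube d n).card - (tiles d k n).card * (cube d k).card) * K)) (fun σ => by
      rw [← mul_sub, abs_mul, abs_neg, abs_of_nonneg hβ]
      exact mul_le_mul_of_nonneg_left (hV.abs_cubeEnergy_sub_tiles_le k n σ) hβ)
      (uniformConfig d S)
    have h2 : ∫ σ, Real.exp (-β * ∑ x ∈ tiles d k n, cubeEnergy V k (shift x σ))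
        ∂(uniformConfig d S) = meanPartition β V k ^ (tiles d k n).card := by
      simp_rw [Finset.mul_sum, Real.exp_sum]
      exact integral_prod_tiles_uniformConfig (hdk.comp_fun Real.exp) subset_rfl
    rw [h2, Real.log_pow] at h1
    have h3 : c n - r n * c k = (Real.log (meanPartition β V n) -
        (tiles d k n).card * Real.log (meanPartition β V k)) / (cube d n).card := by
      simp only [hc, hr]
      field_simp
    rw [h3, abs_div, abs_of_pos hp, div_le_iff₀ hp]
    refine h1.trans (le_of_eq ?_)
    simp only [hr]
    field_simp
  -- The last term pays for replacing `r n * c k` by `c k`. As n → ∞ only the boundary cost of the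
  -- tiles remains.
  have hlim : Tendsto (fun n => β * (boundarySum N n / (cube d n).card) +
      β * (r n * (boundarySum N k / (cube d k).card)) + β * ((1 - r n) * K) +
      |r n - 1| * |c k|) atTop (𝓝 (β * 0 + β * (1 * (boundarySum N k / (cube d k).card)) +
        β * ((1 - 1) * K) + |(1 : ℝ) - 1| * |c k|)) := by
    refine Tendsto.add (Tendsto.add (Tendsto.add ?_ ?_) ?_) ?_
    · exact hV.isWeight.tendsto_boundarySum.const_mul β
    · exact (hrt.mul_const _).const_mul β
    · exact ((tendsto_const_nhds.sub hrt).mul_const K).const_mul β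
    · exact ((hrt.sub_const 1).abs).mul_const _
  filter_upwards [hlim.eventually (gt_mem_nhds (show _ < β * (boundarySum N k / (cube d k).card)
    + ε by simp; linarith))] with n hn
  have h4 : |c n - c k| ≤ |c n - r n * c k| + |r n - 1| * |c k| := by
    rw [← abs_mul]
    refine le_trans (le_of_eq ?_) (abs_add_le _ _)
    congr 1
    ring
  linarith [key n]

end FreeEnergyLimit

/-! ### Gibbs measures in cubes and the tangent inequality -/

section Gibbs

variable {d : ℕ} {S : Type*}

theorem IsPotential.norm_sub_le [Finite S] {U : Interaction d S} (hU : IsPotential U)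
    {Λ : Finset (Site d)} {σ η : Config d S} (h : ∀ x ∉ Λ, σ x = η x) (A : Finset (Site d)) :
    ‖U A σ - U A η‖ ≤
      ∑ x ∈ Λ, 2 * {A : Finset (Site d) | x ∈ A}.indicator (fun A => unifNorm (U A)) A := by
  have hn : ∀ x ∈ Λ, 0 ≤
      2 * {A : Finset (Site d) | x ∈ A}.indicator (fun A => unifNorm (U A)) A :=
    fun x _ => mul_nonneg zero_le_two (hU.isWeight.indicator_nonneg _ A)
  by_cases hA : ∃ x ∈ Λ, x ∈ A
  · obtain ⟨x, hx, hxA⟩ := hA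
    refine le_trans ?_ (Finset.single_le_sum hn hx)
    rw [Set.indicator_of_mem (by exact hxA), two_mul]
    exact (_root_.norm_sub_le _ _).trans (add_le_add (hU.abs_le A σ) (hU.abs_le A η))
  · push Not at hA
    rw [hU.dep A σ η fun x hx => h x fun hxΛ => hA x hxΛ hx, sub_self, norm_zero]
    exact Finset.sum_nonneg hn

theorem IsPotential.summable_sub [Finite S] {U : Interaction d S} (hU : IsPotential U)
    {Λ : Finset (Site d)} {σ η : Config d S} (h : ∀ x ∉ Λ, σ x = η x) :
    Summable fun A => U A σ - U A η :=
  Summable.of_norm_bounded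
    (summable_sum fun x _ => (hU.isWeight.summable_star x).mul_left 2) (hU.norm_sub_le h)

/-- Sets disjoint from Λ do not see the change of configuration, so the error comes from sets that
meet Λ and leave Λ_k. -/
theorem IsPotential.abs_relEnergy_sub_le [Finite S] {U : Interaction d S} (hU : IsPotential U)
    {Λ : Finset (Site d)} {σ η : Config d S} (h : ∀ x ∉ Λ, σ x = η x) (k : ℕ) :
    |relEnergy U σ η - (cubeEnergy U k σ - cubeEnergy U k η)| ≤
      2 * ∑ x ∈ Λ, tailSum (fun A => unifNorm (U A)) k x := by
  have hs := hU.summable_sub h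
  rw [relEnergy, ← hs.sum_add_tsum_compl (s := (cube d k).powerset), Finset.sum_sub_distrib,
    cubeEnergy, cubeEnergy, add_sub_cancel_left,
    tsum_subtype (((cube d k).powerset : Set (Finset (Site d)))ᶜ) fun A => U A σ - U A η]
  rw [Finset.mul_sum]
  refine tsum_of_norm_bounded (f := Set.indicator _ fun A => U A σ - U A η) (hasSum_sum fun x _ => (hU.isWeight.summable_of_subset
    (x := x) (s := {A | x ∈ A ∧ ¬ A ⊆ cube d k}) fun A hA => hA.1).hasSum.mul_left 2) fun A => ?_
  by_cases hA : A ⊆ cube d k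
  · rw [Set.indicator_of_notMem (by simpa using hA), norm_zero]
    exact Finset.sum_nonneg fun x _ =>
      mul_nonneg zero_le_two (hU.isWeight.indicator_nonneg _ A)
  · rw [Set.indicator_of_mem (by simpa using hA)]
    refine (hU.norm_sub_le h A).trans (Finset.sum_le_sum fun x _ => ?_)
    simp [Set.indicator_apply, hA]

variable [MeasurableSpace S]

theorem measurable_piecewise_cylinderEvents (Λ : Finset (Site d)) (σ : Config d S) :
    @Measurable _ _ (cylinderEvents (X := fun _ : Site d => S) ((Λ : Set (Site d))ᶜ))
      MeasurableSpace.pi fun ξ : Config d S => Λ.piecewise σ ξ := by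
  refine (@measurable_pi_iff _ _ _ (_) _ _).2 fun x => ?_
  by_cases hx : x ∈ Λ
  · simp only [Finset.piecewise_eq_of_mem _ _ _ hx]
    exact measurable_const
  · simp only [Finset.piecewise_eq_of_notMem _ _ _ hx]
    exact measurable_cylinderEvent_apply (X := fun _ : Site d => S) (by simpa using hx)

/-- Overwriting the spins in Λ by a fixed configuration does not change φ, and this operation is
measurable with respect to the exterior σ-algebra. -/
theorem measurable_cylinderEvents_of_dependsOn {Λ : Finset (Site d)} {φ : Config d S → ℝ}
    (hm : Measurable φ) (hφ : DependsOn φ ((Λ : Set (Site d))ᶜ)) :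
    Measurable[cylinderEvents (X := fun _ : Site d => S) ((Λ : Set (Site d))ᶜ)] φ := by
  rcases isEmpty_or_nonempty (Config d S) with h | ⟨⟨ξ⟩⟩
  · exact @measurable_of_empty _ _ (_) _ _ φ
  · have h : φ = φ ∘ fun η => Λ.piecewise ξ η := by
      ext η
      exact hφ fun x hx => (Finset.piecewise_eq_of_notMem _ _ _ (by simpa using hx)).symm
    rw [h]
    exact hm.comp (measurable_piecewise_cylinderEvents Λ ξ)

/-- The Gibbs property in cubes, in integrated form: the masses of two configurations `σ, η` in a
cube compare like the Boltzmann factors, uniformly in the exterior condition. -/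
def GibbsSwap (β : ℝ) (U : Interaction d S) (μ : Measure (Config d S)) : Prop :=
  ∀ (n : ℕ) (σ η : Config d S) (φ ψ : Config d S → ℝ), Measurable φ → Measurable ψ →
    DependsOn φ ((cube d n : Set (Site d))ᶜ) → DependsOn ψ ((cube d n : Set (Site d))ᶜ) →
    (∃ c, ∀ ξ, |φ ξ| ≤ c) → (∃ c, ∀ ξ, |ψ ξ| ≤ c) → (∀ ξ, 0 ≤ φ ξ) →
    (∀ ξ, Real.exp (-β * relEnergy U ((cube d n).piecewise σ ξ) ((cube d n).piecewise η ξ)) * φ ξ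
      ≤ ψ ξ) →
    ∫ ξ in cylinderEvent (cube d n) (fun x => σ x), φ ξ ∂μ ≤
      ∫ ξ in cylinderEvent (cube d n) (fun x => η x), ψ ξ ∂μ

/-- Exterior functions can be pulled out of the conditional expectation given the exterior. -/
theorem setIntegral_cylinderEvent_eq [DiscreteMeasurableSpace S] {μ : Measure (Config d S)}
    [IsProbabilityMeasure μ] {Λ : Finset (Site d)} (σ : Λ → S) {φ : Config d S → ℝ}
    (hm : Measurable φ) (hφ : DependsOn φ ((Λ : Set (Site d))ᶜ)) {c : ℝ} (hc : ∀ ξ, |φ ξ| ≤ c) :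
    Integrable (fun ξ => φ ξ * (μ[(cylinderEvent Λ σ).indicator (fun _ => (1 : ℝ)) |
        cylinderEvents (X := fun _ : Site d => S) ((Λ : Set (Site d))ᶜ)]) ξ) μ ∧
    ∫ ξ in cylinderEvent Λ σ, φ ξ ∂μ =
      ∫ ξ, φ ξ * (μ[(cylinderEvent Λ σ).indicator (fun _ => (1 : ℝ)) |
        cylinderEvents (X := fun _ : Site d => S) ((Λ : Set (Site d))ᶜ)]) ξ ∂μ := by
  have hcyl := measurableSet_cylinderEvent Λ σ
  have hind : Integrable ((cylinderEvent Λ σ).indicator fun _ => (1 : ℝ)) μ :=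
    (integrable_const _).indicator hcyl
  have hmul : φ * (cylinderEvent Λ σ).indicator (fun _ => (1 : ℝ)) =
      (cylinderEvent Λ σ).indicator φ := by
    ext ξ
    by_cases h : ξ ∈ cylinderEvent Λ σ <;> simp [h]
  have hint : Integrable (φ * (cylinderEvent Λ σ).indicator fun _ => (1 : ℝ)) μ := by
    rw [hmul]
    exact (Integrable.of_bound hm.aestronglyMeasurable c (Eventually.of_forall hc)).indicator hcyl
  have h := condExp_mul_of_stronglyMeasurable_left
    (measurable_cylinderEvents_of_dependsOn hm hφ).stronglyMeasurable hint hind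
  refine ⟨(integrable_condExp.congr h), ?_⟩
  rw [← integral_indicator hcyl, ← hmul, ← integral_condExp (f := φ * _)
    (cylinderEvents_le_pi (Δ := (Λ : Set (Site d))ᶜ)), integral_congr_ae h]
  rfl

theorem IsGibbs.gibbsSwap [DiscreteMeasurableSpace S] {β : ℝ} {U : Interaction d S}
    {μ : Measure (Config d S)} [IsProbabilityMeasure μ] (h : IsGibbs β U μ) :
    GibbsSwap β U μ := by
  rintro n σ η φ ψ hφm hψm hφ hψ ⟨c, hc⟩ ⟨c', hc'⟩ hφ0 hle
  obtain ⟨h1, h2⟩ := setIntegral_cylinderEvent_eq (μ := μ) (fun x : cube d n => σ x) hφm hφ hc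
  obtain ⟨h3, h4⟩ := setIntegral_cylinderEvent_eq (μ := μ) (fun x : cube d n => η x) hψm hψ hc'
  rw [h2, h4]
  refine integral_mono_ae h1 h3 ?_
  have hpos : 0 ≤ᵐ[μ] μ[(cylinderEvent (cube d n) fun x => η x).indicator (fun _ => (1 : ℝ)) |
        cylinderEvents (X := fun _ : Site d => S) ((cube d n : Set (Site d))ᶜ)] :=
    condExp_nonneg (Eventually.of_forall fun ξ => Set.indicator_nonneg (fun _ _ => zero_le_one) ξ)
  filter_upwards [h (cube d n) (fun x => σ x) (fun x => η x), hpos] with ξ hξ hξ0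
  have := mul_le_mul_of_nonneg_right (hle ξ) hξ0
  rw [hξ, glue_restrict, glue_restrict]
  linarith

theorem sum_cubeProb [Fintype S] [Nonempty S] [DiscreteMeasurableSpace S]
    (μ : Measure (Config d S)) [IsProbabilityMeasure μ] (n : ℕ) :
    ∑ σ : cube d n → S, cubeProb μ n σ = 1 := by
  obtain ⟨ξ⟩ : Nonempty (Config d S) := inferInstance
  have := integral_of_dependsOn (Λ := cube d n) (f := fun _ => (1 : ℝ)) (fun _ _ _ => rfl) μ ξ
  simpa [cubeProb] using this.symm

/-- Constants suffice as test functions: whatever the exterior, the relative energy differs from the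
difference of the cube energies by at most twice the boundary sum. -/
theorem GibbsSwap.cubeProb_le [Finite S] {β : ℝ} {U : Interaction d S}
    (hU : IsPotential U) (hβ : 0 ≤ β) {μ : Measure (Config d S)} [IsProbabilityMeasure μ]
    (h : GibbsSwap β U μ) (n : ℕ) (σ η : Config d S) :
    cubeProb μ n (fun x => σ x) ≤
      Real.exp (-β * (cubeEnergy U n σ - cubeEnergy U n η) +
        2 * β * boundarySum (fun A => unifNorm (U A)) n) * cubeProb μ n fun x => η x := by
  set C := Real.exp (-β * (cubeEnergy U n σ - cubeEnergy U n η) +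
        2 * β * boundarySum (fun A => unifNorm (U A)) n) with hC
  have := h n σ η (fun _ => 1) (fun _ => C) measurable_const measurable_const
    (fun _ _ _ => rfl) (fun _ _ _ => rfl) ⟨_, fun _ => le_rfl⟩ ⟨_, fun _ => le_rfl⟩
    (fun _ => zero_le_one) fun ξ => ?_
  · simpa [cubeProb, mul_comm] using this
  · rw [mul_one, hC]
    refine Real.exp_le_exp.2 ?_
    have h1 := hU.abs_relEnergy_sub_le (Λ := cube d n) (σ := (cube d n).piecewise σ ξ)
      (η := (cube d n).piecewise η ξ) (fun x hx => by simp [hx]) n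
    have h2 : ∀ σ, cubeEnergy U n ((cube d n).piecewise σ ξ) = cubeEnergy U n σ :=
      fun σ => hU.dependsOn_cubeEnergy n fun x hx => Finset.piecewise_eq_of_mem _ _ _ hx
    rw [h2, h2] at h1
    have h3 := mul_le_mul_of_nonneg_left (abs_le.1 h1).1 hβ
    have h4 : boundarySum (fun A => unifNorm (U A)) n =
      ∑ x ∈ cube d n, tailSum (fun A => unifNorm (U A)) n x := rfl
    rw [h4]
    linarith

/-- All cylinder probabilities are comparable, so if one vanished the total mass would vanish. -/
theorem GibbsSwap.cubeProb_pos [Fintype S] [Nonempty S] [DiscreteMeasurableSpace S] {β : ℝ}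
    {U : Interaction d S} (hU : IsPotential U) (hβ : 0 ≤ β) {μ : Measure (Config d S)}
    [IsProbabilityMeasure μ] (h : GibbsSwap β U μ) (n : ℕ) (σ : cube d n → S) :
    0 < cubeProb μ n σ := by
  obtain ⟨ξ⟩ : Nonempty (Config d S) := inferInstance
  have hr : ∀ σ : cube d n → S, (fun x : cube d n => glue (cube d n) σ ξ x) = σ :=
    fun σ => funext fun x => glue_apply_mem x.2 σ ξ
  by_contra hσ
  have h0 : cubeProb μ n σ = 0 := le_antisymm (not_lt.1 hσ) measureReal_nonneg
  have h1 : ∀ η : cube d n → S, cubeProb μ n η = 0 := fun η => by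
    have := h.cubeProb_le hU hβ n (glue _ η ξ) (glue _ σ ξ)
    rw [hr, hr, h0, mul_zero] at this
    exact le_antisymm this measureReal_nonneg
  have := sum_cubeProb μ n
  simp [h1] at this

theorem GibbsSwap.abs_log_div_le [Fintype S] [Nonempty S] [DiscreteMeasurableSpace S] {β : ℝ}
    {U : Interaction d S} (hU : IsPotential U) (hβ : 0 ≤ β) {μ : Measure (Config d S)}
    [IsProbabilityMeasure μ] (h : GibbsSwap β U μ) (n : ℕ) (σ η : Config d S) :
    |Real.log (cubeProb μ n (fun x => σ x) / cubeProb μ n (fun x => η x)) +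
      β * (cubeEnergy U n σ - cubeEnergy U n η)| ≤
        2 * β * boundarySum (fun A => unifNorm (U A)) n := by
  have key : ∀ σ η : Config d S,
      Real.log (cubeProb μ n (fun x => σ x) / cubeProb μ n (fun x => η x)) ≤
      -β * (cubeEnergy U n σ - cubeEnergy U n η) +
        2 * β * boundarySum (fun A => unifNorm (U A)) n := fun σ η => by
    rw [Real.log_le_iff_le_exp (div_pos (h.cubeProb_pos hU hβ n _) (h.cubeProb_pos hU hβ n _)),
      div_le_iff₀ (h.cubeProb_pos hU hβ n _)]
    exact h.cubeProb_le hU hβ n σ η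
  have h1 := key σ η
  have h2 := key η σ
  rw [← inv_div, Real.log_inv] at h2
  rw [abs_le]
  constructor <;> linarith

/-- Jensen's inequality, from the tangent line of exp at the mean. -/
theorem le_log_integral_exp [Finite S] [DiscreteMeasurableSpace S] {Λ : Finset (Site d)}
    {f : Config d S → ℝ} (hf : DependsOn f Λ) (μ : Measure (Config d S))
    [IsProbabilityMeasure μ] :
    ∫ σ, f σ ∂μ ≤ Real.log (∫ σ, Real.exp (f σ) ∂μ) := by
  set m := ∫ σ, f σ ∂μ with hm
  rw [Real.le_log_iff_exp_le (integral_exp_pos_of_dependsOn hf μ)]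
  have hi := integrable_of_dependsOn hf μ
  have h1 : ∫ σ, Real.exp m * (f σ - m + 1) ∂μ ≤ ∫ σ, Real.exp (f σ) ∂μ := by
    refine integral_mono (((hi.sub (integrable_const m)).add (integrable_const 1)).const_mul _)
      (integrable_of_dependsOn (hf.comp_fun Real.exp) μ) fun σ => ?_
    calc Real.exp m * (f σ - m + 1) ≤ Real.exp m * Real.exp (f σ - m) := by
          gcongr
          exact Real.add_one_le_exp _
      _ = Real.exp (f σ) := by rw [← Real.exp_add]; ring_nf
  rw [integral_const_mul, integral_add (f := fun σ => f σ - m) (hi.sub (integrable_const m))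
    (integrable_const 1),
    integral_sub hi (integrable_const m)] at h1
  simpa [← hm] using h1

/-- The marginal of μ on the cube has density at most e^b times that of the free-boundary Gibbs
distribution. Therefore Z_U μ(exp(-β(H_V - H_U))) ≤ e^b Z_V, and Jensen's inequality bounds the left
side from below. -/
theorem GibbsSwap.log_meanPartition_sub_ge [Fintype S] [Nonempty S] [DiscreteMeasurableSpace S]
    {β : ℝ} {U V : Interaction d S} (hU : IsPotential U) (hV : IsPotential V) (hβ : 0 ≤ β)
    {μ : Measure (Config d S)} [IsProbabilityMeasure μ] (h : GibbsSwap β U μ) (n : ℕ) :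
    -β * (∫ σ, cubeEnergy V n σ ∂μ - ∫ σ, cubeEnergy U n σ ∂μ) -
        2 * β * boundarySum (fun A => unifNorm (U A)) n ≤
      Real.log (meanPartition β V n) - Real.log (meanPartition β U n) := by
  obtain ⟨ξ⟩ : Nonempty (Config d S) := inferInstance
  set b := 2 * β * boundarySum (fun A => unifNorm (U A)) n with hb
  have hr : ∀ σ : cube d n → S, (fun x : cube d n => glue (cube d n) σ ξ x) = σ :=
    fun σ => funext fun x => glue_apply_mem x.2 σ ξ
  have hdU := (hU.dependsOn_cubeEnergy n).comp_fun fun t => -β * t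
  have hdV := (hV.dependsOn_cubeEnergy n).comp_fun fun t => -β * t
  have hdD : DependsOn (fun σ => -β * (cubeEnergy V n σ - cubeEnergy U n σ)) (cube d n) :=
    fun σ η hση => by
      simp only [hU.dependsOn_cubeEnergy n hση, hV.dependsOn_cubeEnergy n hση]
  have hZU : 0 < meanPartition β U n := integral_exp_pos_of_dependsOn hdU _
  have hZV : 0 < meanPartition β V n := integral_exp_pos_of_dependsOn hdV _
  -- Compare σ with every η and sum over η: the Boltzmann weights of η build the partition function,
  -- their probabilities sum to 1.
  have hdens : ∀ σ : cube d n → S, cubeProb μ n σ * meanPartition β U n ≤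
      Real.exp (-β * cubeEnergy U n (glue _ σ ξ) + b) *
        (uniformConfig d S).real (cylinderEvent (cube d n) σ) := by
    intro σ
    rw [meanPartition, integral_of_dependsOn (hdU.comp_fun Real.exp) _ ξ, Finset.mul_sum]
    have h1 : ∀ η : cube d n → S, cubeProb μ n σ *
        ((uniformConfig d S).real (cylinderEvent (cube d n) η) *
          Real.exp (-β * cubeEnergy U n (glue _ η ξ))) ≤
        Real.exp (-β * cubeEnergy U n (glue _ σ ξ) + b) *
        (uniformConfig d S).real (cylinderEvent (cube d n) σ) * cubeProb μ n η := fun η => by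
      have h2 := h.cubeProb_le hU hβ n (glue _ σ ξ) (glue _ η ξ)
      rw [hr, hr, ← hb] at h2
      rw [uniformConfig_cylinderEvent, uniformConfig_cylinderEvent]
      set q := ((Fintype.card S : ℝ) ^ (cube d n).card)⁻¹
      have hq : 0 ≤ q := by positivity
      calc _ ≤ Real.exp (-β * (cubeEnergy U n (glue _ σ ξ) - cubeEnergy U n (glue _ η ξ)) + b) *
            cubeProb μ n η * (q * Real.exp (-β * cubeEnergy U n (glue _ η ξ))) := by gcongr
        _ = q * cubeProb μ n η *
            (Real.exp (-β * (cubeEnergy U n (glue _ σ ξ) - cubeEnergy U n (glue _ η ξ)) + b) *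
              Real.exp (-β * cubeEnergy U n (glue _ η ξ))) := by ring
        _ = _ := by
          rw [← Real.exp_add]
          ring_nf
    refine (Finset.sum_le_sum fun η _ => h1 η).trans ?_
    rw [← Finset.mul_sum, sum_cubeProb, mul_one]
  have hle : meanPartition β U n *
      ∫ σ, Real.exp (-β * (cubeEnergy V n σ - cubeEnergy U n σ)) ∂μ ≤
      Real.exp b * meanPartition β V n := by
    rw [integral_of_dependsOn (hdD.comp_fun Real.exp) μ ξ, meanPartition.eq_1 β V,
      integral_of_dependsOn (hdV.comp_fun Real.exp) _ ξ, Finset.mul_sum, Finset.mul_sum]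
    refine Finset.sum_le_sum fun σ _ => ?_
    have h3 := mul_le_mul_of_nonneg_right (hdens σ) (Real.exp_nonneg
      (-β * (cubeEnergy V n (glue _ σ ξ) - cubeEnergy U n (glue _ σ ξ))))
    calc _ = cubeProb μ n σ * meanPartition β U n * Real.exp
          (-β * (cubeEnergy V n (glue _ σ ξ) - cubeEnergy U n (glue _ σ ξ))) := by
          simp only [cubeProb]
          ring
      _ ≤ _ := h3
      _ = (uniformConfig d S).real (cylinderEvent (cube d n) σ) *
          (Real.exp (-β * cubeEnergy U n (glue _ σ ξ) + b) *
            Real.exp (-β * (cubeEnergy V n (glue _ σ ξ) - cubeEnergy U n (glue _ σ ξ)))) := by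
          ring
      _ = (uniformConfig d S).real (cylinderEvent (cube d n) σ) *
          (Real.exp b * Real.exp (-β * cubeEnergy V n (glue _ σ ξ))) := by
          rw [← Real.exp_add, ← Real.exp_add]
          ring_nf
      _ = _ := by ring
  have hI := integral_exp_pos_of_dependsOn hdD μ
  have h4 := Real.log_le_log (mul_pos hZU hI) hle
  rw [Real.log_mul hZU.ne' hI.ne', Real.log_mul (Real.exp_ne_zero _) hZV.ne', Real.log_exp] at h4
  have h5 := le_log_integral_exp hdD μ
  rw [integral_const_mul, integral_sub (integrable_of_dependsOn (hV.dependsOn_cubeEnergy n) μ)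
    (integrable_of_dependsOn (hU.dependsOn_cubeEnergy n) μ)] at h5
  linarith

/-- The mean site energies of a Gibbs measure are tangent to the free energy density. -/
theorem GibbsSwap.freeEnergy_tangent [Fintype S] [Nonempty S] [DiscreteMeasurableSpace S]
    {β : ℝ} {U V : Interaction d S} (hU : IsPotential U) (hV : IsPotential V) (hβ : 0 ≤ β)
    {μ : Measure (Config d S)} [IsProbabilityMeasure μ] (h : GibbsSwap β U μ)
    (hμ : IsShiftInvariant μ) {P Q : ℝ} (hP : Tendsto (cubeFreeEnergy β U) atTop (𝓝 P))
    (hQ : Tendsto (cubeFreeEnergy β V) atTop (𝓝 Q)) :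
    -β * (∫ σ, siteEnergy V σ ∂μ - ∫ σ, siteEnergy U σ ∂μ) ≤ Q - P := by
  have h1 : Tendsto (fun n => -β * ((∫ σ, cubeEnergy V n σ ∂μ) / (cube d n).card -
      (∫ σ, cubeEnergy U n σ ∂μ) / (cube d n).card) -
        2 * β * (boundarySum (fun A => unifNorm (U A)) n / (cube d n).card)) atTop
      (𝓝 (-β * (∫ σ, siteEnergy V σ ∂μ - ∫ σ, siteEnergy U σ ∂μ) - 2 * β * 0)) :=
    (((hV.tendsto_integral_cubeEnergy hμ).sub (hU.tendsto_integral_cubeEnergy hμ)).const_mul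
      (-β)).sub (hU.isWeight.tendsto_boundarySum.const_mul _)
  rw [mul_zero, sub_zero] at h1
  refine le_of_tendsto_of_tendsto' h1 (hQ.sub hP) fun n => ?_
  have hp := card_cube_pos d n
  rw [hV.cubeFreeEnergy_eq, hU.cubeFreeEnergy_eq, add_sub_add_left_eq_sub, ← sub_div (Real.log _)]
  refine le_trans (le_of_eq ?_)
    (div_le_div_of_nonneg_right (h.log_meanPartition_sub_ge hU hV hβ n) hp.le)
  field_simp

end Gibbs

/-! ### Linear growth of the relative entropy for inequivalent potentials -/

section Positivity

variable {d : ℕ} {S : Type*}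

/-- The Donsker–Varadhan lower bound for the relative entropy on a finite set. -/
theorem sub_log_sum_le_relEntropy {ι : Type*} [Fintype ι] [Nonempty ι] {p q : ι → ℝ}
    (hp : ∀ i, 0 < p i) (hq : ∀ i, 0 < q i) (hp1 : ∑ i, p i = 1) (f : ι → ℝ) :
    ∑ i, p i * f i - Real.log (∑ i, q i * Real.exp (f i)) ≤
      ∑ i, p i * Real.log (p i / q i) := by
  set Z := ∑ i, q i * Real.exp (f i) with hZ
  have hZ0 : 0 < Z := Finset.sum_pos (fun i _ => mul_pos (hq i) (Real.exp_pos _))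
    Finset.univ_nonempty
  have h : ∀ i, p i * f i - p i * Real.log Z - p i * Real.log (p i / q i) ≤
      q i * Real.exp (f i) / Z - p i := fun i => by
    -- This is log x ≤ x - 1 at the ratio of the tilted law q e^f / Z to p. Weighted by p, the
    -- right-hand sides sum to zero.
    have h1 := Real.log_le_sub_one_of_pos
      (show 0 < q i * Real.exp (f i) / (Z * p i) from
        div_pos (mul_pos (hq i) (Real.exp_pos _)) (mul_pos hZ0 (hp i)))
    rw [Real.log_div (mul_pos (hq i) (Real.exp_pos _)).ne' (mul_pos hZ0 (hp i)).ne',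
      Real.log_mul (hq i).ne' (Real.exp_ne_zero _), Real.log_mul hZ0.ne' (hp i).ne',
      Real.log_exp] at h1
    rw [Real.log_div (hp i).ne' (hq i).ne']
    have h2 := mul_le_mul_of_nonneg_left h1 (hp i).le
    have h3 : p i * (q i * Real.exp (f i) / (Z * p i) - 1) = q i * Real.exp (f i) / Z - p i := by
      have := (hp i).ne'
      field_simp
    rw [h3] at h2
    linarith
  have h4 := Finset.sum_le_sum fun i (_ : i ∈ Finset.univ) => h i
  simp only [Finset.sum_sub_distrib] at h4
  rw [← Finset.sum_mul, ← Finset.sum_div, hp1, ← hZ, div_self hZ0.ne'] at h4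
  linarith

theorem IsPotential.tendsto_cubeEnergy_sub [Finite S] {U : Interaction d S}
    (hU : IsPotential U) {b : ℕ} {σ η : Config d S} (h : ∀ x ∉ cube d b, σ x = η x) :
    Tendsto (fun k => cubeEnergy U k σ - cubeEnergy U k η) atTop (𝓝 (relEnergy U σ η)) := by
  refine ((hU.summable_sub h).hasSum.comp tendsto_powerset_cube).congr fun n => ?_
  exact Finset.sum_sub_distrib _ _

theorem IsPotential.tendsto_sum_tailSum [Finite S] {U : Interaction d S}
    (hU : IsPotential U) (b : ℕ) :
    Tendsto (fun k => 2 * ∑ x ∈ cube d b, tailSum (fun A => unifNorm (U A)) k x)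
      atTop (𝓝 0) := by
  have := (tendsto_finsetSum (cube d b) fun x _ => hU.isWeight.tendsto_tailSum x).const_mul 2
  simpa using this

variable [MeasurableSpace S]

/-- Since σ and η agree off Λ_b, the error is a tail summed over Λ_b only. It vanishes as k → ∞, in
contrast to the boundary sum of the whole cube Λ_k. -/
theorem GibbsSwap.setIntegral_le [Finite S] {β : ℝ} {U : Interaction d S} (hU : IsPotential U)
    (hβ : 0 ≤ β) {μ : Measure (Config d S)} (hG : GibbsSwap β U μ) {b k : ℕ}
    {σ η : Config d S} (h : ∀ x ∉ cube d b, σ x = η x) {F : Config d S → ℝ} (hF : Measurable F)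
    (hFd : DependsOn F ((cube d k : Set (Site d))ᶜ)) {c : ℝ} (hc : ∀ ξ, |F ξ| ≤ c)
    (hF0 : ∀ ξ, 0 ≤ F ξ) :
    ∫ ξ in cylinderEvent (cube d k) (fun x => σ x), F ξ ∂μ ≤
      Real.exp (-β * (cubeEnergy U k σ - cubeEnergy U k η -
        2 * ∑ x ∈ cube d b, tailSum (fun A => unifNorm (U A)) k x)) *
      ∫ ξ in cylinderEvent (cube d k) (fun x => η x), F ξ ∂μ := by
  rw [← integral_const_mul]
  set C := Real.exp (-β * (cubeEnergy U k σ - cubeEnergy U k η -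
        2 * ∑ x ∈ cube d b, tailSum (fun A => unifNorm (U A)) k x)) with hC
  refine hG k σ η F (fun ξ => C * F ξ) hF (hF.const_mul C) hFd (fun ξ ξ' hξ => by
    simp only [hFd hξ]) ⟨c, hc⟩ ⟨C * c, fun ξ => ?_⟩ hF0 fun ξ => ?_
  · rw [abs_mul, abs_of_pos (Real.exp_pos _)]
    exact mul_le_mul_of_nonneg_left (hc ξ) (Real.exp_pos _).le
  · refine mul_le_mul_of_nonneg_right (Real.exp_le_exp.2 ?_) (hF0 ξ)
    have h1 := hU.abs_relEnergy_sub_le (Λ := cube d b) (σ := (cube d k).piecewise σ ξ)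
      (η := (cube d k).piecewise η ξ) (fun x hx => by
        by_cases hxk : x ∈ cube d k <;> simp [hxk, h x hx]) k
    have h2 : ∀ σ, cubeEnergy U k ((cube d k).piecewise σ ξ) = cubeEnergy U k σ :=
      fun σ => hU.dependsOn_cubeEnergy k fun x hx => Finset.piecewise_eq_of_mem _ _ _ hx
    rw [h2, h2] at h1
    have h3 := mul_le_mul_of_nonneg_left (abs_le.1 h1).1 hβ
    linarith

/-- A substitute for independence. Move one tile to the origin; the other factors then live outside
Λ_k, and the bound `h`, uniform in exterior weights, replaces the split-off factor by a. -/
theorem integral_prod_tiles_le [Finite S] [DiscreteMeasurableSpace S] {k n : ℕ}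
    {ν : Measure (Config d S)} [IsProbabilityMeasure ν] (hν : IsShiftInvariant ν)
    {f : Config d S → ℝ} (hf : DependsOn f (cube d k)) (hf0 : ∀ σ, 0 ≤ f σ) {a : ℝ}
    (ha : 0 ≤ a)
    (h : ∀ F : Config d S → ℝ, Measurable F → DependsOn F ((cube d k : Set (Site d))ᶜ) →
      (∃ c, ∀ ξ, |F ξ| ≤ c) → (∀ ξ, 0 ≤ F ξ) → ∫ σ, f σ * F σ ∂ν ≤ a * ∫ σ, F σ ∂ν)
    {X : Finset (Site d)} (hX : X ⊆ tiles d k n) :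
    ∫ σ, ∏ x ∈ X, f (shift x σ) ∂ν ≤ a ^ X.card := by
  induction X using Finset.induction_on with
  | empty => simp
  | insert x X hx ih =>
    have hX' := (Finset.subset_insert _ _).trans hX
    have hd := dependsOn_prod_tiles hf hX' (hX (Finset.mem_insert_self _ _)) hx
    set F : Config d S → ℝ := fun σ => ∏ y ∈ X, f (shift y (shift (-x) σ)) with hF
    have hFx : ∀ σ, F (shift x σ) = ∏ y ∈ X, f (shift y σ) := fun σ => by
      simp only [hF]
      rw [shift_shift (-x) x σ, neg_add_cancel, shift_zero]
    have hm : Measurable F := (measurable_of_dependsOn hd).comp (measurable_shift (-x))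
    have hFd : DependsOn F ((cube d k : Set (Site d))ᶜ) := by
      refine (DependsOn.comp_shift hd (-x)).mono fun z hz hzk => ?_
      refine (Finset.mem_filter.1 (Finset.mem_coe.1 hz)).2 ?_
      simpa using hzk
    have h1 := h F hm hFd ⟨_, fun ξ => abs_le_unifNorm_of_dependsOn hd (shift (-x) ξ)⟩
      fun ξ => Finset.prod_nonneg fun y _ => hf0 _
    rw [← integral_shift (f := fun σ => f σ * F σ) hν ((measurable_of_dependsOn hf).mul hm) x,
      ← integral_shift hν hm x] at h1
    simp only [hFx] at h1
    simp_rw [Finset.prod_insert hx]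
    rw [Finset.card_insert_of_notMem hx, pow_succ']
    exact h1.trans (mul_le_mul_of_nonneg_left (ih hX') ha)

/-- The relative entropy of translation-invariant Gibbs measures for two potentials that are not
physically equivalent grows linearly with the volume. -/
theorem GibbsSwap.relEntropy_ge [Fintype S] [Nonempty S] [DiscreteMeasurableSpace S] {β : ℝ}
    (hβ : 0 < β) {U W : Interaction d S} (hU : IsPotential U) (hW : IsPotential W)
    {μ ν : Measure (Config d S)} [IsProbabilityMeasure μ] [IsProbabilityMeasure ν]
    (hμ : IsShiftInvariant μ) (hν : IsShiftInvariant ν)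
    (hGμ : GibbsSwap β U μ) (hGν : GibbsSwap β W ν) {b : ℕ} {σ η : Config d S}
    (h : ∀ x ∉ cube d b, σ x = η x) (hlt : relEnergy U σ η < relEnergy W σ η) :
    ∃ k, ∃ δ > 0, ∀ n, δ * (tiles d k n).card ≤ ∑ ω : cube d n → S,
      cubeProb μ n ω * Real.log (cubeProb μ n ω / cubeProb ν n ω) := by
  -- In a large cube the gap between the two relative energies exceeds both truncation errors.
  obtain ⟨k, hk⟩ : ∃ k, cubeEnergy U k σ - cubeEnergy U k η +
      2 * ∑ x ∈ cube d b, tailSum (fun A => unifNorm (U A)) k x <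
      cubeEnergy W k σ - cubeEnergy W k η -
      2 * ∑ x ∈ cube d b, tailSum (fun A => unifNorm (W A)) k x := by
    have h1 := (hU.tendsto_cubeEnergy_sub h).add (hU.tendsto_sum_tailSum b)
    have h2 := (hW.tendsto_cubeEnergy_sub h).sub (hW.tendsto_sum_tailSum b)
    exact (h1.eventually_lt h2 (by linarith)).exists
  set c := Real.exp (-β * (cubeEnergy W k σ - cubeEnergy W k η -
    2 * ∑ x ∈ cube d b, tailSum (fun A => unifNorm (W A)) k x)) with hc
  have hc0 : 0 < c := Real.exp_pos _
  set Cσ := cylinderEvent (cube d k) (fun x => σ x) with hCσ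
  set Cη := cylinderEvent (cube d k) (fun x => η x) with hCη
  have hmσ : MeasurableSet Cσ := measurableSet_cylinderEvent _ _
  have hmη : MeasurableSet Cη := measurableSet_cylinderEvent _ _
  -- The constant c bounds the ratio of the weights of σ and η under ν for every exterior, so g has
  -- nonpositive mean under ν against any nonnegative exterior weight. Under μ the ratio is strictly
  -- larger than c.
  set g : Config d S → ℝ := fun ω =>
    Cσ.indicator (fun _ => (1 : ℝ)) ω - c * Cη.indicator (fun _ => (1 : ℝ)) ω with hg
  have hind : ∀ τ : Config d S, DependsOn
      ((cylinderEvent (cube d k) fun x => τ x).indicator fun _ => (1 : ℝ)) (cube d k) := by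
    intro τ ω ω' hω
    have : ω ∈ (cylinderEvent (cube d k) fun x => τ x) ↔
        ω' ∈ cylinderEvent (cube d k) fun x => τ x := by
      refine forall_congr' fun x => ?_
      rw [hω x x.2]
    by_cases hω' : ω' ∈ cylinderEvent (cube d k) fun x => τ x
    · rw [Set.indicator_of_mem hω', Set.indicator_of_mem (this.2 hω')]
    · rw [Set.indicator_of_notMem hω', Set.indicator_of_notMem (mt this.1 hω')]
  have hgd : DependsOn g (cube d k) := fun ω ω' hω => by
    simp only [hg, hCσ, hCη, hind σ hω, hind η hω]
  have hind01 : ∀ (A : Set (Config d S)) ω, 0 ≤ A.indicator (fun _ => (1 : ℝ)) ω ∧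
      A.indicator (fun _ => (1 : ℝ)) ω ≤ 1 := fun A ω =>
    ⟨Set.indicator_nonneg (fun _ _ => zero_le_one) ω,
      Set.indicator_le_self' (fun _ _ => zero_le_one) ω⟩
  have hgM : ∀ ω, |g ω| ≤ 1 + c := fun ω => by
    have h1 := hind01 Cσ ω
    have h2 := hind01 Cη ω
    have h3 := mul_le_mul_of_nonneg_left h2.2 hc0.le
    have h4 := mul_nonneg hc0.le h2.1
    rw [abs_le]
    constructor <;> simp only [hg] <;> linarith [h1.1, h1.2]
  have hgint : ∀ (ρ : Measure (Config d S)) [IsProbabilityMeasure ρ] (F : Config d S → ℝ),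
      Integrable F ρ → ∫ ω, g ω * F ω ∂ρ = ∫ ω in Cσ, F ω ∂ρ - c * ∫ ω in Cη, F ω ∂ρ := by
    intro ρ _ F hF
    rw [← integral_indicator hmσ, ← integral_indicator hmη, ← integral_const_mul,
      ← integral_sub (hF.indicator hmσ) ((hF.indicator hmη).const_mul c)]
    refine integral_congr_ae (Eventually.of_forall fun ω => ?_)
    by_cases h1 : ω ∈ Cσ <;> by_cases h2 : ω ∈ Cη <;> simp [hg, h1, h2, sub_mul]
  have hgν : ∀ F : Config d S → ℝ, Measurable F → DependsOn F ((cube d k : Set (Site d))ᶜ) →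
      (∃ c, ∀ ξ, |F ξ| ≤ c) → (∀ ξ, 0 ≤ F ξ) → ∫ ω, g ω * F ω ∂ν ≤ 0 := by
    rintro F hm hd ⟨a, ha⟩ h0
    rw [hgint ν F (Integrable.of_bound hm.aestronglyMeasurable a (Eventually.of_forall ha)),
      sub_nonpos]
    exact hGν.setIntegral_le hW hβ.le h hm hd ha h0
  obtain ⟨D, hD0, hD⟩ : ∃ D > 0, D ≤ ∫ ω, g ω ∂μ := by
    set c' := Real.exp (-β * (cubeEnergy U k η - cubeEnergy U k σ -
      2 * ∑ x ∈ cube d b, tailSum (fun A => unifNorm (U A)) k x)) with hc'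
    have h1 := hGμ.setIntegral_le hU hβ.le (k := k) (fun x hx => (h x hx).symm)
      (F := fun _ => 1) measurable_const (fun _ _ _ => rfl) (fun _ => le_rfl)
      fun _ => zero_le_one
    rw [← hc'] at h1
    have h2 := hgint μ (fun _ => 1) (integrable_const 1)
    have hpos : 0 < μ.real Cη := hGμ.cubeProb_pos hU hβ.le k fun x => η x
    simp only [mul_one, setIntegral_const, smul_eq_mul] at h1 h2
    -- The choice of k leaves a strict gap: 1/c' is a lower bound for the ratio under μ, and it
    -- exceeds c.
    have hcc : c * c' < 1 := by
      rw [hc, hc', ← Real.exp_add, Real.exp_lt_one_iff]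
      have := mul_lt_mul_of_pos_left hk hβ
      linarith
    refine ⟨(1 - c * c') * μ.real Cσ, mul_pos (by linarith) ?_, ?_⟩
    · exact hGμ.cubeProb_pos hU hβ.le k fun x => σ x
    · rw [h2]
      have := mul_le_mul_of_nonneg_left h1 hc0.le
      linarith
  set M := 1 + c + D with hM
  have hM0 : 0 < M := by positivity
  -- This l makes the quadratic cost (lM)² equal to lD/2, half of the linear gain. Including D in M
  -- gives lM ≤ 1 at once, as the expansion of exp requires.
  set l := D / (2 * M ^ 2) with hl
  have hl0 : 0 < l := by positivity
  have hlM : l * M ≤ 1 := by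
    rw [hl, div_mul_eq_mul_div, div_le_one (by positivity)]
    nlinarith
  have hexp : ∀ ω, Real.exp (l * g ω) ≤ 1 + l * g ω + (l * M) ^ 2 := fun ω => by
    have h1 : |l * g ω| ≤ l * M := by
      rw [abs_mul, abs_of_pos hl0]
      exact mul_le_mul_of_nonneg_left ((hgM ω).trans (by linarith)) hl0.le
    have h2 := (abs_le.1 (Real.abs_exp_sub_one_sub_id_le (h1.trans hlM))).2
    have h3 : (l * g ω) ^ 2 ≤ (l * M) ^ 2 := sq_le_sq' (abs_le.1 h1).1 (abs_le.1 h1).2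
    linarith
  refine ⟨k, l * D / 2, by positivity, fun n => ?_⟩
  set f : Config d S → ℝ := fun ω => ∑ x ∈ tiles d k n, l * g (shift x ω) with hf
  have hfd : DependsOn f (cube d n) := by
    refine DependsOn.finset_sum' fun x hx => ?_
    refine (DependsOn.comp_shift (hgd.comp_fun fun t => l * t) x).mono fun z hz => ?_
    simpa using add_mem_of_mem_tiles hx hz
  obtain ⟨ξ⟩ : Nonempty (Config d S) := inferInstance
  have hDV := sub_log_sum_le_relEntropy (hGμ.cubeProb_pos hU hβ.le n)
    (hGν.cubeProb_pos hW hβ.le n) (sum_cubeProb μ n) fun ω => f (glue (cube d n) ω ξ)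
  have hfμ := integral_of_dependsOn hfd μ ξ
  have hfν := integral_of_dependsOn (hfd.comp_fun Real.exp) ν ξ
  change ∫ ω, f ω ∂μ = ∑ ω : cube d n → S, cubeProb μ n ω * f (glue (cube d n) ω ξ) at hfμ
  change ∫ ω, Real.exp (f ω) ∂ν =
    ∑ ω : cube d n → S, cubeProb ν n ω * Real.exp (f (glue (cube d n) ω ξ)) at hfν
  rw [← hfμ, ← hfν] at hDV
  refine le_trans ?_ hDV
  have hgi := integrable_of_dependsOn hgd μ
  have h1 : ∫ ω, f ω ∂μ = (tiles d k n).card * (l * ∫ ω, g ω ∂μ) := by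
    simp only [hf]
    rw [integral_finsetSum _ fun x _ => (integrable_shift hμ hgi x).const_mul l]
    simp_rw [integral_const_mul, integral_shift hμ (measurable_of_dependsOn hgd)]
    rw [Finset.sum_const, nsmul_eq_mul]
  -- For each tile, exp(lg) ≤ 1 + lg + (lM)², and the linear term can be dropped because its
  -- weighted mean under ν is nonpositive.
  have h2 : ∫ ω, Real.exp (f ω) ∂ν ≤ (1 + (l * M) ^ 2) ^ (tiles d k n).card := by
    simp only [hf, Real.exp_sum]
    refine integral_prod_tiles_le hν (hgd.comp_fun fun t => Real.exp (l * t))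
      (fun _ => (Real.exp_pos _).le) (by positivity) (fun F hm hd ⟨a, ha⟩ h0 => ?_) subset_rfl
    have hFi : Integrable F ν :=
      Integrable.of_bound hm.aestronglyMeasurable a (Eventually.of_forall ha)
    have hgF : Integrable (fun ω => g ω * F ω) ν :=
      hFi.bdd_mul (measurable_of_dependsOn hgd).aestronglyMeasurable
        (Eventually.of_forall hgM)
    have heF : Integrable (fun ω => Real.exp (l * g ω) * F ω) ν :=
      hFi.bdd_mul (measurable_of_dependsOn (hgd.comp_fun fun t =>
        Real.exp (l * t))).aestronglyMeasurable
        (Eventually.of_forall (abs_le_unifNorm_of_dependsOn (hgd.comp_fun fun t =>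
          Real.exp (l * t))))
    calc ∫ ω, Real.exp (l * g ω) * F ω ∂ν
        ≤ ∫ ω, ((1 + (l * M) ^ 2) * F ω + l * (g ω * F ω)) ∂ν := by
          refine integral_mono heF ((hFi.const_mul _).add (hgF.const_mul l)) fun ω => ?_
          have := mul_le_mul_of_nonneg_right (hexp ω) (h0 ω)
          linarith
      _ = (1 + (l * M) ^ 2) * ∫ ω, F ω ∂ν + l * ∫ ω, g ω * F ω ∂ν := by
          rw [integral_add (hFi.const_mul _) (hgF.const_mul l), integral_const_mul,
            integral_const_mul]
      _ ≤ _ := by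
          have := mul_nonpos_of_nonneg_of_nonpos hl0.le (hgν F hm hd ⟨a, ha⟩ h0)
          linarith
  have h3 : Real.log (∫ ω, Real.exp (f ω) ∂ν) ≤ (tiles d k n).card * (l * M) ^ 2 := by
    refine (Real.log_le_log (integral_exp_pos_of_dependsOn hfd ν) h2).trans ?_
    rw [Real.log_pow]
    gcongr
    have := Real.log_le_sub_one_of_pos (show 0 < 1 + (l * M) ^ 2 by positivity)
    linarith
  have h4 : (l * M) ^ 2 = l * D / 2 := by
    rw [hl]
    field_simp
  rw [h1]
  rw [h4] at h3
  have h5 : (tiles d k n).card * (l * D) ≤ (tiles d k n).card * (l * ∫ ω, g ω ∂μ) := by gcongr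
  linarith

theorem GibbsSwap.relEntropyDensity_pos [Fintype S] [Nonempty S] [DiscreteMeasurableSpace S]
    {β : ℝ} (hβ : 0 < β) {U W : Interaction d S} (hU : IsPotential U) (hW : IsPotential W)
    {μ ν : Measure (Config d S)} [IsProbabilityMeasure μ] [IsProbabilityMeasure ν]
    (hμ : IsShiftInvariant μ) (hν : IsShiftInvariant ν)
    (hGμ : GibbsSwap β U μ) (hGν : GibbsSwap β W ν) (hne : ¬ PhysicallyEquivalent U W)
    {s : ℝ} (hs : HasRelEntropyDensity μ ν s) : 0 < s := by
  have hex : ∃ (b : ℕ) (σ η : Config d S), (∀ x ∉ cube d b, σ x = η x) ∧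
      relEnergy U σ η < relEnergy W σ η := by
    unfold PhysicallyEquivalent at hne
    push Not at hne
    obtain ⟨σ, η, hfin, hne⟩ := hne
    obtain ⟨b, hb⟩ := exists_subset_cube hfin.toFinset
    have hag : ∀ x ∉ cube d b, σ x = η x := fun x hx => by
      by_contra h
      exact hx (hb (hfin.mem_toFinset.2 h))
    have hneg : ∀ V : Interaction d S, relEnergy V η σ = -relEnergy V σ η := fun V => by
      rw [relEnergy, relEnergy, ← tsum_neg]
      simp
    -- Relative energies are antisymmetric, so exchanging σ and η produces the required direction of
    -- the inequality.
    rcases lt_or_gt_of_ne hne with h | h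
    · exact ⟨b, σ, η, hag, h⟩
    · exact ⟨b, η, σ, fun x hx => (hag x hx).symm, by rw [hneg, hneg]; linarith⟩
  obtain ⟨b, σ, η, hag, hlt⟩ := hex
  obtain ⟨k, δ, hδ, h⟩ := GibbsSwap.relEntropy_ge hβ hU hW hμ hν hGμ hGν hag hlt
  have hpk := card_cube_pos d k
  have h1 : Tendsto (fun n => δ / (cube d k).card *
      (((tiles d k n).card * (cube d k).card : ℝ) / (cube d n).card)) atTop
      (𝓝 (δ / (cube d k).card * 1)) := (tendsto_card_tiles k).const_mul _
  refine lt_of_lt_of_le (by positivity) (le_of_tendsto_of_tendsto' h1 hs.2 fun n => ?_)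
  have hp := card_cube_pos d n
  calc _ = 1 / ((cube d n).card : ℝ) * (δ * (tiles d k n).card) := by field_simp
    _ ≤ _ := mul_le_mul_of_nonneg_left (h n) (by positivity)

end Positivity

/-! ### Gibbs averages on a finite set -/

section FiniteGibbs

variable {α : Type*} [Fintype α]

/-- The mean of `g` with respect to the weights `exp h` on a finite set. -/
noncomputable def gibbsAvg (h g : α → ℝ) : ℝ :=
  (∑ a, g a * Real.exp (h a)) / ∑ a, Real.exp (h a)

theorem gibbsAvg_add (h g₁ g₂ : α → ℝ) :
    gibbsAvg h (fun a => g₁ a + g₂ a) = gibbsAvg h g₁ + gibbsAvg h g₂ := by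
  simp only [gibbsAvg, add_mul, Finset.sum_add_distrib, add_div]

theorem gibbsAvg_sub (h g₁ g₂ : α → ℝ) :
    gibbsAvg h (fun a => g₁ a - g₂ a) = gibbsAvg h g₁ - gibbsAvg h g₂ := by
  simp only [gibbsAvg, sub_mul, Finset.sum_sub_distrib, sub_div]

theorem gibbsAvg_const_mul (h g : α → ℝ) (c : ℝ) :
    gibbsAvg h (fun a => c * g a) = c * gibbsAvg h g := by
  simp only [gibbsAvg, mul_assoc, ← Finset.mul_sum, mul_div_assoc]

theorem gibbsAvg_sum {ι : Type*} (s : Finset ι) (h : α → ℝ) (g : ι → α → ℝ) :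
    gibbsAvg h (fun a => ∑ i ∈ s, g i a) = ∑ i ∈ s, gibbsAvg h (g i) := by
  simp only [gibbsAvg, Finset.sum_mul, ← Finset.sum_div]
  rw [Finset.sum_comm]

theorem gibbsAvg_mono (h : α → ℝ) {g₁ g₂ : α → ℝ} (hg : ∀ a, g₁ a ≤ g₂ a) :
    gibbsAvg h g₁ ≤ gibbsAvg h g₂ := by
  unfold gibbsAvg
  gcongr with a
  exact hg a

theorem abs_gibbsAvg_le (h g : α → ℝ) : |gibbsAvg h g| ≤ gibbsAvg h fun a => |g a| := by
  unfold gibbsAvg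
  rw [abs_div, abs_of_nonneg (Finset.sum_nonneg fun a _ => (Real.exp_pos (h a)).le)]
  gcongr
  refine (Finset.abs_sum_le_sum_abs _ _).trans (le_of_eq ?_)
  simp only [abs_mul, Real.abs_exp]

theorem gibbsAvg_add_const (h g : α → ℝ) (c : ℝ) :
    gibbsAvg (fun a => h a + c) g = gibbsAvg h g := by
  simp only [gibbsAvg, Real.exp_add, ← mul_assoc, ← Finset.sum_mul]
  rw [mul_div_mul_right _ _ (Real.exp_ne_zero c)]

theorem hasDerivAt_sum_exp (h w g : α → ℝ) (t : ℝ) :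
    HasDerivAt (fun t : ℝ => ∑ a, g a * Real.exp (h a + t * w a))
      (∑ a, g a * w a * Real.exp (h a + t * w a)) t := by
  refine HasDerivAt.fun_sum fun a _ => ?_
  have h1 : HasDerivAt (fun t : ℝ => h a + t * w a) (w a) t := by
    simpa using ((hasDerivAt_id t).mul_const (w a)).const_add (h a)
  exact ((h1.exp).const_mul (g a)).congr_deriv (by ring)

variable [Nonempty α]

theorem sum_exp_pos (h : α → ℝ) : 0 < ∑ a, Real.exp (h a) :=
  Finset.sum_pos (fun _ _ => Real.exp_pos _) Finset.univ_nonempty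

theorem gibbsAvg_const (h : α → ℝ) (c : ℝ) : gibbsAvg h (fun _ => c) = c := by
  rw [gibbsAvg, ← Finset.mul_sum, mul_div_cancel_right₀ _ (sum_exp_pos h).ne']

theorem abs_gibbsAvg_le_of_abs_le (h : α → ℝ) {g : α → ℝ} {c : ℝ} (hg : ∀ a, |g a| ≤ c) :
    |gibbsAvg h g| ≤ c :=
  (abs_gibbsAvg_le h g).trans ((gibbsAvg_mono h hg).trans_eq (gibbsAvg_const h c))

theorem sq_gibbsAvg_le (h g : α → ℝ) : gibbsAvg h g ^ 2 ≤ gibbsAvg h fun a => g a ^ 2 := by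
  set m := gibbsAvg h g with hm
  have h1 : gibbsAvg h (fun _ => 0) ≤ gibbsAvg h fun a => g a ^ 2 - 2 * m * g a + m ^ 2 :=
    gibbsAvg_mono h fun a => by nlinarith [sq_nonneg (g a - m)]
  rw [gibbsAvg_const, gibbsAvg_add, gibbsAvg_sub, gibbsAvg_const_mul, gibbsAvg_const, ← hm] at h1
  linarith

/-- Centring g at the midpoint of its range leaves deviations of at most δ/2, and the mean deviation
of w is at most its standard deviation, hence at most M. The factor 1/2 is what later allows the
bound 1 in the smallness condition. -/
theorem abs_cov_le (h : α → ℝ) {g w : α → ℝ} {δ M : ℝ} (hg : ∀ a b, g a - g b ≤ δ)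
    (hw : ∀ a, |w a| ≤ M) :
    |gibbsAvg h (fun a => g a * w a) - gibbsAvg h g * gibbsAvg h w| ≤ δ * M / 2 := by
  obtain ⟨a, ha⟩ := Finite.exists_max g
  obtain ⟨b, hb⟩ := Finite.exists_min g
  have hM : 0 ≤ M := (abs_nonneg _).trans (hw a)
  have hδ : 0 ≤ δ := by simpa using hg a a
  set m := (g a + g b) / 2
  set v := gibbsAvg h w with hv
  have hgm : ∀ x, |g x - m| ≤ δ / 2 := fun x => by
    rw [abs_le]
    have := hg a b
    constructor <;> simp only [m] <;> linarith [ha x, hb x]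
  have hcov : gibbsAvg h (fun a => g a * w a) - gibbsAvg h g * v =
      gibbsAvg h fun x => (g x - m) * (w x - v) := by
    have : (fun x => (g x - m) * (w x - v)) =
        fun x => g x * w x - v * g x - (m * w x - m * v) := by
      ext x
      ring
    rw [this, gibbsAvg_sub, gibbsAvg_sub, gibbsAvg_sub, gibbsAvg_const_mul, gibbsAvg_const_mul,
      gibbsAvg_const, ← hv]
    ring
  have h1 : gibbsAvg h (fun x => |w x - v|) ≤ M := by
    refine abs_le_of_sq_le_sq' ?_ hM |>.2
    refine (sq_gibbsAvg_le h _).trans ?_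
    have h2 : (fun x => |w x - v| ^ 2) = fun x => w x ^ 2 - 2 * v * w x + v ^ 2 := by
      ext x
      rw [sq_abs]
      ring
    rw [h2, gibbsAvg_add, gibbsAvg_sub, gibbsAvg_const_mul, gibbsAvg_const, ← hv]
    have h3 : gibbsAvg h (fun x => w x ^ 2) ≤ M ^ 2 :=
      (gibbsAvg_mono h fun x => sq_le_sq' (abs_le.1 (hw x)).1 (abs_le.1 (hw x)).2).trans_eq
        (gibbsAvg_const h _)
    nlinarith [sq_nonneg v]
  rw [hcov]
  refine (abs_gibbsAvg_le h _).trans ?_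
  calc gibbsAvg h (fun x => |(g x - m) * (w x - v)|)
      ≤ gibbsAvg h fun x => δ / 2 * |w x - v| := gibbsAvg_mono h fun x => by
        rw [abs_mul]
        gcongr
        exact hgm x
    _ = δ / 2 * gibbsAvg h fun x => |w x - v| := gibbsAvg_const_mul _ _ _
    _ ≤ δ / 2 * M := by gcongr
    _ = δ * M / 2 := by ring

theorem hasDerivAt_log_sum_exp (h w : α → ℝ) (t : ℝ) :
    HasDerivAt (fun t : ℝ => Real.log (∑ a, Real.exp (h a + t * w a)))
      (gibbsAvg (fun a => h a + t * w a) w) t := by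
  have h1 := hasDerivAt_sum_exp h w (fun _ => 1) t
  simp only [one_mul] at h1
  exact h1.log (sum_exp_pos _).ne'

theorem hasDerivAt_gibbsAvg (h w g : α → ℝ) (t : ℝ) :
    HasDerivAt (fun t : ℝ => gibbsAvg (fun a => h a + t * w a) g)
      (gibbsAvg (fun a => h a + t * w a) (fun a => g a * w a) -
        gibbsAvg (fun a => h a + t * w a) g * gibbsAvg (fun a => h a + t * w a) w) t := by
  have h1 := hasDerivAt_sum_exp h w (fun _ => 1) t
  simp only [one_mul] at h1
  have hZ := (sum_exp_pos fun a => h a + t * w a).ne'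
  refine ((hasDerivAt_sum_exp h w g t).fun_div h1 hZ).congr_deriv ?_
  rw [sub_div, sq, mul_div_mul_right _ _ hZ, gibbsAvg, gibbsAvg, gibbsAvg, div_mul_div_comm]

/-- A perturbation of the exponent by at most `M` changes the mean of `g` by at most half of `M`
times the oscillation of `g`. -/
theorem abs_gibbsAvg_sub_le {h h' g : α → ℝ} {δ M c : ℝ} (hg : ∀ a b, g a - g b ≤ δ)
    (hh : ∀ a, |h' a - h a - c| ≤ M) :
    |gibbsAvg h' g - gibbsAvg h g| ≤ δ * M / 2 := by
  set w : α → ℝ := fun a => h' a - h a - c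
  have h1 : gibbsAvg h' g = gibbsAvg (fun a => h a + (1 : ℝ) * w a) g := by
    rw [← gibbsAvg_add_const (fun a => h a + 1 * w a) g c]
    congr 1
    ext a
    simp only [w]
    ring
  have h0 : gibbsAvg h g = gibbsAvg (fun a => h a + (0 : ℝ) * w a) g := by simp
  rw [h1, h0]
  -- Along the interpolation h + tw the derivative of the mean of g is a covariance. The constant c
  -- has disappeared by normalization.
  have := (convex_univ (𝕜 := ℝ) (E := ℝ)).norm_image_sub_le_of_norm_hasDerivWithin_le
    (fun t _ => (hasDerivAt_gibbsAvg h w g t).hasDerivWithinAt)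
    (fun t _ => abs_cov_le _ hg hh) (Set.mem_univ (0 : ℝ)) (Set.mem_univ 1)
  simpa using this

end FiniteGibbs

/-! ### Dobrushin's comparison theorem by random-scan dynamics -/

section Dobrushin

variable {ι S : Type*} [Fintype ι] [DecidableEq ι] [Fintype S] [Nonempty S]

/-- `δ i` bounds the oscillation of `f` in the coordinate `i`. -/
def OscBound (f : (ι → S) → ℝ) (δ : ι → ℝ) : Prop :=
  ∀ i σ s, |f (Function.update σ i s) - f σ| ≤ δ i

/-- The conditional mean of `f` given all coordinates but `i`, for the weights `exp h`. -/
noncomputable def siteAvg (h : (ι → S) → ℝ) (i : ι) (f : (ι → S) → ℝ) (σ : ι → S) : ℝ :=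
  gibbsAvg (fun s => h (Function.update σ i s)) fun s => f (Function.update σ i s)

omit [Fintype ι] [Fintype S] [Nonempty S] in
theorem OscBound.sub_le {f : (ι → S) → ℝ} {δ : ι → ℝ} (hf : OscBound f δ) (i : ι) (σ : ι → S)
    (s s' : S) : f (Function.update σ i s) - f (Function.update σ i s') ≤ δ i := by
  have := hf i (Function.update σ i s') s
  rw [Function.update_idem] at this
  exact (le_abs_self _).trans this

omit [Fintype S] [Nonempty S] in
theorem OscBound.abs_sub_le_sum {f : (ι → S) → ℝ} {δ : ι → ℝ} (hf : OscBound f δ)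
    (σ η : ι → S) : |f σ - f η| ≤ ∑ i, δ i := by
  have h : ∀ t : Finset ι, |f (t.piecewise σ η) - f η| ≤ ∑ i ∈ t, δ i := fun t => by
    induction t using Finset.induction_on with
    | empty => simp
    | insert j t hj ih =>
      rw [Finset.piecewise_insert, Finset.sum_insert hj]
      refine (abs_sub_le _ (f (t.piecewise σ η)) _).trans (add_le_add ?_ ih)
      exact hf j _ _
  simpa using h Finset.univ

/-- Reversibility of single-site resampling: the joint weight of the configurations before and after
resampling is symmetric. -/
theorem gibbsAvg_siteAvg (h f : (ι → S) → ℝ) (i : ι) :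
    gibbsAvg h (siteAvg h i f) = gibbsAvg h f := by
  unfold gibbsAvg
  congr 1
  set Z : (ι → S) → ℝ := fun σ => ∑ s, Real.exp (h (Function.update σ i s)) with hZ
  have hZ0 : ∀ σ, Z σ ≠ 0 := fun σ => (sum_exp_pos _).ne'
  have hZu : ∀ σ s, Z (Function.update σ i s) = Z σ := fun σ s => by
    simp only [hZ, Function.update_idem]
  -- The involution swaps the old and the resampled spin at i; the conditional normalization does
  -- not depend on that spin.
  set e : (ι → S) × S → (ι → S) × S := fun p => (Function.update p.1 i p.2, p.1 i) with he
  have hinv : Function.Involutive e := fun p => by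
    simp [he]
  calc ∑ σ, siteAvg h i f σ * Real.exp (h σ)
      = ∑ p : (ι → S) × S, f (Function.update p.1 i p.2) *
          Real.exp (h (Function.update p.1 i p.2)) / Z p.1 * Real.exp (h p.1) := by
        rw [Fintype.sum_prod_type]
        refine Finset.sum_congr rfl fun σ _ => ?_
        rw [siteAvg, gibbsAvg, Finset.sum_div, Finset.sum_mul]
    _ = ∑ p : (ι → S) × S, f p.1 * Real.exp (h p.1) / Z p.1 *
          Real.exp (h (Function.update p.1 i p.2)) := by
        refine Fintype.sum_equiv hinv.toPerm _ _ fun p => ?_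
        simp [he, hZu]
    _ = ∑ σ, f σ * Real.exp (h σ) := by
        rw [Fintype.sum_prod_type]
        refine Finset.sum_congr rfl fun σ _ => ?_
        dsimp only
        rw [← Finset.mul_sum]
        exact div_mul_cancel₀ _ (hZ0 σ)

/-- Dobrushin's condition: `C i j` bounds the influence of the coordinate `j` on the conditional
distribution of the coordinate `i`, and the total influence on each coordinate is at most `c`. -/
structure DobrushinCondition (h : (ι → S) → ℝ) (C : ι → ι → ℝ) (c : ℝ) : Prop where
  nonneg : ∀ i j, 0 ≤ C i j
  influence : ∀ i j, j ≠ i → ∀ σ a, ∃ b, ∀ s,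
    |h (Function.update (Function.update σ j a) i s) - h (Function.update σ i s) - b| ≤ 2 * C i j
  sum_le : ∀ i, ∑ j ∈ Finset.univ.erase i, C i j ≤ c

omit [Fintype ι] in
-- A change at j acts on the integrand, costing δ_j, and on the conditional law at i, costing C_ij
-- δ_i. The dependence on i itself is averaged out.
theorem OscBound.siteAvg {h f : (ι → S) → ℝ} {C : ι → ι → ℝ}
    (hC : ∀ i j, j ≠ i → ∀ σ a, ∃ b, ∀ s, |h (Function.update (Function.update σ j a) i s) -
      h (Function.update σ i s) - b| ≤ 2 * C i j) {δ : ι → ℝ} (hf : OscBound f δ) (i : ι) :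
    OscBound (siteAvg h i f) fun j => if j = i then 0 else δ j + C i j * δ i := by
  intro j σ a
  by_cases hij : j = i
  · subst hij
    simp [_root_.siteAvg]
  · simp only [if_neg hij]
    obtain ⟨b, hb⟩ := hC i j hij σ a
    refine (abs_sub_le _ (gibbsAvg (fun s => h (Function.update (Function.update σ j a) i s))
      fun s => f (Function.update σ i s)) _).trans (add_le_add ?_ ?_)
    · rw [_root_.siteAvg, ← gibbsAvg_sub]
      refine abs_gibbsAvg_le_of_abs_le _ fun s => ?_
      rw [Function.update_comm hij]
      exact hf j _ _
    · refine (abs_gibbsAvg_sub_le (fun s s' => hf.sub_le i σ s s') hb).trans (le_of_eq ?_)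
      ring

variable [Nonempty ι]

/-- The transition operator of the random-scan dynamics. -/
noncomputable def scanAvg (h f : (ι → S) → ℝ) (σ : ι → S) : ℝ :=
  (Fintype.card ι : ℝ)⁻¹ * ∑ i, siteAvg h i f σ

theorem gibbsAvg_scanAvg (h f : (ι → S) → ℝ) : gibbsAvg h (scanAvg h f) = gibbsAvg h f := by
  have : (Fintype.card ι : ℝ) ≠ 0 := by exact_mod_cast Fintype.card_ne_zero
  change gibbsAvg h (fun σ => (Fintype.card ι : ℝ)⁻¹ * ∑ i, siteAvg h i f σ) = _
  rw [gibbsAvg_const_mul, gibbsAvg_sum]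
  simp only [gibbsAvg_siteAvg, Finset.sum_const, Finset.card_univ, nsmul_eq_mul]
  field_simp

/-- Resampling i removes the oscillation δ_i and spreads at most cδ_i over the other sites.
Averaging over i contracts the total oscillation. -/
theorem DobrushinCondition.exists_oscBound_scanAvg {h : (ι → S) → ℝ} {C : ι → ι → ℝ} {c : ℝ}
    (hC : DobrushinCondition h C c) {f : (ι → S) → ℝ} {δ : ι → ℝ} (hf : OscBound f δ) :
    ∃ δ', OscBound (scanAvg h f) δ' ∧
      ∑ i, δ' i ≤ (1 - (1 - c) / Fintype.card ι) * ∑ i, δ i := by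
  have hN : (0 : ℝ) < Fintype.card ι := by exact_mod_cast Fintype.card_pos
  have hδ : ∀ i, 0 ≤ δ i := fun i =>
    (abs_nonneg _).trans (hf i (Classical.arbitrary _) (Classical.arbitrary _))
  refine ⟨fun j => (Fintype.card ι : ℝ)⁻¹ * ∑ i, if j = i then 0 else δ j + C i j * δ i,
    fun j σ a => ?_, ?_⟩
  · rw [scanAvg, scanAvg, ← mul_sub, abs_mul, abs_of_pos (inv_pos.2 hN),
      ← Finset.sum_sub_distrib]
    refine mul_le_mul_of_nonneg_left ?_ (inv_pos.2 hN).le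
    refine (Finset.abs_sum_le_sum_abs _ _).trans (Finset.sum_le_sum fun i _ => ?_)
    exact hf.siteAvg hC.influence i j σ a
  · rw [← Finset.mul_sum, Finset.sum_comm]
    have h1 : ∀ i, (∑ j, if j = i then 0 else δ j + C i j * δ i) ≤
        ∑ j, δ j - δ i + c * δ i := fun i => by
      have h2 : (∑ j, if j = i then 0 else δ j + C i j * δ i) =
          ∑ j ∈ Finset.univ.erase i, (δ j + C i j * δ i) := by
        rw [← Finset.add_sum_erase _ _ (Finset.mem_univ i), if_pos rfl, zero_add]
        exact Finset.sum_congr rfl fun j hj => if_neg (Finset.ne_of_mem_erase hj)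
      rw [h2, Finset.sum_add_distrib, ← Finset.sum_mul,
        ← Finset.add_sum_erase _ δ (Finset.mem_univ i), add_sub_cancel_left]
      gcongr
      · exact hδ i
      · exact hC.sum_le i
    calc (Fintype.card ι : ℝ)⁻¹ * ∑ i, ∑ j, (if j = i then 0 else δ j + C i j * δ i)
        ≤ (Fintype.card ι : ℝ)⁻¹ * ∑ i, (∑ j, δ j - δ i + c * δ i) := by
          gcongr with i
          exact h1 i
      _ = (1 - (1 - c) / Fintype.card ι) * ∑ i, δ i := by
          rw [Finset.sum_add_distrib, Finset.sum_sub_distrib, ← Finset.mul_sum, Finset.sum_const,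
            Finset.card_univ, nsmul_eq_mul]
          field_simp
          ring

/-- Dobrushin's comparison theorem, for a uniform bound of the perturbation. -/
theorem DobrushinCondition.abs_gibbsAvg_sub_le {h : (ι → S) → ℝ} {C : ι → ι → ℝ} {c : ℝ}
    (hC : DobrushinCondition h C c) (hc : c < 1) {h' : (ι → S) → ℝ} {M : ℝ} (hM : 0 ≤ M)
    (hh : ∀ i σ, ∃ b, ∀ s, |h' (Function.update σ i s) - h (Function.update σ i s) - b| ≤ M)
    {f : (ι → S) → ℝ} {δ : ι → ℝ} (hf : OscBound f δ) :
    |gibbsAvg h' f - gibbsAvg h f| ≤ M / (2 * (1 - c)) * ∑ i, δ i := by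
  have hN : (1 : ℝ) ≤ Fintype.card ι := by exact_mod_cast Fintype.card_pos
  have hN0 : (0 : ℝ) < Fintype.card ι := by linarith
  have hc0 : 0 ≤ c := (Finset.sum_nonneg fun j _ => hC.nonneg _ j).trans
    (hC.sum_le (Classical.arbitrary ι))
  set B := M / (2 * (1 - c)) with hB
  set r := 1 - (1 - c) / (Fintype.card ι : ℝ) with hr
  have hr0 : 0 ≤ r := by
    rw [hr, sub_nonneg, div_le_one hN0]
    linarith
  have hr1 : r < 1 := by
    have : 0 < (1 - c) / (Fintype.card ι : ℝ) := div_pos (by linarith) hN0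
    linarith
  have hB0 : 0 ≤ B := div_nonneg hM (by linarith)
  -- Each scan leaves the mean for h unchanged and contracts the oscillation; r^k is the remainder
  -- after k scans.
  have key : ∀ (k : ℕ) (f : (ι → S) → ℝ) (δ : ι → ℝ), OscBound f δ →
      |gibbsAvg h' f - gibbsAvg h f| ≤ (B + r ^ k) * ∑ i, δ i := by
    intro k
    induction k with
    | zero =>
      intro f δ hf
      have hsum : 0 ≤ ∑ i, δ i :=
        (abs_nonneg _).trans (hf.abs_sub_le_sum (Classical.arbitrary _) (Classical.arbitrary _))
      have h1 : ∀ (h : (ι → S) → ℝ) σ, |f σ - gibbsAvg h f| ≤ ∑ i, δ i := fun h σ => by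
        rw [← gibbsAvg_const h (f σ), ← gibbsAvg_sub]
        exact abs_gibbsAvg_le_of_abs_le _ fun η => hf.abs_sub_le_sum σ η
      have h2 : |gibbsAvg h' f - gibbsAvg h f| ≤ ∑ i, δ i := by
        rw [← gibbsAvg_const h' (gibbsAvg h f), ← gibbsAvg_sub]
        exact abs_gibbsAvg_le_of_abs_le _ fun η => h1 h η
      have h3 := mul_nonneg hB0 hsum
      rw [pow_zero]
      linarith
    | succ k ih =>
      intro f δ hf
      obtain ⟨δ', hδ', hsum⟩ := hC.exists_oscBound_scanAvg hf
      -- The mean for h' is invariant under its own scan, so only the single-site conditional laws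
      -- of h and h' have to be compared.
      have h1 : |gibbsAvg h' f - gibbsAvg h' (scanAvg h f)| ≤
          M / (2 * Fintype.card ι) * ∑ i, δ i := by
        rw [← gibbsAvg_scanAvg h' f, ← gibbsAvg_sub]
        refine abs_gibbsAvg_le_of_abs_le _ fun σ => ?_
        rw [scanAvg, scanAvg, ← mul_sub, abs_mul, abs_of_pos (inv_pos.2 hN0),
          ← Finset.sum_sub_distrib]
        have h2 : |∑ i, (siteAvg h' i f σ - siteAvg h i f σ)| ≤ ∑ i, δ i * M / 2 := by
          refine (Finset.abs_sum_le_sum_abs _ _).trans (Finset.sum_le_sum fun i _ => ?_)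
          obtain ⟨b, hb⟩ := hh i σ
          exact _root_.abs_gibbsAvg_sub_le (fun s s' => hf.sub_le i σ s s') hb
        refine (mul_le_mul_of_nonneg_left h2 (inv_pos.2 hN0).le).trans (le_of_eq ?_)
        rw [← Finset.sum_div, ← Finset.sum_mul]
        field_simp
      have h3 := ih _ _ hδ'
      rw [gibbsAvg_scanAvg] at h3
      have h4 : (B + r ^ k) * ∑ i, δ' i ≤ (B + r ^ k) * (r * ∑ i, δ i) := by
        gcongr
      -- B is the fixed point of the recursion for the accumulated error.
      have h5 : M / (2 * Fintype.card ι) + B * r = B := by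
        have : 1 - c ≠ 0 := by linarith
        rw [hB, hr]
        field_simp
        ring
      calc |gibbsAvg h' f - gibbsAvg h f|
          ≤ |gibbsAvg h' f - gibbsAvg h' (scanAvg h f)| +
            |gibbsAvg h' (scanAvg h f) - gibbsAvg h f| := abs_sub_le _ _ _
        _ ≤ M / (2 * Fintype.card ι) * ∑ i, δ i + (B + r ^ k) * (r * ∑ i, δ i) := by linarith
        _ = (M / (2 * Fintype.card ι) + B * r + r ^ (k + 1)) * ∑ i, δ i := by ring
        _ = (B + r ^ (k + 1)) * ∑ i, δ i := by rw [h5]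
  have hlim : Tendsto (fun k => (B + r ^ k) * ∑ i, δ i) atTop (𝓝 ((B + 0) * ∑ i, δ i)) :=
    ((tendsto_pow_atTop_nhds_zero_of_lt_one hr0 hr1).const_add B).mul_const _
  rw [add_zero] at hlim
  exact ge_of_tendsto' hlim fun k => key k f δ hf

/-- Under Dobrushin's condition the logarithm of the partition function has a second-order
expansion whose error is proportional to the number of coordinates. -/
theorem DobrushinCondition.abs_log_sum_exp_sub_le {h : (ι → S) → ℝ} {C : ι → ι → ℝ} {c : ℝ}
    (hC : DobrushinCondition h C c) (hc : c < 1) {w : (ι → S) → ℝ} {m : ℝ}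
    (hw : OscBound w fun _ => m) (t : ℝ) :
    |Real.log (∑ σ, Real.exp (h σ + t * w σ)) - Real.log (∑ σ, Real.exp (h σ)) -
      t * gibbsAvg h w| ≤ t ^ 2 * (m ^ 2 / (2 * (1 - c)) * Fintype.card ι) := by
  have hm : 0 ≤ m := (abs_nonneg _).trans
    (hw (Classical.arbitrary ι) (Classical.arbitrary _) (Classical.arbitrary _))
  have h1 : ∀ s : ℝ, |gibbsAvg (fun σ => h σ + s * w σ) w - gibbsAvg h w| ≤
      |s| * (m ^ 2 / (2 * (1 - c)) * Fintype.card ι) := fun s => by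
    refine (hC.abs_gibbsAvg_sub_le hc (M := |s| * m) (by positivity) (fun i σ =>
      ⟨s * w σ, fun a => ?_⟩) hw).trans (le_of_eq ?_)
    · rw [add_sub_cancel_left, ← mul_sub, abs_mul]
      exact mul_le_mul_of_nonneg_left (hw i σ a) (abs_nonneg s)
    · rw [Finset.sum_const, Finset.card_univ, nsmul_eq_mul]
      ring
  -- After subtraction of the linear term, the derivative at s is the change of the mean of w, which
  -- the comparison theorem bounds linearly in |s|. The mean value inequality supplies the second
  -- factor |t|.
  have h2 := (convex_uIcc (0 : ℝ) t).norm_image_sub_le_of_norm_hasDerivWithin_le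
    (f := fun s => Real.log (∑ σ, Real.exp (h σ + s * w σ)) - s * gibbsAvg h w)
    (f' := fun s => gibbsAvg (fun σ => h σ + s * w σ) w - 1 * gibbsAvg h w)
    (C := |t| * (m ^ 2 / (2 * (1 - c)) * Fintype.card ι))
    (fun s _ => ((hasDerivAt_log_sum_exp h w s).sub
      ((hasDerivAt_id s).mul_const _)).hasDerivWithinAt) (fun s hs => ?_)
    Set.left_mem_uIcc Set.right_mem_uIcc
  · simp only [zero_mul, add_zero, sub_zero, Real.norm_eq_abs] at h2
    calc _ = _ := by
          congr 1
          ring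
      _ ≤ _ := h2
      _ = t ^ 2 * (m ^ 2 / (2 * (1 - c)) * Fintype.card ι) := by
          rw [← sq_abs t]
          ring
  · rw [one_mul, Real.norm_eq_abs]
    refine (h1 s).trans (mul_le_mul_of_nonneg_right ?_ ?_)
    · simpa using Set.abs_sub_left_of_mem_uIcc hs
    · have : 0 < 1 - c := by linarith
      positivity

end Dobrushin

/-! ### Differentiability of the free energy for small potentials -/

section SmallPotentials

variable {d : ℕ} {S : Type*}

theorem glue_update {Λ : Finset (Site d)} (σ : Λ → S) (x : Λ) (s : S) (ξ : Config d S) :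
    glue Λ (Function.update σ x s) ξ = Function.update (glue Λ σ ξ) x s := by
  ext y
  by_cases hy : y ∈ Λ
  · rw [glue_apply_mem hy, Function.update_apply, Function.update_apply, glue_apply_mem hy]
    simp only [Subtype.ext_iff]
  · rw [glue_apply_notMem hy, Function.update_of_ne (fun h => hy (by rw [h]; exact x.2)),
      glue_apply_notMem hy]

theorem IsPotential.update_of_notMem {U : Interaction d S} (hU : IsPotential U)
    {A : Finset (Site d)} {x : Site d} (hx : x ∉ A) (σ : Config d S) (s : S) :
    U A (Function.update σ x s) = U A σ :=
  hU.dep A _ _ fun _ hy => Function.update_of_ne (ne_of_mem_of_not_mem hy hx) _ _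

theorem IsPotential.abs_cubeEnergy_update_sub_le [Finite S] {U : Interaction d S}
    (hU : IsPotential U) (n : ℕ) (σ : Config d S) (x : Site d) (s : S) :
    |cubeEnergy U n (Function.update σ x s) - cubeEnergy U n σ| ≤
      2 * starSum (fun A => unifNorm (U A)) 0 := by
  rw [cubeEnergy, cubeEnergy, ← Finset.sum_sub_distrib, ← hU.isWeight.starSum_eq x, starSum,
    ← tsum_mul_left]
  refine (Finset.abs_sum_le_sum_abs _ _).trans ((Finset.sum_le_sum fun A _ => ?_).trans
    (((hU.isWeight.summable_star x).mul_left 2).sum_le_tsum (cube d n).powerset fun A _ =>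
      mul_nonneg zero_le_two (hU.isWeight.indicator_nonneg _ A)))
  have := hU.norm_sub_le (Λ := {x}) (σ := Function.update σ x s) (η := σ)
    (fun y hy => Function.update_of_ne (by simpa using hy) _ _) A
  rwa [Finset.sum_singleton] at this

/-- The weight of the finite sets that contain two given sites, in a cube. -/
noncomputable def pairSum (N : Finset (Site d) → ℝ) (n : ℕ) (x y : Site d) : ℝ :=
  ∑ A ∈ (cube d n).powerset, if x ∈ A ∧ y ∈ A then N A else 0

theorem IsPotential.exists_abs_cubeEnergy_sub_le [Finite S] {U : Interaction d S}
    (hU : IsPotential U) (n : ℕ) {x y : Site d} (hxy : y ≠ x) (σ : Config d S) (a : S) :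
    ∃ b, ∀ s, |cubeEnergy U n (Function.update (Function.update σ y a) x s) -
        cubeEnergy U n (Function.update σ x s) - b| ≤
      2 * pairSum (fun A => unifNorm (U A)) n x y := by
  -- Sets that avoid x give a constant in s, collected in b; for sets that contain x but not y the
  -- change at y is invisible. Only sets containing both sites remain.
  refine ⟨∑ A ∈ (cube d n).powerset, if x ∈ A then 0 else U A (Function.update σ y a) - U A σ,
    fun s => ?_⟩
  rw [cubeEnergy, cubeEnergy, ← Finset.sum_sub_distrib, ← Finset.sum_sub_distrib, pairSum,
    Finset.mul_sum]
  refine (Finset.abs_sum_le_sum_abs _ _).trans (Finset.sum_le_sum fun A _ => ?_)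
  by_cases hx : x ∈ A
  · by_cases hy : y ∈ A
    · simp only [hx, hy, if_true, and_self, sub_zero]
      rw [two_mul]
      exact (abs_sub _ _).trans (add_le_add (hU.abs_le A _) (hU.abs_le A _))
    · rw [Function.update_comm hxy, hU.update_of_notMem hy]
      simp [hx, hy]
  · rw [hU.update_of_notMem hx, hU.update_of_notMem hx]
    simp [hx]

/-- A set A through x is counted once for each of its other sites in the cube. This is the origin of
the factor |A| - 1. -/
theorem sum_pairSum_le {N : Finset (Site d) → ℝ} (hN : IsWeight N)
    (hs : Summable ({A : Finset (Site d) | 0 ∈ A}.indicator fun A => ((A.card : ℝ) - 1) * N A))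
    (n : ℕ) (x : cube d n) :
    ∑ y ∈ Finset.univ.erase x, pairSum N n x y ≤
      starSum (fun A => ((A.card : ℝ) - 1) * N A) 0 := by
  have hinv : ∀ x A, (((shiftSet x A).card : ℝ) - 1) * N (shiftSet x A) =
      ((A.card : ℝ) - 1) * N A := fun x A => by rw [card_shiftSet, hN.comp_shiftSet]
  have hnn : ∀ A, 0 ≤ {A : Finset (Site d) | (x : Site d) ∈ A}.indicator
      (fun A => ((A.card : ℝ) - 1) * N A) A := fun A => by
    refine Set.indicator_nonneg (fun A hA => mul_nonneg ?_ (hN.nonneg A)) A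
    rw [sub_nonneg]
    exact_mod_cast Finset.card_pos.2 ⟨_, hA⟩
  rw [← starSum_eq hinv x, starSum]
  refine le_trans ?_ ((summable_star hinv hs x).sum_le_tsum (cube d n).powerset fun A _ => hnn A)
  unfold pairSum
  rw [Finset.sum_comm]
  refine Finset.sum_le_sum fun A _ => ?_
  by_cases hx : (x : Site d) ∈ A
  · rw [Set.indicator_of_mem (by exact hx)]
    simp only [hx, true_and]
    rw [← Finset.sum_filter, Finset.sum_const, nsmul_eq_mul]
    refine mul_le_mul_of_nonneg_right ?_ (hN.nonneg A)
    have h1 : ((Finset.univ.erase x).filter fun y : cube d n => (y : Site d) ∈ A).card ≤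
        (A.erase x).card := by
      refine Finset.card_le_card_of_injOn (fun y => (y : Site d)) (fun y hy => ?_)
        Subtype.val_injective.injOn
      simp only [Finset.coe_filter, Finset.mem_erase, Set.mem_ofPred_eq] at hy
      exact Finset.mem_coe.2 (Finset.mem_erase.2 ⟨fun h => hy.1.1 (Subtype.ext h), hy.2⟩)
    rw [Finset.card_erase_of_mem hx] at h1
    have h2 : 1 ≤ A.card := Finset.card_pos.2 ⟨_, hx⟩
    calc _ ≤ ((A.card - 1 : ℕ) : ℝ) := by exact_mod_cast h1
      _ = (A.card : ℝ) - 1 := by rw [Nat.cast_sub h2, Nat.cast_one]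
  · rw [Set.indicator_of_notMem (by exact hx)]
    simp [hx]

/-- Evaluation at t = 1 shows that the slopes q_n are bounded. Any limit point of them serves as the
derivative, so their convergence need not be known beforehand. -/
theorem differentiableAt_of_expansion {P : ℕ → ℝ → ℝ} {p : ℝ → ℝ}
    (hP : ∀ t, Tendsto (fun n => P n t) atTop (𝓝 (p t))) {q : ℕ → ℝ} {C : ℝ}
    (h : ∀ n t, |P n t - P n 0 - t * q n| ≤ C * t ^ 2) : DifferentiableAt ℝ p 0 := by
  obtain ⟨R, hR⟩ := (Metric.isBounded_range_of_tendsto _ ((hP 1).sub (hP 0))).exists_norm_le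
  have hq : ∀ n, q n ∈ Set.Icc (-(R + C)) (R + C) := fun n => by
    have h1 := h n 1
    have h2 : |P n 1 - P n 0| ≤ R := hR _ ⟨n, rfl⟩
    rw [abs_le] at h1 h2
    constructor <;> linarith [h1.1, h1.2, h2.1, h2.2]
  obtain ⟨a, -, φ, hφ, ha⟩ := tendsto_subseq_of_bounded (Metric.isBounded_Icc _ _) hq
  have key : ∀ t, |p t - p 0 - t * a| ≤ C * t ^ 2 := fun t => by
    have h1 := ((((hP t).sub (hP 0)).comp hφ.tendsto_atTop).sub (ha.const_mul t)).abs
    exact le_of_tendsto' h1 fun n => h (φ n) t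
  refine HasDerivAt.differentiableAt (f' := a) ?_
  rw [hasDerivAt_iff_isLittleO]
  simp only [sub_zero, smul_eq_mul]
  refine Asymptotics.IsBigO.trans_isLittleO (g := fun t : ℝ => t ^ 2) ?_
    (Asymptotics.isLittleO_pow_id one_lt_two)
  refine Asymptotics.IsBigO.of_bound C (Eventually.of_forall fun t => ?_)
  rw [Real.norm_eq_abs, Real.norm_of_nonneg (sq_nonneg t)]
  exact key t

/-- Dobrushin's condition makes the free energy density differentiable in every direction. -/
theorem IsPotential.differentiableAt_freeEnergy [Fintype S] [Nonempty S] {U D : Interaction d S}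
    (hU : IsPotential U) (hD : IsPotential D) {β : ℝ} (hβ : 0 ≤ β)
    (hs : Summable ({A : Finset (Site d) | 0 ∈ A}.indicator
      fun A => ((A.card : ℝ) - 1) * unifNorm (U A)))
    (hc : β * starSum (fun A => ((A.card : ℝ) - 1) * unifNorm (U A)) 0 < 1) {p : ℝ → ℝ}
    (hp : ∀ t, Tendsto (cubeFreeEnergy β fun A σ => U A σ + t * D A σ) atTop (𝓝 (p t))) :
    DifferentiableAt ℝ p 0 := by
  set c := β * starSum (fun A => ((A.card : ℝ) - 1) * unifNorm (U A)) 0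
  set m := β * (2 * starSum (fun A => unifNorm (D A)) 0)
  set ξ : Config d S := fun _ => Classical.arbitrary S
  set h : (n : ℕ) → (cube d n → S) → ℝ := fun n σ => -β * cubeEnergy U n (glue (cube d n) σ ξ)
    with hh
  set w : (n : ℕ) → (cube d n → S) → ℝ := fun n σ => -β * cubeEnergy D n (glue (cube d n) σ ξ)
    with hw
  have hdob : ∀ n, DobrushinCondition (h n)
      (fun x y : cube d n => β * pairSum (fun A => unifNorm (U A)) n x y) c := fun n =>
    { nonneg := fun x y => mul_nonneg hβ (Finset.sum_nonneg fun A _ => by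
        split_ifs
        exacts [unifNorm_nonneg _, le_rfl])
      influence := fun x y hxy σ a => by
        obtain ⟨b, hb⟩ := hU.exists_abs_cubeEnergy_sub_le n (x := x) (y := y)
          (fun h => hxy (Subtype.ext h)) (glue (cube d n) σ ξ) a
        refine ⟨-β * b, fun s => ?_⟩
        simp only [hh, glue_update]
        rw [← mul_sub, ← mul_sub, abs_mul, abs_neg, abs_of_nonneg hβ]
        refine (mul_le_mul_of_nonneg_left (hb s) hβ).trans (le_of_eq ?_)
        ring
      sum_le := fun x => by
        rw [← Finset.mul_sum]
        exact mul_le_mul_of_nonneg_left (sum_pairSum_le hU.isWeight hs n x) hβ }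
  have hosc : ∀ n, OscBound (w n) fun _ => m := fun n x σ s => by
    simp only [hw, glue_update]
    rw [← mul_sub, abs_mul, abs_neg, abs_of_nonneg hβ]
    exact mul_le_mul_of_nonneg_left (hD.abs_cubeEnergy_update_sub_le n _ _ _) hβ
  have hP : ∀ n t, cubeFreeEnergy β (fun A σ => U A σ + t * D A σ) n =
      1 / ((cube d n).card : ℝ) * Real.log (∑ σ, Real.exp (h n σ + t * w n σ)) := by
    intro n t
    unfold cubeFreeEnergy
    congr 2
    refine Finset.sum_congr rfl fun σ _ => ?_
    congr 1
    simp only [hh, hw, cubeEnergy]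
    rw [Finset.sum_add_distrib, ← Finset.mul_sum]
    ring
  refine differentiableAt_of_expansion (P := fun n t => cubeFreeEnergy β
    (fun A σ => U A σ + t * D A σ) n) hp (C := m ^ 2 / (2 * (1 - c)))
    (q := fun n => 1 / ((cube d n).card : ℝ) * gibbsAvg (h n) (w n)) fun n t => ?_
  have hpos := card_cube_pos d n
  have : Nonempty (cube d n) := ⟨⟨0, zero_mem_cube n⟩⟩
  have h1 := (hdob n).abs_log_sum_exp_sub_le hc (hosc n) t
  rw [Fintype.card_coe] at h1
  have h0 := hP n 0
  simp only [zero_mul, add_zero] at h0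
  simp only [hP n t, zero_mul, add_zero, h0]
  have h2 : ∀ a b e : ℝ, 1 / ((cube d n).card : ℝ) * a - 1 / ((cube d n).card : ℝ) * b -
      t * (1 / ((cube d n).card : ℝ) * e) = (a - b - t * e) / (cube d n).card := fun a b e => by
    ring
  rw [h2, abs_div, abs_of_pos hpos, div_le_iff₀ hpos]
  exact h1.trans (le_of_eq (by ring))

end SmallPotentials

/-! ### Structure of the involutions, transported Gibbs measures and currents -/

section Involution

variable {d : ℕ} {S : Type*}

namespace InvolutionFamily

variable (T : InvolutionFamily d S)

theorem map_eq_globalMap {n : ℕ} {x : Site d} (hx : x ∈ cube d n) (σ : Config d S) :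
    T.map n σ x = T.globalMap σ x :=
  (T.map_consistent _ _ (cubeIndex_le (by simpa using hx)) σ x
    (subset_cube_cubeIndex {x} (Finset.mem_singleton_self x))).symm

theorem globalMap_globalMap (σ : Config d S) : T.globalMap (T.globalMap σ) = σ := by
  ext y
  obtain ⟨n, hn⟩ := exists_mem_cube y
  rw [← T.map_eq_globalMap hn, ← T.map_local n (T.map n σ) _
    (fun x hx => T.map_eq_globalMap hx σ) y hn, T.map_map]

theorem surjective_globalMap : Function.Surjective T.globalMap :=
  fun σ => ⟨_, T.globalMap_globalMap σ⟩

/-- The involution acts on the configurations through an involution `θ` of the lattice that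
preserves the centred cubes and an involution `φ` of the spins. -/
structure IsImplementedBy (θ : Site d ≃+ Site d) (φ : S → S) : Prop where
  globalMap_apply : ∀ σ x, T.globalMap σ (θ x) = φ (σ x)
  theta_theta : ∀ x, θ (θ x) = x
  mem_cube_iff : ∀ n x, θ x ∈ cube d n ↔ x ∈ cube d n

/-- Covariance carries every site to the origin, where π_0 sees a single spin. Two distinct spin
values are needed in order to detect sites, and thereby to show that θ is an involution preserving
the cubes. -/
theorem exists_isImplementedBy [Nontrivial S] : ∃ θ φ, T.IsImplementedBy θ φ := by
  obtain ⟨θ, hθ⟩ := T.map_shift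
  obtain ⟨a, b, hab⟩ := exists_pair_ne S
  set φ : S → S := fun s => T.map 0 (fun _ => s) 0
  have h1 : ∀ n σ x, θ x ∈ cube d n → T.map n σ (θ x) = φ (σ x) := fun n σ x hx => by
    have := hθ 0 n x 0 σ (zero_mem_cube 0) (by simpa using hx)
    rw [zero_add] at this
    rw [← this]
    refine T.map_local 0 _ _ (fun y hy => ?_) 0 (zero_mem_cube 0)
    have hy0 : y = 0 := by
      ext i
      simpa using mem_cube.1 hy i
    simp [shift, hy0]
  have h2 : ∀ σ x, T.globalMap σ (θ x) = φ (σ x) := fun σ x => by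
    obtain ⟨n, hn⟩ := exists_mem_cube (θ x)
    rw [← T.map_eq_globalMap hn, h1 n σ x hn]
  have h3 : ∀ (σ : Config d S) x, φ (φ (σ x)) = σ (θ (θ x)) := fun σ x => by
    rw [← h2 σ x, ← h2 (T.globalMap σ), T.globalMap_globalMap]
  have h4 : ∀ s, φ (φ s) = s := fun s => h3 (fun _ => s) 0
  have h5 : ∀ x, θ (θ x) = x := fun x => by
    by_contra hx
    have := h3 (fun z => if z = x then a else b) x
    rw [h4] at this
    simp only [if_true, if_neg hx] at this
    exact hab this
  -- The spin of π_n σ at θx determines σ(x), but inside Λ_n it may depend only on the spins in Λ_n.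
  have h6 : ∀ n x, θ x ∈ cube d n → x ∈ cube d n := fun n x hx => by
    by_contra hxn
    have h7 := T.map_local n (fun _ => b) (Function.update (fun _ => b) x a) (fun y hy => by
      rw [Function.update_of_ne (ne_of_mem_of_not_mem hy hxn)]) (θ x) hx
    rw [h1 n _ x hx, h1 n _ x hx, Function.update_self] at h7
    have h8 := congrArg φ h7
    rw [h4, h4] at h8
    exact hab h8.symm
  exact ⟨θ, φ, h2, h5, fun n x => ⟨h6 n x, fun hx => h6 n (θ x) (by rwa [h5])⟩⟩

/-- The transformed interaction, indexed by the sets of sites on which it depends. -/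
noncomputable def reflected (θ : Site d ≃+ Site d) (U : Interaction d S) : Interaction d S :=
  fun A σ => U (θ.toEquiv.finsetCongr A) (T.globalMap σ)

theorem apply_map_cubeIndex {U : Interaction d S} (hU : IsPotential U) (A : Finset (Site d))
    (σ : Config d S) : U A (T.map (cubeIndex A) σ) = U A (T.globalMap σ) :=
  hU.dep A _ _ fun _ hx => T.map_eq_globalMap (subset_cube_cubeIndex A hx) σ

variable {T}

namespace IsImplementedBy

theorem mem_finsetCongr {θ : Site d ≃+ Site d} {φ : S → S} (h : T.IsImplementedBy θ φ)
    {A : Finset (Site d)} {x : Site d} : x ∈ θ.toEquiv.finsetCongr A ↔ θ x ∈ A := by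
  rw [Equiv.finsetCongr_apply, Finset.mem_map]
  constructor
  · rintro ⟨y, hy, rfl⟩
    change θ (θ y) ∈ A
    rwa [h.theta_theta]
  · exact fun hx => ⟨θ x, hx, h.theta_theta x⟩

theorem finsetCongr_finsetCongr {θ : Site d ≃+ Site d} {φ : S → S}
    (h : T.IsImplementedBy θ φ) (A : Finset (Site d)) :
    θ.toEquiv.finsetCongr (θ.toEquiv.finsetCongr A) = A := by
  ext x
  rw [h.mem_finsetCongr, h.mem_finsetCongr, h.theta_theta]

theorem finsetCongr_subset_cube {θ : Site d ≃+ Site d} {φ : S → S}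
    (h : T.IsImplementedBy θ φ) {A : Finset (Site d)} {n : ℕ} (hA : A ⊆ cube d n) :
    θ.toEquiv.finsetCongr A ⊆ cube d n := fun x hx =>
  (h.mem_cube_iff n x).1 (hA (h.mem_finsetCongr.1 hx))

theorem sum_powerset_cube {θ : Site d ≃+ Site d} {φ : S → S} (h : T.IsImplementedBy θ φ)
    (n : ℕ) (f : Finset (Site d) → ℝ) :
    ∑ A ∈ (cube d n).powerset, f (θ.toEquiv.finsetCongr A) = ∑ A ∈ (cube d n).powerset, f A := by
  refine Finset.sum_equiv θ.toEquiv.finsetCongr (fun A => ?_) fun A _ => rfl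
  rw [Finset.mem_powerset, Finset.mem_powerset]
  refine ⟨h.finsetCongr_subset_cube, fun hA => ?_⟩
  have := h.finsetCongr_subset_cube hA
  rwa [h.finsetCongr_finsetCongr] at this

theorem globalMap_congr {θ : Site d ≃+ Site d} {φ : S → S} (h : T.IsImplementedBy θ φ)
    {σ η : Config d S} {x : Site d} (hx : σ (θ x) = η (θ x)) :
    T.globalMap σ x = T.globalMap η x := by
  rw [← h.theta_theta x, h.globalMap_apply, h.globalMap_apply, hx]

theorem globalMap_shift {θ : Site d ≃+ Site d} {φ : S → S} (h : T.IsImplementedBy θ φ)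
    (x : Site d) (σ : Config d S) :
    T.globalMap (shift x σ) = shift (θ x) (T.globalMap σ) := by
  ext y
  rw [← h.theta_theta y, h.globalMap_apply]
  simp only [shift]
  rw [← map_add, h.globalMap_apply]

theorem globalMap_piecewise {θ : Site d ≃+ Site d} {φ : S → S} (h : T.IsImplementedBy θ φ)
    (n : ℕ) (σ η : Config d S) :
    T.globalMap ((cube d n).piecewise σ η) =
      (cube d n).piecewise (T.globalMap σ) (T.globalMap η) := by
  ext x
  have hx := h.mem_cube_iff n x
  by_cases hxn : x ∈ cube d n
  · rw [Finset.piecewise_eq_of_mem _ _ _ hxn]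
    exact h.globalMap_congr (Finset.piecewise_eq_of_mem _ _ _ (hx.2 hxn))
  · rw [Finset.piecewise_eq_of_notMem _ _ _ hxn]
    exact h.globalMap_congr (Finset.piecewise_eq_of_notMem _ _ _ (mt hx.1 hxn))

theorem preimage_cylinderEvent {θ : Site d ≃+ Site d} {φ : S → S} (h : T.IsImplementedBy θ φ)
    (n : ℕ) (σ : Config d S) :
    T.globalMap ⁻¹' cylinderEvent (cube d n) (fun x => σ x) =
      cylinderEvent (cube d n) fun x => T.globalMap σ x := by
  have key : ∀ σ ω : Config d S, (∀ x : cube d n, ω x = σ x) →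
      ∀ x : cube d n, T.globalMap ω x = T.globalMap σ x := fun σ ω hω x =>
    h.globalMap_congr (hω ⟨θ x, (h.mem_cube_iff n x).2 x.2⟩)
  ext ω
  refine ⟨fun hω => ?_, fun hω => ?_⟩
  · have := key σ (T.globalMap ω) hω
    rwa [T.globalMap_globalMap] at this
  · have := key (T.globalMap σ) ω hω
    rwa [T.globalMap_globalMap] at this

/-- The function (πU)_A depends on the spins in θA rather than A, so πU is in general not a
potential. Re-indexing by θ repairs this and preserves cube energies and relative energies. -/
theorem potential_eq {θ : Site d ≃+ Site d} {φ : S → S} (h : T.IsImplementedBy θ φ)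
    {U : Interaction d S} (hU : IsPotential U) (A : Finset (Site d)) (σ : Config d S) :
    T.potential U A σ = T.reflected θ U (θ.toEquiv.finsetCongr A) σ := by
  rw [potential, T.apply_map_cubeIndex hU, reflected, h.finsetCongr_finsetCongr]

theorem finsetCongr_shiftSet (θ : Site d ≃+ Site d) (A : Finset (Site d)) (x : Site d) :
    θ.toEquiv.finsetCongr (shiftSet x A) = shiftSet (θ x) (θ.toEquiv.finsetCongr A) := by
  rw [shiftSet_apply, shiftSet_apply, Equiv.finsetCongr_apply, Equiv.finsetCongr_apply,
    Finset.map_map, Finset.map_map]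
  refine congrArg (fun e => Finset.map e A) (Function.Embedding.ext fun y => ?_)
  exact map_add θ y x

theorem unifNorm_reflected (T : InvolutionFamily d S) (θ : Site d ≃+ Site d)
    (U : Interaction d S) (A : Finset (Site d)) :
    unifNorm (T.reflected θ U A) = unifNorm (U (θ.toEquiv.finsetCongr A)) :=
  unifNorm_comp T.surjective_globalMap

theorem isPotential_reflected {θ : Site d ≃+ Site d} {φ : S → S} (h : T.IsImplementedBy θ φ)
    {U : Interaction d S} (hU : IsPotential U) : IsPotential (T.reflected θ U) where
  empty σ := hU.empty _
  dep A σ η hση := hU.dep _ _ _ fun x hx =>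
    h.globalMap_congr (hση _ (h.mem_finsetCongr.1 hx))
  invariant A x η := by
    rw [← shiftSet_apply, reflected, finsetCongr_shiftSet, shiftSet_apply, hU.invariant,
      reflected, h.globalMap_shift]
  summable := by
    refine (summable_subtype_iff_indicator (s := {A : Finset (Site d) | 0 ∈ A})
      (f := fun A => unifNorm (T.reflected θ U A))).2 ?_
    have h2 := hU.isWeight.summable
    rw [← θ.toEquiv.finsetCongr.summable_iff] at h2
    refine h2.congr fun A => ?_
    have h3 : (0 : Site d) ∈ θ.toEquiv.finsetCongr A ↔ 0 ∈ A := by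
      rw [h.mem_finsetCongr, map_zero]
    simp only [Function.comp_apply, Set.indicator_apply, Set.mem_ofPred_eq, h3,
      unifNorm_reflected]

theorem cubeEnergy_reflected {θ : Site d ≃+ Site d} {φ : S → S} (h : T.IsImplementedBy θ φ)
    (U : Interaction d S) (n : ℕ) (σ : Config d S) :
    cubeEnergy (T.reflected θ U) n σ = cubeEnergy U n (T.globalMap σ) :=
  h.sum_powerset_cube n fun A => U A (T.globalMap σ)

theorem relEnergy_reflected (θ : Site d ≃+ Site d) (U : Interaction d S) (σ η : Config d S) :
    relEnergy (T.reflected θ U) σ η = relEnergy U (T.globalMap σ) (T.globalMap η) :=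
  θ.toEquiv.finsetCongr.tsum_eq fun A => U A (T.globalMap σ) - U A (T.globalMap η)

theorem relEnergy_potential {θ : Site d ≃+ Site d} {φ : S → S} (h : T.IsImplementedBy θ φ)
    {U : Interaction d S} (hU : IsPotential U) (σ η : Config d S) :
    relEnergy (T.potential U) σ η = relEnergy (T.reflected θ U) σ η := by
  simp only [relEnergy, h.potential_eq hU]
  exact θ.toEquiv.finsetCongr.tsum_eq fun A => T.reflected θ U A σ - T.reflected θ U A η

/-- θ permutes the subsets of the cube. The right-hand side is written so that
`IsPotential.lin_comb` applies. -/
theorem cubeFreeEnergy_path {θ : Site d ≃+ Site d} {φ : S → S} (h : T.IsImplementedBy θ φ)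
    [Fintype S] [Nonempty S] {U : Interaction d S} (hU : IsPotential U) (β t : ℝ) (n : ℕ) :
    cubeFreeEnergy β (fun A σ => U A σ + t * (T.potential U A σ - U A σ)) n =
      cubeFreeEnergy β
        (fun A σ => U A σ + t * (1 * T.reflected θ U A σ + (-1) * U A σ)) n := by
  unfold cubeFreeEnergy
  congr 2
  refine Finset.sum_congr rfl fun σ _ => ?_
  congr 2
  simp only [h.potential_eq hU, Finset.sum_add_distrib, ← Finset.mul_sum, Finset.sum_sub_distrib]
  rw [h.sum_powerset_cube n fun A => T.reflected θ U A _]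
  ring

end IsImplementedBy

section Measure

variable [MeasurableSpace S]

variable (T) in
theorem measurable_globalMap [Finite S] [DiscreteMeasurableSpace S] {θ : Site d ≃+ Site d}
    {φ : S → S} (h : T.IsImplementedBy θ φ) : Measurable T.globalMap := by
  refine measurable_pi_iff.2 fun x => ?_
  have : (fun σ => T.globalMap σ x) = fun σ => φ (σ (θ x)) := by
    ext σ
    rw [← h.globalMap_apply, h.theta_theta]
  rw [this]
  exact (Measurable.of_discrete (f := φ)).comp (measurable_pi_apply _)

namespace IsImplementedBy

theorem isProbabilityMeasure_measure [Finite S] [DiscreteMeasurableSpace S]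
    {θ : Site d ≃+ Site d} {φ : S → S} (h : T.IsImplementedBy θ φ) (μ : Measure (Config d S))
    [IsProbabilityMeasure μ] : IsProbabilityMeasure (T.measure μ) :=
  Measure.isProbabilityMeasure_map (T.measurable_globalMap h).aemeasurable

theorem isShiftInvariant_measure [Finite S] [DiscreteMeasurableSpace S]
    {θ : Site d ≃+ Site d} {φ : S → S} (h : T.IsImplementedBy θ φ) {μ : Measure (Config d S)}
    (hμ : IsShiftInvariant μ) : IsShiftInvariant (T.measure μ) := by
  intro x
  have hm := T.measurable_globalMap h
  have h1 : shift x ∘ T.globalMap = T.globalMap ∘ shift (θ x) := by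
    ext1 σ
    rw [Function.comp_apply, Function.comp_apply, h.globalMap_shift, h.theta_theta]
  rw [measure, Measure.map_map (measurable_shift x) hm, h1, ← Measure.map_map hm
    (measurable_shift _), hμ]

theorem cubeProb_measure [Finite S] [DiscreteMeasurableSpace S] {θ : Site d ≃+ Site d}
    {φ : S → S} (h : T.IsImplementedBy θ φ) (μ : Measure (Config d S)) (n : ℕ)
    (σ : Config d S) :
    cubeProb (T.measure μ) n (fun x => σ x) = cubeProb μ n fun x => T.globalMap σ x := by
  rw [cubeProb, cubeProb, ← h.preimage_cylinderEvent, measure,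
    map_measureReal_apply (T.measurable_globalMap h) (measurableSet_cylinderEvent _ _)]

/-- Because θ preserves the cubes, π maps cylinder events to cylinder events and respects exterior
functions and gluing. A change of variables thus carries the comparison over. -/
theorem gibbsSwap_measure [Finite S] [DiscreteMeasurableSpace S] {θ : Site d ≃+ Site d}
    {φ : S → S} (h : T.IsImplementedBy θ φ) {β : ℝ} {U : Interaction d S}
    {μ : Measure (Config d S)} (hG : GibbsSwap β U μ) :
    GibbsSwap β (T.reflected θ U) (T.measure μ) := by
  rintro n σ η f g hf hg hfd hgd ⟨c, hc⟩ ⟨c', hc'⟩ hf0 hle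
  have hm := T.measurable_globalMap h
  have hd : ∀ f : Config d S → ℝ, DependsOn f ((cube d n : Set (Site d))ᶜ) →
      DependsOn (fun σ => f (T.globalMap σ)) ((cube d n : Set (Site d))ᶜ) :=
    fun f hf ω ω' hω => hf fun x hx => h.globalMap_congr (hω _ fun hx' => hx
      ((h.mem_cube_iff n x).1 hx'))
  have hint : ∀ (σ : Config d S) (f : Config d S → ℝ), Measurable f →
      ∫ ξ in cylinderEvent (cube d n) (fun x => σ x), f ξ ∂(T.measure μ) =
      ∫ ξ in cylinderEvent (cube d n) (fun x => T.globalMap σ x), f (T.globalMap ξ) ∂μ :=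
    fun σ f hf => by
      rw [measure, setIntegral_map (measurableSet_cylinderEvent _ _) hf.aestronglyMeasurable
        hm.aemeasurable, h.preimage_cylinderEvent]
  rw [hint σ f hf, hint η g hg]
  refine hG n _ _ _ _ (hf.comp hm) (hg.comp hm) (hd f hfd) (hd g hgd) ⟨c, fun ξ => hc _⟩
    ⟨c', fun ξ => hc' _⟩ (fun ξ => hf0 _) fun ξ => ?_
  have := hle (T.globalMap ξ)
  rwa [relEnergy_reflected, h.globalMap_piecewise, h.globalMap_piecewise,
    T.globalMap_globalMap] at this

/-- The relative entropy in a cube of a Gibbs measure and its image. -/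
theorem abs_sum_cubeProb_log_sub_le [Fintype S] [Nonempty S] [DiscreteMeasurableSpace S]
    {θ : Site d ≃+ Site d} {φ : S → S} (h : T.IsImplementedBy θ φ) {β : ℝ} (hβ : 0 ≤ β)
    {U : Interaction d S} (hU : IsPotential U) {μ : Measure (Config d S)}
    [IsProbabilityMeasure μ] (hG : GibbsSwap β U μ) (n : ℕ) :
    |∑ σ : cube d n → S, cubeProb μ n σ * Real.log (cubeProb μ n σ / cubeProb (T.measure μ) n σ) -
      β * (∫ σ, cubeEnergy (T.reflected θ U) n σ ∂μ - ∫ σ, cubeEnergy U n σ ∂μ)| ≤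
      2 * β * boundarySum (fun A => unifNorm (U A)) n := by
  obtain ⟨ξ⟩ : Nonempty (Config d S) := inferInstance
  have hW := h.isPotential_reflected hU
  have hr : ∀ σ : cube d n → S, (fun x : cube d n => glue (cube d n) σ ξ x) = σ :=
    fun σ => funext fun x => glue_apply_mem x.2 σ ξ
  rw [integral_of_dependsOn (hW.dependsOn_cubeEnergy n) μ ξ,
    integral_of_dependsOn (hU.dependsOn_cubeEnergy n) μ ξ, ← Finset.sum_sub_distrib,
    Finset.mul_sum, ← Finset.sum_sub_distrib]
  refine (Finset.abs_sum_le_sum_abs _ _).trans ?_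
  calc _ ≤ ∑ σ : cube d n → S, cubeProb μ n σ *
        (2 * β * boundarySum (fun A => unifNorm (U A)) n) := Finset.sum_le_sum fun σ _ => by
        -- The choice η = πσ turns the probability of η under μ into that of σ under πμ.
        have h1 := hG.abs_log_div_le hU hβ n (glue _ σ ξ) (T.globalMap (glue _ σ ξ))
        rw [← h.cubeProb_measure, hr, ← h.cubeEnergy_reflected] at h1
        have h2 : ∀ a b e : ℝ, cubeProb μ n σ * a - β * (μ.real (cylinderEvent (cube d n) σ) * b -
            μ.real (cylinderEvent (cube d n) σ) * e) =
            cubeProb μ n σ * (a + β * (e - b)) := fun a b e => by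
          simp only [cubeProb]
          ring
        rw [h2, abs_mul, abs_of_nonneg (show 0 ≤ cubeProb μ n σ from measureReal_nonneg)]
        exact mul_le_mul_of_nonneg_left h1 measureReal_nonneg
    _ = _ := by rw [← Finset.sum_mul, sum_cubeProb, one_mul]

/-- The substitution σ ↦ πσ in the cube exchanges the two measures, because π is an involution. -/
theorem sum_cubeProb_log_comm [Fintype S] [Nonempty S] [DiscreteMeasurableSpace S]
    {θ : Site d ≃+ Site d} {φ : S → S} (h : T.IsImplementedBy θ φ) (μ : Measure (Config d S))
    (n : ℕ) :
    ∑ σ : cube d n → S, cubeProb (T.measure μ) n σ *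
      Real.log (cubeProb (T.measure μ) n σ / cubeProb μ n σ) =
    ∑ σ : cube d n → S, cubeProb μ n σ *
      Real.log (cubeProb μ n σ / cubeProb (T.measure μ) n σ) := by
  obtain ⟨ξ⟩ : Nonempty (Config d S) := inferInstance
  have hr : ∀ σ : cube d n → S, (fun x : cube d n => glue (cube d n) σ ξ x) = σ :=
    fun σ => funext fun x => glue_apply_mem x.2 σ ξ
  set e : (cube d n → S) → cube d n → S := fun σ x => T.globalMap (glue (cube d n) σ ξ) x
    with he
  have hee : Function.Involutive e := fun σ => by
    ext x
    have h1 : T.globalMap (glue (cube d n) (e σ) ξ) x =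
        T.globalMap (T.globalMap (glue (cube d n) σ ξ)) x :=
      h.globalMap_congr (by rw [glue_apply_mem ((h.mem_cube_iff n x).2 x.2)])
    rw [T.globalMap_globalMap, glue_apply_mem x.2] at h1
    exact h1
  have h1 : ∀ σ, cubeProb (T.measure μ) n σ = cubeProb μ n (e σ) := fun σ => by
    rw [← h.cubeProb_measure, hr]
  refine Fintype.sum_equiv hee.toPerm _ _ fun σ => ?_
  simp only [Function.Involutive.coe_toPerm, h1, hee σ]

theorem hasRelEntropyDensity [Fintype S] [Nonempty S] [DiscreteMeasurableSpace S]
    {θ : Site d ≃+ Site d} {φ : S → S} (h : T.IsImplementedBy θ φ) {β : ℝ} (hβ : 0 ≤ β)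
    {U : Interaction d S} (hU : IsPotential U) {μ : Measure (Config d S)}
    [IsProbabilityMeasure μ] (hμ : IsShiftInvariant μ) (hG : GibbsSwap β U μ) :
    HasRelEntropyDensity (T.measure μ) μ
      (β * (∫ σ, siteEnergy (T.reflected θ U) σ ∂μ - ∫ σ, siteEnergy U σ ∂μ)) ∧
    HasRelEntropyDensity μ (T.measure μ)
      (β * (∫ σ, siteEnergy (T.reflected θ U) σ ∂μ - ∫ σ, siteEnergy U σ ∂μ)) := by
  have hW := h.isPotential_reflected hU
  have := h.isProbabilityMeasure_measure μ
  have hlim : Tendsto (fun n : ℕ => (1 / ((cube d n).card : ℝ)) *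
      ∑ σ : cube d n → S, cubeProb μ n σ *
        Real.log (cubeProb μ n σ / cubeProb (T.measure μ) n σ)) atTop
      (𝓝 (β * (∫ σ, siteEnergy (T.reflected θ U) σ ∂μ - ∫ σ, siteEnergy U σ ∂μ))) := by
    have h1 := ((hW.tendsto_integral_cubeEnergy hμ).sub
      (hU.tendsto_integral_cubeEnergy hμ)).const_mul β
    have h2 := hU.isWeight.tendsto_boundarySum.const_mul (2 * β)
    rw [mul_zero] at h2
    refine tendsto_of_tendsto_of_dist h1 (squeeze_zero (fun _ => dist_nonneg) (fun n => ?_) h2)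
    have hp := card_cube_pos d n
    rw [dist_comm, Real.dist_eq]
    have h3 := div_le_div_of_nonneg_right (h.abs_sum_cubeProb_log_sub_le hβ hU hG n) hp.le
    rw [← abs_of_pos hp, ← abs_div, abs_of_pos hp] at h3
    calc _ = _ := by
          congr 1
          ring
      _ ≤ _ := h3
      _ = _ := by ring
  refine ⟨⟨fun n σ h0 => absurd h0 (hG.cubeProb_pos hU hβ n σ).ne', ?_⟩,
    ⟨fun n σ h0 => absurd h0 ((h.gibbsSwap_measure hG).cubeProb_pos hW hβ n σ).ne', hlim⟩⟩
  simpa only [h.sum_cubeProb_log_comm] using hlim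

end IsImplementedBy

end Measure

variable (T)

/-- The Weierstrass test: the prefactor 1/(2|A|) absorbs the factor 2 of the difference, so ‖U_A‖
dominates. -/
theorem tendstoUniformly_current [Finite S] {U : Interaction d S} (hU : IsPotential U)
    (x : Site d) :
    TendstoUniformly (fun n σ => T.cubeCurrent U x n σ) (fun σ => T.current U x σ) atTop := by
  set f : Finset (Site d) → Config d S → ℝ := fun A σ =>
    if x ∈ A then 1 / (2 * (A.card : ℝ)) * (U A (T.map (cubeIndex A) σ) - U A σ) else 0 with hf
  have hb : ∀ A σ, ‖f A σ‖ ≤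
      {A : Finset (Site d) | x ∈ A}.indicator (fun A => unifNorm (U A)) A := by
    intro A σ
    by_cases hx : x ∈ A
    · rw [Set.indicator_of_mem (by exact hx)]
      simp only [hf, if_pos hx]
      have h1 : (1 : ℝ) ≤ A.card := by exact_mod_cast Finset.card_pos.2 ⟨x, hx⟩
      have h2 : |U A (T.map (cubeIndex A) σ) - U A σ| ≤ 2 * unifNorm (U A) := by
        rw [two_mul]
        exact (abs_sub _ _).trans (add_le_add (hU.abs_le A _) (hU.abs_le A _))
      rw [Real.norm_eq_abs, abs_mul, abs_of_nonneg (by positivity), one_div,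
        inv_mul_le_iff₀ (by positivity)]
      nlinarith [unifNorm_nonneg (U A)]
    · rw [Set.indicator_of_notMem (by exact hx)]
      simp [hf, hx]
  have h1 := tendstoUniformly_tsum (hU.isWeight.summable_star x) hb
  have h2 : TendstoUniformly (fun n σ => T.cubeCurrent U x n σ) (fun σ => ∑' A, f A σ) atTop := by
    intro u hu
    refine (tendsto_powerset_cube.eventually (h1 u hu)).mono fun n hn σ => ?_
    simpa only [cubeCurrent, Finset.sum_filter] using hn σ
  have h3 : (fun σ => T.current U x σ) = fun σ => ∑' A, f A σ :=
    funext fun σ => (h2.tendsto_at σ).limUnder_eq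
  rwa [h3]

theorem measurable_cubeCurrent [Finite S] [MeasurableSpace S] [DiscreteMeasurableSpace S]
    {U : Interaction d S} (hU : IsPotential U) (x : Site d) (n : ℕ) :
    Measurable (T.cubeCurrent U x n) := by
  refine Finset.measurable_sum _ fun A _ => (Measurable.sub ?_
    (measurable_of_dependsOn (hU.dependsOn A))).const_mul _
  refine measurable_of_dependsOn (Λ := cube d (cubeIndex A)) fun σ η h => ?_
  exact hU.dep A _ _ fun y hy => T.map_local _ σ η h y (subset_cube_cubeIndex A hy)

theorem integrable_current [Finite S] [MeasurableSpace S] [DiscreteMeasurableSpace S]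
    {U : Interaction d S} (hU : IsPotential U) (x : Site d) (μ : Measure (Config d S))
    [IsProbabilityMeasure μ] : Integrable (T.current U x) μ := by
  have hlim := T.tendstoUniformly_current hU x
  have hm : Measurable (T.current U x) := measurable_of_tendsto_metrizable
    (T.measurable_cubeCurrent hU x) (tendsto_pi_nhds.2 fun σ => hlim.tendsto_at σ)
  -- The current is bounded, being within distance 1 of a function of finitely many spins.
  obtain ⟨n, hn⟩ := (Metric.tendstoUniformly_iff.1 hlim 1 one_pos).exists
  have hd : DependsOn (T.cubeCurrent U x n) (cube d n) := by
    refine DependsOn.finset_sum' fun A hA σ η h => ?_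
    have hAn := Finset.mem_powerset.1 (Finset.mem_filter.1 hA).1
    have h1 : U A (T.map (cubeIndex A) σ) = U A (T.map (cubeIndex A) η) :=
      hU.dep A _ _ fun y hy => T.map_local _ σ η
        (fun z hz => h z (cube_mono (cubeIndex_le hAn) hz)) y (subset_cube_cubeIndex A hy)
    simp only [h1, hU.dep A σ η fun y hy => h y (hAn hy)]
  refine Integrable.of_bound hm.aestronglyMeasurable (unifNorm (T.cubeCurrent U x n) + 1)
    (Eventually.of_forall fun σ => ?_)
  have h1 := hn σ
  rw [Real.dist_eq] at h1
  have h2 := abs_le_unifNorm_of_dependsOn hd σ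
  calc ‖T.current U x σ‖ = |T.cubeCurrent U x n σ + (T.current U x σ - T.cubeCurrent U x n σ)| := by
        rw [Real.norm_eq_abs]
        ring_nf
    _ ≤ _ := (abs_add_le _ _).trans (add_le_add h2 h1.le)

end InvolutionFamily

theorem IsPotential.siteEnergy_lin_comb [Finite S] {V W : Interaction d S} (hV : IsPotential V)
    (hW : IsPotential W) (a b : ℝ) (σ : Config d S) :
    siteEnergy (fun A σ => a * V A σ + b * W A σ) σ = a * siteEnergy V σ + b * siteEnergy W σ := by
  refine tendsto_nhds_unique ((hV.lin_comb hW a b).tendsto_siteEnergy σ)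
    ((((hV.tendsto_siteEnergy σ).const_mul a).add
      ((hW.tendsto_siteEnergy σ).const_mul b)).congr fun n => ?_)
  rw [Finset.mul_sum, Finset.mul_sum, ← Finset.sum_add_distrib]
  refine Finset.sum_congr rfl fun A _ => ?_
  split_ifs <;> ring

theorem abs_totalPotential_le [Finite S] {m : ℕ} {U₀ : Interaction d S}
    {U : Fin m → Interaction d S} (E : Fin m → ℝ) (hU₀ : IsPotential U₀)
    (hU : ∀ α, IsPotential (U α)) (A : Finset (Site d)) (σ : Config d S) :
    |totalPotential U₀ U E A σ| ≤ unifNorm (U₀ A) + ∑ α, |E α| * unifNorm (U α A) := by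
  refine (abs_add_le _ _).trans (add_le_add (hU₀.abs_le A σ)
    ((Finset.abs_sum_le_sum_abs _ _).trans (Finset.sum_le_sum fun α _ => ?_)))
  rw [abs_mul]
  exact mul_le_mul_of_nonneg_left ((hU α).abs_le A σ) (abs_nonneg _)

theorem unifNorm_totalPotential_le [Finite S] {m : ℕ} {U₀ : Interaction d S}
    {U : Fin m → Interaction d S} (E : Fin m → ℝ) (hU₀ : IsPotential U₀)
    (hU : ∀ α, IsPotential (U α)) (A : Finset (Site d)) :
    unifNorm (totalPotential U₀ U E A) ≤ unifNorm (U₀ A) + ∑ α, |E α| * unifNorm (U α A) :=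
  unifNorm_le (add_nonneg (unifNorm_nonneg _) (Finset.sum_nonneg fun _ _ =>
    mul_nonneg (abs_nonneg _) (unifNorm_nonneg _))) (abs_totalPotential_le E hU₀ hU A)

theorem isPotential_totalPotential [Finite S] {m : ℕ} {U₀ : Interaction d S}
    {U : Fin m → Interaction d S} (E : Fin m → ℝ) (hU₀ : IsPotential U₀)
    (hU : ∀ α, IsPotential (U α)) : IsPotential (totalPotential U₀ U E) where
  empty σ := by simp [totalPotential, hU₀.empty, (hU _).empty]
  dep A σ η h := by
    simp only [totalPotential, hU₀.dep A σ η h]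
    congr 1
    exact Finset.sum_congr rfl fun α _ => by rw [(hU α).dep A σ η h]
  invariant A x η := by simp only [totalPotential, hU₀.invariant, (hU _).invariant]
  summable := Summable.of_nonneg_of_le (fun _ => unifNorm_nonneg _)
    (fun A => unifNorm_totalPotential_le E hU₀ hU A.1)
    (hU₀.summable.add (summable_sum fun α _ => (hU α).summable.mul_left _))

/-- The currents measure the difference of the site energies of `πU` and `U`. -/
theorem InvolutionFamily.IsImplementedBy.sum_mul_current [Finite S] {m : ℕ}
    {T : InvolutionFamily d S} {θ : Site d ≃+ Site d} {φ : S → S} (h : T.IsImplementedBy θ φ)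
    {U₀ : Interaction d S} {U : Fin m → Interaction d S} (E : Fin m → ℝ) (hU₀ : IsPotential U₀)
    (hU : ∀ α, IsPotential (U α))
    (hinv : ∀ (A : Finset (Site d)) (n : ℕ), A ⊆ cube d n →
      ∀ σ : Config d S, U₀ A (T.map n σ) = U₀ A σ) (σ : Config d S) :
    ∑ α, E α * T.current (U α) 0 σ =
      (siteEnergy (T.reflected θ (totalPotential U₀ U E)) σ -
        siteEnergy (totalPotential U₀ U E) σ) / 2 := by
  have hV := isPotential_totalPotential E hU₀ hU
  have hW := h.isPotential_reflected hV
  refine tendsto_nhds_unique (tendsto_finsetSum _ fun α _ =>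
    ((T.tendstoUniformly_current (hU α) 0).tendsto_at σ).const_mul (E α))
    ((((hW.tendsto_siteEnergy σ).sub (hV.tendsto_siteEnergy σ)).div_const 2).congr fun n => ?_)
  -- θ fixes the origin and preserves cardinalities, so the re-indexed potential can be replaced by
  -- πU in this sum.
  have h1 : ∑ A ∈ (cube d n).powerset, (if (0 : Site d) ∈ A then
      T.reflected θ (totalPotential U₀ U E) A σ / (A.card : ℝ) else 0) =
      ∑ A ∈ (cube d n).powerset, (if (0 : Site d) ∈ A then
        totalPotential U₀ U E A (T.map (cubeIndex A) σ) / (A.card : ℝ) else 0) := by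
    rw [← h.sum_powerset_cube n]
    refine Finset.sum_congr rfl fun A _ => ?_
    have h3 : (0 : Site d) ∈ θ.toEquiv.finsetCongr A ↔ 0 ∈ A := by
      rw [h.mem_finsetCongr, map_zero]
    have h4 : (θ.toEquiv.finsetCongr A).card = A.card := Finset.card_map _
    rw [← h.potential_eq hV, h4]
    simp only [h3, potential]
  rw [h1, ← Finset.sum_sub_distrib, Finset.sum_div]
  simp only [cubeCurrent, Finset.mul_sum]
  rw [Finset.sum_comm, Finset.sum_filter]
  refine Finset.sum_congr rfl fun A _ => ?_
  split_ifs with hA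
  -- The invariant part U⁰ cancels in the difference.
  · simp only [totalPotential, hinv A _ (subset_cube_cubeIndex A)]
    rw [← sub_div, add_sub_add_left_eq_sub, ← Finset.sum_sub_distrib, Finset.sum_div,
      Finset.sum_div]
    refine Finset.sum_congr rfl fun α _ => ?_
    have : (A.card : ℝ) ≠ 0 := by exact_mod_cast (Finset.card_pos.2 ⟨_, hA⟩).ne'
    field_simp
  · simp

theorem IsSmall.summable_starSum_lt [Finite S] {m : ℕ} {β : ℝ} (hβ : 0 ≤ β)
    {U₀ : Interaction d S} {U : Fin m → Interaction d S} {E : Fin m → ℝ} (hU₀ : IsPotential U₀)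
    (hU : ∀ α, IsPotential (U α)) (h : IsSmall β U₀ U E) :
    Summable ({A : Finset (Site d) | 0 ∈ A}.indicator
      fun A => ((A.card : ℝ) - 1) * unifNorm (totalPotential U₀ U E A)) ∧
    β * starSum (fun A => ((A.card : ℝ) - 1) * unifNorm (totalPotential U₀ U E A)) 0 < 1 := by
  obtain ⟨hs, hlt⟩ := h
  have hcard : ∀ A : {A : Finset (Site d) // (0 : Site d) ∈ A}, 0 ≤ (A.1.card : ℝ) - 1 :=
    fun A => by
      rw [sub_nonneg]
      exact_mod_cast Finset.card_pos.2 ⟨_, A.2⟩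
  have hle : ∀ A : {A : Finset (Site d) // (0 : Site d) ∈ A},
      ((A.1.card : ℝ) - 1) * unifNorm (totalPotential U₀ U E A.1) ≤
      ((A.1.card : ℝ) - 1) * (unifNorm (U₀ A.1) + ∑ α, |E α| * unifNorm (U α A.1)) := fun A =>
    mul_le_mul_of_nonneg_left (unifNorm_totalPotential_le E hU₀ hU A.1) (hcard A)
  have hs' : Summable fun A : {A : Finset (Site d) // (0 : Site d) ∈ A} =>
      ((A.1.card : ℝ) - 1) * unifNorm (totalPotential U₀ U E A.1) :=
    Summable.of_nonneg_of_le (fun A => mul_nonneg (hcard A) (unifNorm_nonneg _)) hle hs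
  refine ⟨summable_subtype_iff_indicator.1 hs', lt_of_le_of_lt ?_ hlt⟩
  refine mul_le_mul_of_nonneg_left ?_ hβ
  rw [starSum, ← tsum_subtype {A : Finset (Site d) | (0 : Site d) ∈ A}
    fun A => ((A.card : ℝ) - 1) * unifNorm (totalPotential U₀ U E A)]
  exact Summable.tsum_le_tsum hle hs' hs

/-- After subtraction of the supporting line, p has a minimum at 0. -/
theorem deriv_eq_of_forall_mul_le {p : ℝ → ℝ} {a : ℝ} (h : ∀ t, t * a ≤ p t - p 0)
    (hp : DifferentiableAt ℝ p 0) : deriv p 0 = a := by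
  have h1 : HasDerivAt (fun t => p t - t * a) (deriv p 0 - 1 * a) 0 :=
    hp.hasDerivAt.sub ((hasDerivAt_id (0 : ℝ)).mul_const a)
  have h2 : IsLocalMin (fun t => p t - t * a) 0 := Eventually.of_forall fun t => by
    have := h t
    simp only [zero_mul, sub_zero]
    linarith
  have h3 := h2.hasDerivAt_eq_zero h1
  linarith

end Involution

/-! ### The proposition -/

theorem proposition1 {d m : ℕ} {S : Type*} [Fintype S] [Nonempty S]
    [MeasurableSpace S] [DiscreteMeasurableSpace S]
    (T : InvolutionFamily d S) (β : ℝ) (hβ : 0 < β)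
    (U₀ : Interaction d S) (U : Fin m → Interaction d S) (E : Fin m → ℝ)
    (hU₀ : IsPotential U₀) (hU : ∀ α, IsPotential (U α))
    (hinv : ∀ (A : Finset (Site d)) (n : ℕ), A ⊆ cube d n →
      ∀ σ : Config d S, U₀ A (T.map n σ) = U₀ A σ)
    (μ : MeasureTheory.Measure (Config d S)) [MeasureTheory.IsProbabilityMeasure μ]
    (hμ : IsShiftInvariant μ)
    (hGibbs : IsGibbs β (totalPotential U₀ U E) μ)
    (hne : μ ≠ T.measure μ)
    (hphys : ¬ PhysicallyEquivalent (T.potential (totalPotential U₀ U E)) (totalPotential U₀ U E)) :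
    -- the currents are well defined, as uniform limits
    (∀ α x, TendstoUniformly (fun n σ => T.cubeCurrent (U α) x n σ)
      (fun σ => T.current (U α) x σ) Filter.atTop) ∧
    -- the relative entropy densities, and their positivity
    HasRelEntropyDensity (T.measure μ) μ (2 * β * ∑ α, E α * ∫ σ, T.current (U α) 0 σ ∂μ) ∧
    HasRelEntropyDensity μ (T.measure μ) (2 * β * ∑ α, E α * ∫ σ, T.current (U α) 0 σ ∂μ) ∧
    0 < 2 * β * ∑ α, E α * ∫ σ, T.current (U α) 0 σ ∂μ ∧
    -- the free energy densities P(U + t(πU - U)) exist as limits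
    (∀ t : ℝ, Filter.Tendsto
      (cubeFreeEnergy β fun A σ => totalPotential U₀ U E A σ +
        t * (T.potential (totalPotential U₀ U E) A σ - totalPotential U₀ U E A σ))
      Filter.atTop (nhds (T.freeEnergyPath β (totalPotential U₀ U E) t))) ∧
    -- the averaged current as a derivative, whenever the free energy is differentiable
    (DifferentiableAt ℝ (T.freeEnergyPath β (totalPotential U₀ U E)) 0 →
      ∑ α, E α * ∫ σ, T.current (U α) 0 σ ∂μ =
        -(1 / (2 * β)) * deriv (T.freeEnergyPath β (totalPotential U₀ U E)) 0) ∧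
    -- and in particular for small potentials
    (IsSmall β U₀ U E →
      DifferentiableAt ℝ (T.freeEnergyPath β (totalPotential U₀ U E)) 0 ∧
      ∑ α, E α * ∫ σ, T.current (U α) 0 σ ∂μ =
        -(1 / (2 * β)) * deriv (T.freeEnergyPath β (totalPotential U₀ U E)) 0) := by
  -- With a single spin value there is only one configuration, and πμ = μ.
  have hnt : Nontrivial S := by
    by_contra hS
    rw [not_nontrivial_iff_subsingleton] at hS
    refine hne ?_
    have : T.globalMap = id := funext fun σ => Subsingleton.elim _ _
    rw [InvolutionFamily.measure, this, Measure.map_id]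
  obtain ⟨θ, φ, h⟩ := T.exists_isImplementedBy
  set V := totalPotential U₀ U E with hVdef
  have hV : IsPotential V := isPotential_totalPotential E hU₀ hU
  have hW : IsPotential (T.reflected θ V) := h.isPotential_reflected hV
  have hG : GibbsSwap β V μ := hGibbs.gibbsSwap
  have hJ : 2 * ∑ α, E α * ∫ σ, T.current (U α) 0 σ ∂μ =
      ∫ σ, siteEnergy (T.reflected θ V) σ ∂μ - ∫ σ, siteEnergy V σ ∂μ := by
    rw [← integral_sub (hW.integrable_siteEnergy μ) (hV.integrable_siteEnergy μ)]
    simp_rw [← integral_const_mul]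
    rw [← integral_finsetSum _ fun α _ =>
      (T.integrable_current (hU α) 0 μ).const_mul (E α), ← integral_const_mul]
    refine integral_congr_ae (Eventually.of_forall fun σ => ?_)
    dsimp only
    rw [h.sum_mul_current E hU₀ hU hinv]
    ring
  have hs : 2 * β * ∑ α, E α * ∫ σ, T.current (U α) 0 σ ∂μ =
      β * (∫ σ, siteEnergy (T.reflected θ V) σ ∂μ - ∫ σ, siteEnergy V σ ∂μ) := by
    rw [← hJ]
    ring
  have hent := h.hasRelEntropyDensity hβ.le hV hμ hG
  have hD := hW.lin_comb hV 1 (-1)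
  have hpath : ∀ t, IsPotential fun A σ =>
      V A σ + t * (1 * T.reflected θ V A σ + -1 * V A σ) := fun t => by
    simpa only [one_mul] using hV.lin_comb hD 1 t
  have hlim : ∀ t : ℝ, Tendsto (cubeFreeEnergy β fun A σ => V A σ +
      t * (T.potential V A σ - V A σ)) atTop (𝓝 (T.freeEnergyPath β V t)) := fun t => by
    have heq := funext (h.cubeFreeEnergy_path hV β t)
    obtain ⟨P, hP⟩ := (hpath t).exists_tendsto_cubeFreeEnergy hβ.le
    rw [← heq] at hP
    exact tendsto_nhds_limUnder ⟨P, hP⟩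
  have hlim' : ∀ t : ℝ, Tendsto (cubeFreeEnergy β fun A σ => V A σ +
      t * (1 * T.reflected θ V A σ + -1 * V A σ)) atTop (𝓝 (T.freeEnergyPath β V t)) := fun t => by
    rw [← funext (h.cubeFreeEnergy_path hV β t)]
    exact hlim t
  have hlim0 : Tendsto (cubeFreeEnergy β V) atTop (𝓝 (T.freeEnergyPath β V 0)) := by
    simpa only [zero_mul, add_zero] using hlim' 0
  have hderiv : DifferentiableAt ℝ (T.freeEnergyPath β V) 0 →
      ∑ α, E α * ∫ σ, T.current (U α) 0 σ ∂μ =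
        -(1 / (2 * β)) * deriv (T.freeEnergyPath β V) 0 := fun hd => by
    -- By `hJ` this slope is -β μ(e_{πU} - e_U). The tangent inequality holds for t of both signs,
    -- which turns it into an equality of slopes.
    have h1 := deriv_eq_of_forall_mul_le (a := -β * (2 * ∑ α, E α * ∫ σ, T.current (U α) 0 σ ∂μ))
      (fun t => ?_) hd
    · rw [h1]
      field_simp
    · have h2 := hG.freeEnergy_tangent hV (hpath t) hβ.le hμ hlim0 (hlim' t)
      have h3 : ∀ σ, siteEnergy (fun A σ => V A σ +
          t * (1 * T.reflected θ V A σ + -1 * V A σ)) σ =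
          siteEnergy V σ + t * (siteEnergy (T.reflected θ V) σ - siteEnergy V σ) := fun σ => by
        have h4 := hV.siteEnergy_lin_comb hD 1 t σ
        rw [hW.siteEnergy_lin_comb hV] at h4
        simp only [one_mul] at h4 ⊢
        rw [h4]
        ring
      have hiV := hV.integrable_siteEnergy μ
      have hiW := hW.integrable_siteEnergy μ
      have hi : Integrable (fun σ => t * (siteEnergy (T.reflected θ V) σ - siteEnergy V σ)) μ :=
        (hiW.sub hiV).const_mul t
      simp only [h3] at h2
      rw [integral_add hiV hi, integral_const_mul,
        integral_sub hiW hiV, add_sub_cancel_left, ← hJ] at h2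
      linarith
  refine ⟨fun α x => T.tendstoUniformly_current (hU α) x, ?_, ?_, ?_, hlim, hderiv, fun hsm => ?_⟩
  · rw [hs]
    exact hent.1
  · rw [hs]
    exact hent.2
  · have := h.isProbabilityMeasure_measure μ
    rw [hs]
    -- The inequivalence passes to the re-indexed potential, since relative energies do not change
    -- under re-indexing.
    refine GibbsSwap.relEntropyDensity_pos hβ hV hW hμ (h.isShiftInvariant_measure hμ) hG
      (h.gibbsSwap_measure hG) (fun hpe => hphys fun σ η hση => ?_) hent.2
    rw [h.relEnergy_potential hV, hpe σ η hση]
  · obtain ⟨h1, h2⟩ := hsm.summable_starSum_lt hβ.le hU₀ hU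
    have hd := hV.differentiableAt_freeEnergy hD hβ.le h1 h2 hlim'
    exact ⟨hd, hderiv hd⟩
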